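/- Let $m\ge 0$, $\alpha,\beta\in\mathbb R$, let $z:[0,\infty)\to\mathbb R$ and $\lambda:[0,\infty)\to\mathbb C$ be continuously differentiable, and put $\Omega=\{(x,t)\in\mathbb R^2 : t\ge 0,\ x\ge z(t)\}$. Assume (H1) $z(0)=0$ and $-1<z'(t)<1$ for all $t\ge 0$; (H2) $|\lambda(t)|^2\,(1-z'(t))\le 1+z'(t)$ for all $t\ge 0$. Let $u_0,v_0\in H^1([0,\infty))$ be complex-valued (identified with their continuous representatives) with $u_0(0)=\lambda(0)v_0(0)$. Consider the initial boundary value problem $$ \begin{cases} i(u_t+u_x)=-mv+\alpha u|v|^2+2\beta v(\overline u v+u\overline v) & \text{in } \Omega,\\ i(v_t-v_x)=-mu+\alpha v|u|^2+2\beta u(\overline u v+u\overline v) & \text{in } \Omega,\\ u(x,0)=u_0(x),\quad v(x,0)=v_0(x) & x\ge 0,\\ u(z(t),t)=\lambda(t)\,v(z(t),t) & t\ge 0, \end{cases} $$ where for $u,v\in H^1_{loc}\cap C$ the equations are understood almost everywhere with weak derivatives and the initial and boundary conditions pointwise. Then this problem has a unique global solution $(u,v)$ in $H^1_{loc}(\Omega)\cap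 C(\overline\Omega)$. Here $u,v$ and their weak first derivatives are square integrable on every compact subset of $\Omega$ (which contains its boundary), and uniqueness holds even among all solutions that are continuous on $\overline\Omega$ and belong to $H^1_{loc}$ of the interior of $\Omega$. Moreover, for every $t\ge 0$, $$u(\cdot,t),\ v(\cdot,t)\in H^1([z(t),\infty)).$$ -/

import Mathlib

open MeasureTheory Set
open scoped ContDiff

namespace Dirac

noncomputable section

/-- `g` is the weak (distributional) derivative of `f` in the direction `w` on the open set `U`:
both are locally integrable on `U`, and `∫_U (∂_w φ) f = - ∫_U φ g` for every real-valued
test function `φ ∈ C_c^∞(U)`. -/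
def HasWeakDeriv {E : Type*} [NormedAddCommGroup E] [NormedSpace ℝ E] [MeasureSpace E]
    (U : Set E) (w : E) (f g : E → ℂ) : Prop :=
  LocallyIntegrableOn f U ∧ LocallyIntegrableOn g U ∧
    ∀ φ : E → ℝ, ContDiff ℝ ∞ φ → HasCompactSupport φ → tsupport φ ⊆ U →
      ∫ x in U, (fderiv ℝ φ x w) • f x = - ∫ x in U, φ x • g x

/-- `f ∈ L²_loc(S)`: `f` is square integrable on every compact subset of `S`. -/
def MemL2Loc (S : Set (ℝ × ℝ)) (f : ℝ × ℝ → ℂ) : Prop :=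
  ∀ K : Set (ℝ × ℝ), IsCompact K → K ⊆ S → MemLp f 2 (volume.restrict K)

/-- `f ∈ H¹_loc(S)` for a set `S` of points `(x, t)`, open or with (part of) its boundary:
`f` has weak derivatives `f_x`, `f_t` in the interior of `S`, and `f`, `f_x`, `f_t` are square
integrable on every compact subset of `S`. -/
def MemH1Loc (S : Set (ℝ × ℝ)) (f : ℝ × ℝ → ℂ) : Prop :=
  ∃ fx ft : ℝ × ℝ → ℂ,
    HasWeakDeriv (interior S) (1, 0) f fx ∧ HasWeakDeriv (interior S) (0, 1) f ft ∧
      MemL2Loc S f ∧ MemL2Loc S fx ∧ MemL2Loc S ft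

/-- `f ∈ H¹([a, ∞))`: `f` and its weak derivative on `(a, ∞)` are square integrable. -/
def MemH1HalfLine (a : ℝ) (f : ℝ → ℂ) : Prop :=
  ∃ g : ℝ → ℂ, HasWeakDeriv (Ioi a) (1 : ℝ) f g ∧
    MemLp f 2 (volume.restrict (Ioi a)) ∧ MemLp g 2 (volume.restrict (Ioi a))

/-- The closed domain `Ω = {(x, t) | t ≥ 0, x ≥ z(t)}`; a point `p` is `(x, t)`. -/
def Omega (z : ℝ → ℝ) : Set (ℝ × ℝ) := {p | 0 ≤ p.2 ∧ z p.2 ≤ p.1}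

/-- `N₁(u, v) = α u |v|² + 2 β v (ū v + u v̄)`. -/
def N₁ (α β : ℝ) (u v : ℂ) : ℂ :=
  α * u * (‖v‖ : ℂ) ^ 2 + 2 * β * v * (star u * v + u * star v)

/-- `N₂(u, v) = α v |u|² + 2 β u (ū v + u v̄)`. -/
def N₂ (α β : ℝ) (u v : ℂ) : ℂ :=
  α * v * (‖u‖ : ℂ) ^ 2 + 2 * β * u * (star u * v + u * star v)

/-- The system
`i (u_t + u_x) = - m v + N₁(u, v)`, `i (v_t - v_x) = - m u + N₂(u, v)`
holds almost everywhere in `U`, the derivatives being weak derivatives on `U`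
which are locally square integrable there. -/
def SolvesDirac (m α β : ℝ) (U : Set (ℝ × ℝ)) (u v : ℝ × ℝ → ℂ) : Prop :=
  ∃ ux ut vx vt : ℝ × ℝ → ℂ,
    (HasWeakDeriv U (1, 0) u ux ∧ HasWeakDeriv U (0, 1) u ut ∧
      HasWeakDeriv U (1, 0) v vx ∧ HasWeakDeriv U (0, 1) v vt) ∧
    (MemL2Loc U ux ∧ MemL2Loc U ut ∧ MemL2Loc U vx ∧ MemL2Loc U vt) ∧
    (∀ᵐ p ∂(volume.restrict U),
      Complex.I * (ut p + ux p) = -(m : ℂ) * v p + N₁ α β (u p) (v p)) ∧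
    (∀ᵐ p ∂(volume.restrict U),
      Complex.I * (vt p - vx p) = -(m : ℂ) * u p + N₂ α β (u p) (v p))

/-- `(u, v)` is a global solution of the initial boundary value problem which is continuous up to
the boundary of `Ω` and belongs to `H¹_loc` in the interior of `Ω`; the initial and the boundary
condition hold pointwise. -/
structure IsGlobalSolution (m α β : ℝ) (z : ℝ → ℝ) (lam : ℝ → ℂ) (u₀ v₀ : ℝ → ℂ)
    (u v : ℝ × ℝ → ℂ) : Prop where
  continuousOn_u : ContinuousOn u (Omega z)
  continuousOn_v : ContinuousOn v (Omega z)
  memH1Loc_u : MemH1Loc (interior (Omega z)) u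
  memH1Loc_v : MemH1Loc (interior (Omega z)) v
  equation : SolvesDirac m α β (interior (Omega z)) u v
  initial : ∀ x : ℝ, 0 ≤ x → u (x, 0) = u₀ x ∧ v (x, 0) = v₀ x
  boundary : ∀ t : ℝ, 0 ≤ t → u (z t, t) = lam t * v (z t, t)

end

end Dirac

set_option linter.unusedSectionVars false

/-! The principal part is diagonal: `u` is transported along (1, 1) and `v` along (-1, 1). A
solution continuous up to the boundary therefore satisfies integral equations along characteristics
(`isCharSol_of_isGlobalSolution`). As the curve is slower than both families, a `v`-characteristic
followed backwards reaches t = 0, and a `u`-characteristic followed backwards reaches either t = 0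
or the curve, where the boundary condition gives `u` in terms of `v`. Uniqueness is a weighted
Gronwall argument on compact domains of dependence (`IsCharSol.eqOn`).

Existence on 0 ≤ t ≤ T: truncate the nonlinearity by a radial retraction, solve the resulting
globally Lipschitz problem by a contraction (`exists_transport`), and show that the solution stays
below a bound independent of the truncation (`exists_bound_transport`). The bound has two sources.
The charge |u|² + |v|² is conserved in the interior, and (H2) says that the boundary creates none;
balanced over regions bounded by characteristics, it controls ∫|u|² along `v`-characteristics and
∫|v|² along `u`-characteristics. Moreover the derivative of |u|² along its own characteristic is at
most (m + 4|β||v|²)|u|² + m|v|², without a term |u|⁴, and symmetrically for `v`, so that Gronwall's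
inequality closes. Strip solutions are then glued by uniqueness.

For the H¹ regularity, |f'|² ∈ L¹ is encoded as |f(y) - f(x)|² ≤ (y - x)(E(y) - E(x)) with `E` of
bounded total increment (`SqModulusOn`). This is stable under concatenation of paths and yields a
square integrable weak derivative. For `v`, a horizontal increment is a step in the direction (1, 1)
followed by a step along a `v`-characteristic; steps in the direction (1, 1) propagate along
`v`-characteristics with a source that needs only the increments of `u` along its own
characteristics, so no regularity of `u` enters (`IsStripSol.sqModulusOn_v`). For `u`, horizontal
increments propagate from the initial line or from the curve, where they are reduced to those of `v`
and of the coefficients (`IsStripSol.exists_modulus`). Time derivatives come from the equations. -/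

namespace Dirac

/-! ### Weak directional derivatives and integration along segments -/

section WeakDeriv

variable {E : Type*} [NormedAddCommGroup E] [NormedSpace ℝ E] [MeasureSpace E] [BorelSpace E]

theorem integrableOn_smul_of_tsupport_subset {U : Set E} (hU : MeasurableSet U) {f : E → ℂ}
    (hf : LocallyIntegrableOn f U) {ψ : E → ℝ} (hψ : Continuous ψ) (hc : HasCompactSupport ψ)
    (hs : tsupport ψ ⊆ U) : IntegrableOn (fun x => ψ x • f x) U := by
  have h1 : IntegrableOn f (tsupport ψ) := hf.integrableOn_compact_subset hs hc
  have h2 : IntegrableOn (fun x => ψ x • f x) (tsupport ψ) :=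
    h1.continuousOn_smul hψ.continuousOn hc
  refine h2.of_forall_sdiff_eq_zero hU fun x hx => ?_
  simp [image_eq_zero_of_notMem_tsupport hx.2]

theorem continuous_fderiv_apply_const {φ : E → ℝ} (hφ : ContDiff ℝ ∞ φ) (w : E) :
    Continuous (fun x => fderiv ℝ φ x w) :=
  (hφ.continuous_fderiv (by simp)).clm_apply continuous_const

theorem HasWeakDeriv.add_dir {U : Set E} (hU : MeasurableSet U) {w₁ w₂ : E} {f g₁ g₂ : E → ℂ}
    (h₁ : HasWeakDeriv U w₁ f g₁) (h₂ : HasWeakDeriv U w₂ f g₂) :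
    HasWeakDeriv U (w₁ + w₂) f (g₁ + g₂) := by
  refine ⟨h₁.1, h₁.2.1.add h₂.2.1, fun φ hφ hc hs => ?_⟩
  have i (w : E) : IntegrableOn (fun x => (fderiv ℝ φ x w) • f x) U :=
    integrableOn_smul_of_tsupport_subset hU h₁.1 (continuous_fderiv_apply_const hφ w)
      (hc.fderiv_apply ℝ w) ((tsupport_fderiv_apply_subset ℝ w).trans hs)
  simp only [map_add, add_smul, Pi.add_apply, smul_add]
  rw [integral_add (i w₁) (i w₂), integral_add
    (integrableOn_smul_of_tsupport_subset hU h₁.2.1 hφ.continuous hc hs)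
    (integrableOn_smul_of_tsupport_subset hU h₂.2.1 hφ.continuous hc hs),
    h₁.2.2 φ hφ hc hs, h₂.2.2 φ hφ hc hs, neg_add]

theorem HasWeakDeriv.neg_dir {U : Set E} {w : E} {f g : E → ℂ}
    (h : HasWeakDeriv U w f g) : HasWeakDeriv U (-w) f (-g) := by
  refine ⟨h.1, h.2.1.neg, fun φ hφ hc hs => ?_⟩
  simp only [map_neg, neg_smul, Pi.neg_apply, smul_neg, integral_neg, h.2.2 φ hφ hc hs]

theorem HasWeakDeriv.sub {U : Set E} (hU : MeasurableSet U) {w : E} {f₁ f₂ g₁ g₂ : E → ℂ}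
    (h₁ : HasWeakDeriv U w f₁ g₁) (h₂ : HasWeakDeriv U w f₂ g₂) :
    HasWeakDeriv U w (f₁ - f₂) (g₁ - g₂) := by
  refine ⟨h₁.1.sub h₂.1, h₁.2.1.sub h₂.2.1, fun φ hφ hc hs => ?_⟩
  have i (f) (hf : LocallyIntegrableOn f U) :
      IntegrableOn (fun x => (fderiv ℝ φ x w) • f x) U :=
    integrableOn_smul_of_tsupport_subset hU hf (continuous_fderiv_apply_const hφ w)
      (hc.fderiv_apply ℝ w) ((tsupport_fderiv_apply_subset ℝ w).trans hs)
  simp only [Pi.sub_apply, smul_sub]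
  rw [integral_sub (i _ h₁.1) (i _ h₂.1), integral_sub
    (integrableOn_smul_of_tsupport_subset hU h₁.2.1 hφ.continuous hc hs)
    (integrableOn_smul_of_tsupport_subset hU h₂.2.1 hφ.continuous hc hs),
    h₁.2.2 φ hφ hc hs, h₂.2.2 φ hφ hc hs]
  abel

theorem HasWeakDeriv.congr {U : Set E} {w : E} {f f' g g' : E → ℂ}
    (h : HasWeakDeriv U w f g) (hf : f =ᵐ[volume.restrict U] f')
    (hg : g =ᵐ[volume.restrict U] g') : HasWeakDeriv U w f' g' := by
  refine ⟨h.1.congr hf, h.2.1.congr hg, fun φ hφ hc hs => ?_⟩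
  have e1 : ∫ x in U, (fderiv ℝ φ x w) • f' x = ∫ x in U, (fderiv ℝ φ x w) • f x :=
    integral_congr_ae (hf.mono fun x hx => by simp only [hx])
  have e2 : ∫ x in U, φ x • g' x = ∫ x in U, φ x • g x :=
    integral_congr_ae (hg.mono fun x hx => by simp only [hx])
  rw [e1, e2, h.2.2 φ hφ hc hs]

theorem setIntegral_smul_eq_integral {U : Set E} {φ : E → ℝ} (hs : tsupport φ ⊆ U) (f : E → ℂ) :
    ∫ x in U, φ x • f x = ∫ x, φ x • f x :=
  setIntegral_eq_integral_of_forall_compl_eq_zero fun x hx => by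
    simp [image_eq_zero_of_notMem_tsupport fun h => hx (hs h)]

theorem setIntegral_fderiv_smul_eq_integral {U : Set E} {φ : E → ℝ} (hs : tsupport φ ⊆ U) (w : E)
    (f : E → ℂ) : ∫ x in U, (fderiv ℝ φ x w) • f x = ∫ x, (fderiv ℝ φ x w) • f x :=
  setIntegral_smul_eq_integral (φ := fun x => fderiv ℝ φ x w)
    ((tsupport_fderiv_apply_subset ℝ w).trans hs) f

theorem HasWeakDeriv.mono {U V : Set E} {w : E} {f g : E → ℂ} (h : HasWeakDeriv V w f g)
    (hUV : U ⊆ V) : HasWeakDeriv U w f g := by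
  refine ⟨h.1.mono_set hUV, h.2.1.mono_set hUV, fun φ hφ hc hs => ?_⟩
  have := h.2.2 φ hφ hc (hs.trans hUV)
  rw [setIntegral_fderiv_smul_eq_integral (hs.trans hUV),
    setIntegral_smul_eq_integral (hs.trans hUV)] at this
  rw [setIntegral_fderiv_smul_eq_integral hs, setIntegral_smul_eq_integral hs, this]

variable [FiniteDimensional ℝ E] [(volume : Measure E).IsAddHaarMeasure]

/-- The integral is the convolution of `f` with the reflected function `χ`, evaluated at `r • w`;
all smoothness comes from `ψ`, and `f` need only be continuous. -/
theorem hasDerivAt_integral_translate_smul {ψ : E → ℝ} (hψ : ContDiff ℝ ∞ ψ)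
    (hc : HasCompactSupport ψ) {f : E → ℂ} (hf : Continuous f) (w : E) (r : ℝ) :
    HasDerivAt (fun r : ℝ => ∫ y, ψ (y - r • w) • f y)
      (-∫ y, (fderiv ℝ (fun y => ψ (y - r • w)) y w) • f y) r := by
  set L : ℂ →L[ℝ] ℝ →L[ℝ] ℂ := (ContinuousLinearMap.lsmul ℝ ℝ).flip
  set χ : E → ℝ := fun x => ψ (-x) with hχdef
  have hχ : ContDiff ℝ ∞ χ := hψ.comp contDiff_neg
  have hχc : HasCompactSupport χ := hc.comp_homeomorph (Homeomorph.neg E)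
  have hχ' : ∀ x, fderiv ℝ χ x w = - fderiv ℝ ψ (-x) w := fun x => by
    have : HasFDerivAt χ ((fderiv ℝ ψ (-x)).comp (-ContinuousLinearMap.id ℝ E)) x :=
      ((hψ.differentiable (by simp)) (-x)).hasFDerivAt.comp x (hasFDerivAt_id x).neg
    rw [this.fderiv]; simp
  have h1 := HasCompactSupport.hasFDerivAt_convolution_right (μ := volume) L hχc
    hf.locallyIntegrable (hχ.of_le (by exact_mod_cast le_top)) (r • w)
  have hlin : HasDerivAt (fun r : ℝ => r • w) w r := by
    simpa using (hasDerivAt_id r).smul_const w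
  have h2 := h1.comp_hasDerivAt r hlin
  rw [convolution_precompR_apply L hf.locallyIntegrable (hχc.fderiv ℝ)
    (hχ.continuous_fderiv (by simp))] at h2
  have e : convolution f χ L volume ∘ (fun r : ℝ => r • w) =
      fun r : ℝ => ∫ y, ψ (y - r • w) • f y := by
    ext r
    simp [convolution, hχdef, L]
  rw [e] at h2
  have e' : convolution f (fun a => fderiv ℝ χ a w) L volume (r • w) =
      -∫ y, (fderiv ℝ (fun y => ψ (y - r • w)) y w) • f y := by
    simp only [convolution, hχ']
    rw [← integral_neg]
    refine integral_congr_ae (.of_forall fun y => ?_)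
    simp only [fderiv_comp_sub, L, ContinuousLinearMap.flip_apply, ContinuousLinearMap.lsmul_apply,
      neg_sub, neg_smul]
  exact e' ▸ h2

theorem tsupport_comp_sub (ψ : E → ℝ) (a : E) {x : E} (hx : x ∈ tsupport (fun y => ψ (y - a))) :
    x - a ∈ tsupport ψ :=
  tsupport_comp_subset_preimage ψ (f := fun y => y - a) (by fun_prop) hx

/-- Against a test function `ψ`, the translates of `f` have r-derivative `∫ ψ y • g (y + r • w)`.
Integrating in `r` and exchanging integrals shows that the defect `D` is orthogonal to every `ψ`,
hence zero almost everywhere, hence zero by continuity. -/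
theorem HasWeakDeriv.sub_eq_integral {U : Set E} (hU : IsOpen U) {w : E} {f g : E → ℂ}
    (hf : Continuous f) (hg : Continuous g) (h : HasWeakDeriv U w f g) {p : E} {s : ℝ}
    (hs : 0 ≤ s) (hseg : ∀ r ∈ Icc 0 s, p + r • w ∈ U) :
    f (p + s • w) - f p = ∫ r in (0:ℝ)..s, g (p + r • w) := by
  -- Starting points whose whole segment stays in `U`. Compactness of [0, s] makes this set open,
  -- and translates of test functions supported in it are admissible on `U`.
  set V : Set E := {y | ∀ r ∈ Icc 0 s, y + r • w ∈ U} with hV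
  have hVo : IsOpen V := by
    rw [isOpen_iff_eventually]
    intro y hy
    refine isCompact_Icc.eventually_forall_of_forall_eventually fun r hr => ?_
    exact (hU.preimage (f := fun q : E × ℝ => q.1 + q.2 • w) (by fun_prop)).eventually_mem (hy r hr)
  set D : E → ℂ := fun y => f (y + s • w) - f y - ∫ r in (0:ℝ)..s, g (y + r • w) with hD
  have hIc : Continuous fun y => ∫ r in (0:ℝ)..s, g (y + r • w) :=
    intervalIntegral.continuous_parametric_intervalIntegral_of_continuous
      (by fun_prop) continuous_const
  have hDc : Continuous D := by fun_prop
  have key : ∀ ψ : E → ℝ, ContDiff ℝ ∞ ψ → HasCompactSupport ψ → tsupport ψ ⊆ V →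
      ∫ y, ψ y • D y = 0 := by
    intro ψ hψ hc hsupp
    have hcs (a : E) : HasCompactSupport (fun y => ψ (y - a)) :=
      hc.comp_homeomorph (Homeomorph.subRight a)
    have hderiv : ∀ r ∈ uIcc 0 s, HasDerivAt (fun r : ℝ => ∫ y, ψ (y - r • w) • f y)
        (∫ y, ψ y • g (y + r • w)) r := by
      intro r hr
      rw [uIcc_of_le hs] at hr
      have h1 := hasDerivAt_integral_translate_smul hψ hc hf w r
      have hsub : tsupport (fun y => ψ (y - r • w)) ⊆ U := fun x hx => by
        have := hsupp (tsupport_comp_sub ψ _ hx) r hr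
        simpa using this
      have h2 := h.2.2 (fun y => ψ (y - r • w)) (hψ.comp (contDiff_id.sub contDiff_const)) (hcs _)
        hsub
      rw [setIntegral_fderiv_smul_eq_integral hsub, setIntegral_smul_eq_integral hsub] at h2
      rw [h2, neg_neg] at h1
      convert h1 using 1
      rw [← integral_sub_right_eq_self (fun y => ψ y • g (y + r • w)) (r • w)]
      simp
    have hprod : IntegrableOn (Function.uncurry fun (r : ℝ) (y : E) => ψ y • g (y + r • w))
        (Icc 0 s ×ˢ tsupport ψ) (volume.prod volume) := by
      refine ContinuousOn.integrableOn_compact (isCompact_Icc.prod hc) ?_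
      have := hψ.continuous
      simp only [Function.uncurry_def]
      fun_prop
    have hprod' : Integrable (Function.uncurry fun (r : ℝ) (y : E) => ψ y • g (y + r • w))
        ((volume.restrict (uIoc 0 s)).prod volume) := by
      have : IntegrableOn (Function.uncurry fun (r : ℝ) (y : E) => ψ y • g (y + r • w))
          (uIoc 0 s ×ˢ univ) (volume.prod volume) := by
        refine (hprod.mono_set (prod_mono_left (s₁ := uIoc 0 s) ?_)).of_forall_sdiff_eq_zero
          (measurableSet_uIoc.prod MeasurableSet.univ) ?_
        · rw [uIoc_of_le hs]; exact Ioc_subset_Icc_self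
        · rintro ⟨r, y⟩ ⟨hx1, hx2⟩
          have : y ∉ tsupport ψ := fun hy => hx2 ⟨hx1.1, hy⟩
          simp [Function.uncurry, image_eq_zero_of_notMem_tsupport this]
      rwa [IntegrableOn, ← Measure.prod_restrict, Measure.restrict_univ] at this
    have hswap := intervalIntegral_integral_swap hprod'
    have hint : IntervalIntegrable (fun r : ℝ => ∫ y, ψ y • g (y + r • w)) volume 0 s := by
      rw [intervalIntegrable_iff]
      exact hprod'.integral_prod_left
    have hftc := intervalIntegral.integral_eq_sub_of_hasDerivAt hderiv hint
    rw [hswap] at hftc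
    have e1 : ∫ y, ψ (y - s • w) • f y = ∫ y, ψ y • f (y + s • w) := by
      rw [← integral_sub_right_eq_self (fun y => ψ y • f (y + s • w)) (s • w)]; simp
    have hψc := hψ.continuous
    have I1 : Integrable fun y => ψ y • f (y + s • w) :=
      Continuous.integrable_of_hasCompactSupport (by fun_prop) hc.smul_right
    have I2 : Integrable fun y => ψ y • f y :=
      Continuous.integrable_of_hasCompactSupport (by fun_prop) hc.smul_right
    have I3 : Integrable fun y => ψ y • ∫ r in (0:ℝ)..s, g (y + r • w) :=
      Continuous.integrable_of_hasCompactSupport (by fun_prop) hc.smul_right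
    simp only [hD, smul_sub]
    rw [integral_sub (f := fun y => ψ y • f (y + s • w) - ψ y • f y) (I1.sub I2) I3,
      integral_sub I1 I2]
    simp only [intervalIntegral.integral_smul, zero_smul, sub_zero] at hftc
    rw [hftc, e1, sub_self]
  have hae := hVo.ae_eq_zero_of_integral_contDiff_smul_eq_zero
    (hDc.locallyIntegrable.locallyIntegrableOn V) key
  have h0 : EqOn D 0 V := by
    refine Measure.eqOn_open_of_ae_eq (μ := volume) ?_ hVo hDc.continuousOn continuousOn_const
    exact (ae_restrict_iff' hVo.measurableSet).2 hae
  have := h0 (x := p) hseg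
  simpa [hD, sub_eq_zero] using this

/-- The function r ↦ ∫ φ(y - rw) f(y) dy is differentiated at 0 in two ways: on `φ`, and, after a
change of variables, under the integral sign on `f`. -/
theorem hasWeakDeriv_of_hasDerivAt {U : Set E} (hU : IsOpen U) {w : E} {f g : E → ℂ}
    (hf : Continuous f) (hg : Continuous g)
    (h : ∀ p ∈ U, HasDerivAt (fun r : ℝ => f (p + r • w)) (g p) 0) : HasWeakDeriv U w f g := by
  refine ⟨hf.locallyIntegrable.locallyIntegrableOn U, hg.locallyIntegrable.locallyIntegrableOn U,
    fun φ hφ hc hs => ?_⟩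
  rw [setIntegral_fderiv_smul_eq_integral hs, setIntegral_smul_eq_integral hs]
  have h1 := hasDerivAt_integral_translate_smul hφ hc hf w 0
  have e (r : ℝ) : ∫ y, φ (y - r • w) • f y = ∫ y in tsupport φ, φ y • f (y + r • w) := by
    rw [setIntegral_smul_eq_integral subset_rfl,
      ← integral_sub_right_eq_self (fun y => φ y • f (y + r • w)) (r • w)]; simp
  simp only [e, zero_smul, sub_zero] at h1
  have hnear : ∀ᶠ r : ℝ in nhds 0, ∀ y ∈ tsupport φ, y + r • w ∈ U := by
    refine IsCompact.eventually_forall_of_forall_eventually hc fun y hy => ?_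
    refine (hU.preimage (f := fun q : ℝ × E => q.2 + q.1 • w) (by fun_prop)).eventually_mem ?_
    simpa using hs hy
  obtain ⟨ε, hε, hball⟩ := Metric.eventually_nhds_iff_ball.1 hnear
  have hφc := hφ.continuous
  obtain ⟨C, hC⟩ := ((isCompact_closedBall (0:ℝ) ε).prod hc).exists_bound_of_continuousOn
    (f := fun q : ℝ × E => φ q.2 • g (q.2 + q.1 • w)) (by fun_prop)
  have hms : MeasurableSet (tsupport φ) := (isClosed_tsupport φ).measurableSet
  have h2 := (hasDerivAt_integral_of_dominated_loc_of_deriv_le (μ := volume.restrict (tsupport φ))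
    (F := fun (r : ℝ) y => φ y • f (y + r • w)) (F' := fun (r : ℝ) y => φ y • g (y + r • w))
    (x₀ := 0) (s := Metric.ball 0 ε) (bound := fun _ => C) (Metric.ball_mem_nhds _ hε)
    (.of_forall fun r => (by fun_prop : Continuous _).aestronglyMeasurable)
    ((by fun_prop : Continuous _).continuousOn.integrableOn_compact hc)
    ((by fun_prop : Continuous _).aestronglyMeasurable)
    ((ae_restrict_iff' hms).2 (.of_forall fun y hy r hr =>
      hC (r, y) ⟨Metric.ball_subset_closedBall hr, hy⟩))
    (by
      have : IsFiniteMeasure (volume.restrict (tsupport φ)) :=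
        ⟨by rw [Measure.restrict_apply_univ]; exact IsCompact.measure_lt_top hc⟩
      exact integrable_const C)
    ((ae_restrict_iff' hms).2 (.of_forall fun y hy r hr => by
      have h3 := h _ (hball r hr y hy)
      have h4 : HasDerivAt (fun r' : ℝ => f (y + r • w + (r' - r) • w)) (g (y + r • w)) r := by
        have := HasDerivAt.comp_sub_const (x := r) (a := r)
          (f := fun r' : ℝ => f (y + r • w + r' • w)) (f' := g (y + r • w)) (by simpa using h3)
        exact this
      have h5 : (fun r' : ℝ => f (y + r • w + (r' - r) • w)) = fun r' => f (y + r' • w) := by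
        ext r'; congr 1; rw [sub_smul]; abel
      rw [h5] at h4
      exact h4.const_smul (φ y)))).2
  have h3 := h1.unique h2
  simp only [zero_smul, add_zero] at h3
  rw [setIntegral_smul_eq_integral subset_rfl] at h3
  rw [← h3, neg_neg]

end WeakDeriv

/-! ### Square moduli of continuity -/

/-- The increments of `f` are controlled by those of `E`: this expresses `|f'|² ≤ E'` without
derivatives, and forces `E` to be monotone. -/
def SqModulusOn {F : Type*} [NormedAddCommGroup F] (s : Set ℝ) (f : ℝ → F) (E : ℝ → ℝ) : Prop :=
  ∀ x ∈ s, ∀ y ∈ s, x ≤ y → ‖f y - f x‖ ^ 2 ≤ (y - x) * (E y - E x)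

section Modulus

variable {F : Type*} [NormedAddCommGroup F] {f : ℝ → F} {E : ℝ → ℝ}

theorem SqModulusOn.monotoneOn {s : Set ℝ} (h : SqModulusOn s f E) : MonotoneOn E s := by
  intro x hx y hy hxy
  rcases hxy.eq_or_lt with rfl | hlt
  · exact le_rfl
  · have := (sq_nonneg _).trans (h x hx y hy hxy)
    have := nonneg_of_mul_nonneg_right this (sub_pos.2 hlt)
    linarith

theorem SqModulusOn.monotone (h : SqModulusOn univ f E) : Monotone E :=
  monotoneOn_univ.1 h.monotoneOn

/-- Cauchy–Schwarz in the plane: the cross term satisfies (ab)² ≤ (d₁e₂)(d₂e₁), and the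
arithmetic–geometric mean inequality does the rest. This is why square moduli concatenate without
loss of constant. -/
theorem sq_add_le_mul_add {a b d₁ d₂ e₁ e₂ : ℝ} (hd₁ : 0 ≤ d₁) (hd₂ : 0 ≤ d₂) (he₁ : 0 ≤ e₁)
    (he₂ : 0 ≤ e₂) (h₁ : a ^ 2 ≤ d₁ * e₁) (h₂ : b ^ 2 ≤ d₂ * e₂) :
    (a + b) ^ 2 ≤ (d₁ + d₂) * (e₁ + e₂) := by
  have h3 : (a * b) ^ 2 ≤ ((d₁ * e₂ + d₂ * e₁) / 2) ^ 2 := by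
    have : (a * b) ^ 2 ≤ (d₁ * e₁) * (d₂ * e₂) := by
      rw [mul_pow]; gcongr
    nlinarith [sq_nonneg (d₁ * e₂ - d₂ * e₁)]
  have h4 : a * b ≤ (d₁ * e₂ + d₂ * e₁) / 2 :=
    (le_abs_self _).trans (abs_le_of_sq_le_sq h3 (by positivity))
  nlinarith

theorem SqModulusOn.norm_sub_sq_le_of_mid {x y w : ℝ} (hxy : x ≤ y) (hyw : y ≤ w)
    (hE₁ : E x ≤ E y) (hE₂ : E y ≤ E w) (h₁ : ‖f y - f x‖ ^ 2 ≤ (y - x) * (E y - E x))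
    (h₂ : ‖f w - f y‖ ^ 2 ≤ (w - y) * (E w - E y)) :
    ‖f w - f x‖ ^ 2 ≤ (w - x) * (E w - E x) := by
  have h3 := sq_add_le_mul_add (sub_nonneg.2 hxy) (sub_nonneg.2 hyw) (sub_nonneg.2 hE₁)
    (sub_nonneg.2 hE₂) h₁ h₂
  have h4 : ‖f w - f x‖ ≤ ‖f y - f x‖ + ‖f w - f y‖ := by
    have : f w - f x = (f y - f x) + (f w - f y) := by abel
    rw [this]; exact norm_add_le _ _
  calc ‖f w - f x‖ ^ 2 ≤ (‖f y - f x‖ + ‖f w - f y‖) ^ 2 := by gcongr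
    _ ≤ _ := h3
    _ = _ := by ring

theorem SqModulusOn.union {a : ℝ} {s t : Set ℝ} (hs : SqModulusOn s f E) (ht : SqModulusOn t f E)
    (has : a ∈ s) (hat : a ∈ t) (hsa : ∀ x ∈ s, x ≤ a) (hta : ∀ x ∈ t, a ≤ x) :
    SqModulusOn (s ∪ t) f E := by
  rintro x (hx | hx) y (hy | hy) hxy
  · exact hs x hx y hy hxy
  · exact norm_sub_sq_le_of_mid (hsa x hx) (hta y hy) (hs.monotoneOn hx has (hsa x hx))
      (ht.monotoneOn hat hy (hta y hy)) (hs x hx a has (hsa x hx)) (ht a hat y hy (hta y hy))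
  · obtain rfl : x = y := le_antisymm hxy ((hsa y hy).trans (hta x hx))
    simp
  · exact ht x hx y hy hxy

/-- Increments need only be estimated at short range: a long interval is cut into steps of length
`η`, whose nodes stay in `s` by order-connectedness. -/
theorem sqModulusOn_of_step {s : Set ℝ} (hs : s.OrdConnected) {η : ℝ} (hη : 0 < η)
    (h : ∀ x ∈ s, ∀ y ∈ s, x ≤ y → y ≤ x + η → ‖f y - f x‖ ^ 2 ≤ (y - x) * (E y - E x)) :
    SqModulusOn s f E := by
  have mono : ∀ x ∈ s, ∀ y ∈ s, x ≤ y → y ≤ x + η → E x ≤ E y := by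
    intro x hx y hy hxy hy1
    rcases hxy.eq_or_lt with rfl | hlt
    · exact le_rfl
    · have := nonneg_of_mul_nonneg_right ((sq_nonneg _).trans (h x hx y hy hxy hy1))
        (sub_pos.2 hlt)
      linarith
  have key : ∀ n : ℕ, ∀ x ∈ s, ∀ y ∈ s, x ≤ y → y ≤ x + n * η →
      E x ≤ E y ∧ ‖f y - f x‖ ^ 2 ≤ (y - x) * (E y - E x) := by
    intro n
    induction n with
    | zero =>
      intro x hx y hy hxy hy1
      obtain rfl : x = y := le_antisymm hxy (by simpa using hy1)
      simp
    | succ n ih =>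
      intro x hx y hy hxy hy1
      rcases le_total y (x + η) with h1 | h1
      · exact ⟨mono x hx y hy hxy h1, h x hx y hy hxy h1⟩
      · have hm : x + η ∈ s := hs.out hx hy ⟨by linarith, h1⟩
        have h2 := ih (x + η) hm y hy h1 (by push_cast at hy1; linarith)
        have h3 := mono x hx _ hm (by linarith) le_rfl
        exact ⟨h3.trans h2.1, SqModulusOn.norm_sub_sq_le_of_mid (by linarith) h1 h3 h2.1
          (h x hx _ hm (by linarith) le_rfl) h2.2⟩
  intro x hx y hy hxy
  obtain ⟨n, hn⟩ := exists_nat_ge ((y - x) / η)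
  rw [div_le_iff₀ hη] at hn
  exact (key n x hx y hy hxy (by linarith)).2

/-- A Stieltjes measure needs a right-continuous function. The bound passes to right limits of `E`
because `f` is continuous: shift both endpoints by ε and let ε decrease to 0. -/
theorem SqModulusOn.rightLim (hf : Continuous f) (h : SqModulusOn univ f E) :
    SqModulusOn univ f h.monotone.stieltjesFunction := by
  intro x _ y _ hxy
  rw [h.monotone.stieltjesFunction_eq, h.monotone.stieltjesFunction_eq]
  have tr (a : ℝ) : Filter.Tendsto (fun ε : ℝ => a + ε) (nhdsWithin 0 (Ioi 0))
      (nhdsWithin a (Ioi a)) := by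
    refine tendsto_nhdsWithin_iff.2 ⟨?_, ?_⟩
    · have : Continuous fun ε : ℝ => a + ε := by fun_prop
      simpa using (this.tendsto 0).mono_left nhdsWithin_le_nhds
    · filter_upwards [self_mem_nhdsWithin] with ε hε
      simpa using hε
  have l1 := (h.monotone.tendsto_rightLim x).comp (tr x)
  have l2 := (h.monotone.tendsto_rightLim y).comp (tr y)
  have fl (a : ℝ) : Filter.Tendsto (fun ε : ℝ => f (a + ε)) (nhdsWithin 0 (Ioi 0)) (nhds (f a)) :=
    (hf.tendsto a).comp ((tr a).mono_right nhdsWithin_le_nhds)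
  refine le_of_tendsto_of_tendsto (((fl y).sub (fl x)).norm.pow 2)
    ((l2.sub l1).const_mul (y - x)) (.of_forall fun ε => ?_)
  have := h (x + ε) trivial (y + ε) trivial (by linarith)
  simpa using this

/-- Over disjoint intervals, ∑|Δf| ≤ ∑ √length · √μ ≤ √(∑ length) · √(∑ μ), with μ the Stieltjes
measure of `E`; the last factor is bounded by the mass of the whole interval. -/
theorem SqModulusOn.absolutelyContinuousOnInterval (hf : Continuous f) (h : SqModulusOn univ f E)
    (a b : ℝ) : AbsolutelyContinuousOnInterval f a b := by
  rw [absolutelyContinuousOnInterval_iff]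
  intro ε hε
  set S := h.monotone.stieltjesFunction
  have hS := h.rightLim hf
  set V := S.measure.real (uIoc a b)
  have hV : 0 ≤ V := measureReal_nonneg
  -- Chosen so that its square root times √(V + 1) equals `ε`; the summand 1 covers `V = 0`.
  refine ⟨ε ^ 2 / (V + 1), by positivity, ?_⟩
  rintro ⟨n, I⟩ hI hlen
  simp only at hlen ⊢
  have fin (c d : ℝ) : S.measure (uIoc c d) ≠ ⊤ := by
    rw [uIoc, S.measure_Ioc]; exact ENNReal.ofReal_ne_top
  have hm (i : ℕ) : dist (f (I i).1) (f (I i).2) ≤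
      √(dist (I i).1 (I i).2) * √(S.measure.real (uIoc (I i).1 (I i).2)) := by
    rw [← Real.sqrt_mul dist_nonneg]
    apply Real.le_sqrt_of_sq_le
    have key (c d : ℝ) (hcd : c ≤ d) :
        dist (f c) (f d) ^ 2 ≤ dist c d * S.measure.real (uIoc c d) := by
      rw [uIoc_of_le hcd, Measure.real, S.measure_Ioc,
        ENNReal.toReal_ofReal (sub_nonneg.2 (S.mono hcd)), dist_comm, dist_eq_norm, dist_comm,
        Real.dist_eq, abs_of_nonneg (sub_nonneg.2 hcd)]
      exact hS c trivial d trivial hcd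
    rcases le_total (I i).1 (I i).2 with hc | hc
    · exact key _ _ hc
    · rw [dist_comm, dist_comm (I i).1, uIoc_comm]
      exact key _ _ hc
  have hsum : ∑ i ∈ Finset.range n, S.measure.real (uIoc (I i).1 (I i).2) ≤ V := by
    rw [← measureReal_biUnion_finset hI.2 (fun _ _ => measurableSet_uIoc) (fun _ _ => fin _ _)]
    refine measureReal_mono (iUnion₂_subset fun i hi => ?_) (fin _ _)
    exact AbsolutelyContinuousOnInterval.uIoc_subset_of_mem_disjWithin hI (Finset.mem_range.1 hi)
  calc ∑ i ∈ Finset.range n, dist (f (I i).1) (f (I i).2)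
      ≤ ∑ i ∈ Finset.range n, √(dist (I i).1 (I i).2) *
          √(S.measure.real (uIoc (I i).1 (I i).2)) := Finset.sum_le_sum fun i _ => hm i
    _ ≤ √(∑ i ∈ Finset.range n, dist (I i).1 (I i).2) *
          √(∑ i ∈ Finset.range n, S.measure.real (uIoc (I i).1 (I i).2)) :=
        Real.sum_sqrt_mul_sqrt_le _ (fun _ => dist_nonneg) (fun _ => measureReal_nonneg)
    _ ≤ √(∑ i ∈ Finset.range n, dist (I i).1 (I i).2) * √(V + 1) := by gcongr; linarith
    _ < √(ε ^ 2 / (V + 1)) * √(V + 1) := by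
        gcongr
    _ = ε := by
        rw [← Real.sqrt_mul (by positivity), div_mul_cancel₀ _ (by positivity), Real.sqrt_sq hε.le]

end Modulus

/-! ### Square integrable weak derivatives from a bounded modulus -/

section Deriv

variable {f : ℝ → ℂ} {E : ℝ → ℝ}

/-- On [-R, R] the integral of E(x + h) - E(x) telescopes to ∫ E over [R, R + h] minus ∫ E over [-R,
-R + h], at most h(E(R + h) - E(-R)) by monotonicity. -/
theorem lintegral_monotone_increment_le {C : ℝ} (hE : Monotone E) (hC : ∀ x y, E y - E x ≤ C)
    {h : ℝ} (hh : 0 < h) :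
    ∫⁻ x, ENNReal.ofReal ((E (x + h) - E x) / h) ≤ ENNReal.ofReal C := by
  have hmeas : Measurable fun x => ENNReal.ofReal ((E (x + h) - E x) / h) :=
    (((hE.measurable.comp (measurable_add_const h)).sub hE.measurable).div_const h).ennreal_ofReal
  have hcov : AECover volume Filter.atTop fun R : ℝ => Ioc (-R) R :=
    aecover_Ioc Filter.tendsto_neg_atTop_atBot Filter.tendsto_id
  refine le_of_tendsto (hcov.lintegral_tendsto_of_countably_generated hmeas.aemeasurable) ?_
  filter_upwards [Filter.eventually_ge_atTop 0] with R hR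
  have hE' : Monotone fun x => E (x + h) := fun x y hxy => hE (by linarith)
  have ii (a b : ℝ) : IntervalIntegrable E volume a b := hE.intervalIntegrable
  have ii' (a b : ℝ) : IntervalIntegrable (fun x => E (x + h)) volume a b := hE'.intervalIntegrable
  have hint : IntervalIntegrable (fun x => (E (x + h) - E x) / h) volume (-R) R :=
    ((ii' _ _).sub (ii _ _)).div_const h
  have hle : -R ≤ R := by linarith
  rw [← ofReal_integral_eq_lintegral_ofReal ((intervalIntegrable_iff_integrableOn_Ioc_of_le hle).1
    hint) (.of_forall fun x => div_nonneg (sub_nonneg.2 (hE (by linarith))) hh.le),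
    ← intervalIntegral.integral_of_le hle, intervalIntegral.integral_div,
    intervalIntegral.integral_sub (ii' _ _) (ii _ _), intervalIntegral.integral_comp_add_right,
    ← intervalIntegral.integral_add_adjacent_intervals (ii (-R + h) R) (ii R (R + h)),
    ← intervalIntegral.integral_add_adjacent_intervals (ii (-R) (-R + h)) (ii (-R + h) R)]
  apply ENNReal.ofReal_le_ofReal
  rw [div_le_iff₀ hh]
  have e1 : ∫ x in R..R + h, E x ≤ h * E (R + h) := by
    have := intervalIntegral.integral_mono_on (a := R) (b := R + h) (by linarith) (ii _ _)
      (g := fun _ => E (R + h)) (by simp) (fun x hx => hE hx.2)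
    simpa using this
  have e2 : h * E (-R) ≤ ∫ x in -R..-R + h, E x := by
    have := intervalIntegral.integral_mono_on (a := -R) (b := -R + h) (by linarith)
      (f := fun _ => E (-R)) (by simp) (ii _ _) (fun x hx => hE hx.1)
    simpa using this
  nlinarith [hC (-R) (R + h)]

/-- The squared difference quotient of `f` is at most the difference quotient of `E`; Fatou's lemma
along the steps 1/(n + 1) gives the bound. -/
theorem SqModulusOn.lintegral_deriv_le {C : ℝ} (h : SqModulusOn univ f E)
    (hC : ∀ x y, E y - E x ≤ C) : ∫⁻ x, ‖deriv f x‖ₑ ^ 2 ≤ ENNReal.ofReal C := by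
  set δ : ℕ → ℝ := fun n => 1 / ((n : ℝ) + 1) with hδ
  have hδpos (n) : 0 < δ n := by positivity
  have hδ0 : Filter.Tendsto δ Filter.atTop (nhds 0) := tendsto_one_div_add_atTop_nhds_zero_nat
  set G : ℕ → ℝ → ENNReal := fun n x => ENNReal.ofReal ((E (x + δ n) - E x) / δ n)
  have hE := h.monotone
  have hG (n) : Measurable (G n) :=
    (((hE.measurable.comp (measurable_add_const _)).sub hE.measurable).div_const _).ennreal_ofReal
  have hpt (x : ℝ) : ‖deriv f x‖ₑ ^ 2 ≤ Filter.liminf (fun n => G n x) Filter.atTop := by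
    by_cases hd : DifferentiableAt ℝ f x
    · have h1 := hd.hasDerivAt.tendsto_slope_zero
      have h2 : Filter.Tendsto δ Filter.atTop (nhdsWithin 0 {0}ᶜ) :=
        tendsto_nhdsWithin_iff.2 ⟨hδ0, .of_forall fun n => (hδpos n).ne'⟩
      have h3 := (ENNReal.continuous_pow 2).tendsto _ |>.comp (h1.comp h2).enorm
      refine (h3.liminf_eq).symm.trans_le (Filter.liminf_le_liminf (.of_forall fun n => ?_))
      simp only [Function.comp_apply, G]
      rw [← ofReal_norm, ← ENNReal.ofReal_pow (norm_nonneg _)]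
      apply ENNReal.ofReal_le_ofReal
      rw [norm_smul, mul_pow, norm_inv, Real.norm_of_nonneg (hδpos n).le]
      have := h x trivial (x + δ n) trivial (by linarith [hδpos n])
      rw [add_sub_cancel_left] at this
      rw [inv_pow, inv_mul_eq_div, div_le_div_iff₀ (pow_pos (hδpos n) 2) (hδpos n)]
      nlinarith [hδpos n]
    -- Here `deriv` is 0 by convention, so almost everywhere differentiability is not needed for the
    -- bound.
    · simp [deriv_zero_of_not_differentiableAt hd]
  calc ∫⁻ x, ‖deriv f x‖ₑ ^ 2 ≤ ∫⁻ x, Filter.liminf (fun n => G n x) Filter.atTop :=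
        lintegral_mono hpt
    _ ≤ Filter.liminf (fun n => ∫⁻ x, G n x) Filter.atTop := lintegral_liminf_le hG
    _ ≤ Filter.liminf (fun _ : ℕ => ENNReal.ofReal C) Filter.atTop :=
        Filter.liminf_le_liminf (.of_forall fun n =>
          lintegral_monotone_increment_le hE hC (hδpos n))
    _ = ENNReal.ofReal C := by simp

theorem memLp_two_of_lintegral {α : Type*} [MeasurableSpace α] {μ : Measure α} {g : α → ℂ}
    (hg : AEStronglyMeasurable g μ) (h : ∫⁻ x, ‖g x‖ₑ ^ 2 ∂μ < ⊤) : MemLp g 2 μ := by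
  refine ⟨hg, (eLpNorm_lt_top_iff_lintegral_rpow_enorm_lt_top (by simp) (by simp)).2 ?_⟩
  simpa using h

theorem SqModulusOn.memLp_deriv {C : ℝ} (h : SqModulusOn univ f E)
    (hC : ∀ x y, E y - E x ≤ C) : MemLp (deriv f) 2 :=
  memLp_two_of_lintegral (measurable_deriv f).aestronglyMeasurable
    ((h.lintegral_deriv_le hC).trans_lt ENNReal.ofReal_lt_top)

/-- The real and imaginary parts inherit the modulus, hence are absolutely continuous, and
integration by parts applies to each on an interval containing the support of `φ`. -/
theorem SqModulusOn.integral_fderiv_smul {C : ℝ} (hf : Continuous f) (h : SqModulusOn univ f E)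
    (hC : ∀ x y, E y - E x ≤ C) {φ : ℝ → ℝ} (hφ : ContDiff ℝ 1 φ) (hc : HasCompactSupport φ) :
    ∫ x, deriv φ x • f x = -∫ x, φ x • deriv f x := by
  have hli : LocallyIntegrable (deriv f) := (h.memLp_deriv hC).locallyIntegrable (by norm_num)
  have hre : SqModulusOn univ (fun x => (f x).re) E := fun x hx y hy hxy => by
    refine le_trans ?_ (h x hx y hy hxy)
    rw [← Complex.sub_re]
    gcongr; exact Complex.abs_re_le_norm _
  have him : SqModulusOn univ (fun x => (f x).im) E := fun x hx y hy hxy => by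
    refine le_trans ?_ (h x hx y hy hxy)
    rw [← Complex.sub_im]
    gcongr; exact Complex.abs_im_le_norm _
  have hcre : Continuous fun x => (f x).re := by fun_prop
  have hcim : Continuous fun x => (f x).im := by fun_prop
  obtain ⟨R, hR⟩ := (hc.isBounded).subset_closedBall 0
  rw [Real.closedBall_eq_Icc, zero_sub, zero_add] at hR
  set b := |R| + 1
  have hsub : tsupport φ ⊆ Ioc (-b) b := fun x hx => by
    have := hR hx
    have := le_abs_self R
    constructor <;> simp only [b, mem_Icc] at * <;> linarith
  have hb : -b ≤ b := by have := abs_nonneg R; simp only [b]; linarith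
  have hφ0 (x : ℝ) (hx : x ∉ Ioc (-b) b) : φ x = 0 :=
    image_eq_zero_of_notMem_tsupport fun h => hx (hsub h)
  have hφ'0 (x : ℝ) (hx : x ∉ Ioc (-b) b) : deriv φ x = 0 :=
    image_eq_zero_of_notMem_tsupport fun h => hx (hsub (tsupport_deriv_subset h))
  have hφb : φ b = 0 := image_eq_zero_of_notMem_tsupport fun hx => by
    have h1 := (hR hx).2
    have := le_abs_self R
    simp only [b] at h1; linarith
  have hφnb : φ (-b) = 0 := hφ0 _ (by simp)
  have acφ : AbsolutelyContinuousOnInterval φ (-b) b :=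
    hφ.contDiffOn.absolutelyContinuousOnInterval
  have key (g : ℝ → ℝ) (hg : Continuous g) (hm : SqModulusOn univ g E) :
      ∫ x in -b..b, deriv φ x * g x = -∫ x in -b..b, φ x * deriv g x := by
    have := acφ.integral_mul_deriv_eq_deriv_mul (hm.absolutelyContinuousOnInterval hg _ _)
    rw [hφb, hφnb] at this
    linarith
  have i1 : Integrable fun x => deriv φ x • f x :=
    Continuous.integrable_of_hasCompactSupport
      ((hφ.continuous_deriv le_rfl).smul hf) (hc.deriv.smul_right)
  have i2 : Integrable fun x => φ x • deriv f x :=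
    hli.integrable_smul_left_of_hasCompactSupport hφ.continuous hc
  have d1 : ∀ᵐ x, x ∈ uIcc (-b) b → DifferentiableAt ℝ (fun x => (f x).re) x :=
    (hre.absolutelyContinuousOnInterval hcre (-b) b).ae_differentiableAt
  have d2 : ∀ᵐ x, x ∈ uIcc (-b) b → DifferentiableAt ℝ (fun x => (f x).im) x :=
    (him.absolutelyContinuousOnInterval hcim (-b) b).ae_differentiableAt
  -- The components of `deriv f` are the derivatives of the components wherever both are
  -- differentiable, hence almost everywhere.
  have dd : ∀ᵐ x, x ∈ Ioc (-b) b → deriv (fun x => (f x).re) x = (deriv f x).re ∧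
      deriv (fun x => (f x).im) x = (deriv f x).im := by
    filter_upwards [d1, d2] with x h1 h2 hx
    have hx' : x ∈ uIcc (-b) b := by rw [uIcc_of_le hb]; exact Ioc_subset_Icc_self hx
    have h3 : HasDerivAt f (deriv (fun x => (f x).re) x + deriv (fun x => (f x).im) x * Complex.I)
        x := by
      have := (h1 hx').hasDerivAt.ofReal_comp.add ((h2 hx').hasDerivAt.ofReal_comp.mul_const Complex.I)
      have e : ((fun y => ((f y).re : ℂ)) + fun y => ((f y).im : ℂ) * Complex.I) = f := by
        funext y
        simp
      rwa [e] at this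
    rw [h3.deriv]
    simp
  have toInt {G : Type} [NormedAddCommGroup G] [NormedSpace ℝ G] (g : ℝ → G)
      (hg : ∀ x ∉ Ioc (-b) b, g x = 0) :
      ∫ x, g x = ∫ x in -b..b, g x := by
    rw [intervalIntegral.integral_of_le hb, setIntegral_eq_integral_of_forall_compl_eq_zero hg]
  apply Complex.ext
  · rw [Complex.neg_re, ← RCLike.re_eq_complex_re, ← integral_re i1, ← integral_re i2]
    simp only [RCLike.re_eq_complex_re, Complex.smul_re, smul_eq_mul]
    rw [toInt _ (fun x hx => by rw [hφ'0 x hx, zero_mul]),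
      toInt _ (fun x hx => by rw [hφ0 x hx, zero_mul]), key _ hcre hre]
    congr 1
    refine intervalIntegral.integral_congr_ae (dd.mono fun x hx hxi => ?_)
    rw [uIoc_of_le hb] at hxi
    rw [(hx hxi).1]
  · rw [Complex.neg_im, ← RCLike.im_eq_complex_im, ← integral_im i1, ← integral_im i2]
    simp only [RCLike.im_eq_complex_im, Complex.smul_im, smul_eq_mul]
    rw [toInt _ (fun x hx => by rw [hφ'0 x hx, zero_mul]),
      toInt _ (fun x hx => by rw [hφ0 x hx, zero_mul]), key _ hcim him]
    congr 1
    refine intervalIntegral.integral_congr_ae (dd.mono fun x hx hxi => ?_)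
    rw [uIoc_of_le hb] at hxi
    rw [(hx hxi).2]

theorem SqModulusOn.hasWeakDeriv {C : ℝ} (hf : Continuous f) (h : SqModulusOn univ f E)
    (hC : ∀ x y, E y - E x ≤ C) : HasWeakDeriv univ (1 : ℝ) f (deriv f) := by
  refine ⟨hf.locallyIntegrable.locallyIntegrableOn _,
    ((h.memLp_deriv hC).locallyIntegrable (by norm_num)).locallyIntegrableOn _,
    fun φ hφ hc _ => ?_⟩
  have := h.integral_fderiv_smul hf hC (hφ.of_le (by exact_mod_cast le_top)) hc
  simpa using this

end Deriv

/-! ### Functions of two variables with controlled horizontal slices -/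

section Plane

variable {F : ℝ × ℝ → ℂ} {E : ℝ → ℝ → ℝ}

theorem measurable_deriv_slice (hF : Continuous F) :
    Measurable fun p : ℝ × ℝ => deriv (fun x => F (x, p.2)) p.1 := by
  have h : Continuous (Function.uncurry fun t x : ℝ => F (x, t)) := by
    simp only [Function.uncurry_def]; fun_prop
  exact (measurable_deriv_with_param h).comp measurable_swap

/-- Tonelli: the slice bounds are uniform in |t| ≤ T, and a compact set lies in such a strip. -/
theorem memLp_deriv_slice (hF : Continuous F) (hm : ∀ t, SqModulusOn univ (fun x => F (x, t)) (E t))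
    (hC : ∀ T, ∃ C, ∀ t, |t| ≤ T → ∀ x y, E t y - E t x ≤ C) {K : Set (ℝ × ℝ)} (hK : IsCompact K) :
    MemLp (fun p : ℝ × ℝ => deriv (fun x => F (x, p.2)) p.1) 2 (volume.restrict K) := by
  have hmeas := measurable_deriv_slice hF
  obtain ⟨T, hT⟩ := (hK.image continuous_snd).isBounded.subset_closedBall 0
  obtain ⟨C, hC⟩ := hC T
  have hsub : K ⊆ univ ×ˢ Icc (-T) T := fun p hp => by
    have := hT (mem_image_of_mem _ hp)
    rw [Real.closedBall_eq_Icc, zero_sub, zero_add] at this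
    exact ⟨trivial, this⟩
  refine memLp_two_of_lintegral hmeas.aestronglyMeasurable ?_
  refine (lintegral_mono_set hsub).trans_lt ?_
  have e : (volume : Measure (ℝ × ℝ)).restrict (univ ×ˢ Icc (-T) T) =
      volume.prod (volume.restrict (Icc (-T) T)) := by
    rw [Measure.volume_eq_prod, ← Measure.prod_restrict, Measure.restrict_univ]
  rw [e, lintegral_prod_symm _ (hmeas.enorm.pow_const 2).aemeasurable]
  have : ∫⁻ t in Icc (-T) T, ∫⁻ x, ‖deriv (fun x => F (x, t)) x‖ₑ ^ 2 ≤
      ∫⁻ t in Icc (-T) T, ENNReal.ofReal C := by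
    refine setLIntegral_mono measurable_const fun t ht => ?_
    exact (hm t).lintegral_deriv_le (hC t (abs_le.2 ht))
  refine this.trans_lt ?_
  rw [setLIntegral_const]
  exact ENNReal.mul_lt_top ENNReal.ofReal_lt_top (by simp)

/-- Fubini reduces the identity to integration by parts on each horizontal line. -/
theorem hasWeakDeriv_slice (hF : Continuous F)
    (hm : ∀ t, SqModulusOn univ (fun x => F (x, t)) (E t))
    (hC : ∀ T, ∃ C, ∀ t, |t| ≤ T → ∀ x y, E t y - E t x ≤ C) :
    HasWeakDeriv univ ((1, 0) : ℝ × ℝ) F (fun p => deriv (fun x => F (x, p.2)) p.1) := by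
  have hli : LocallyIntegrable fun p : ℝ × ℝ => deriv (fun x => F (x, p.2)) p.1 := by
    rw [locallyIntegrable_iff]
    intro K hK
    have : IsFiniteMeasure (volume.restrict K) :=
      ⟨by rw [Measure.restrict_apply_univ]; exact hK.measure_lt_top⟩
    exact (memLp_deriv_slice hF hm hC hK).integrable (by norm_num)
  refine ⟨hF.locallyIntegrable.locallyIntegrableOn _, hli.locallyIntegrableOn _,
    fun φ hφ hc _ => ?_⟩
  rw [setIntegral_univ, setIntegral_univ]
  have i1 : Integrable fun p => (fderiv ℝ φ p (1, 0)) • F p :=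
    Continuous.integrable_of_hasCompactSupport ((continuous_fderiv_apply_const hφ _).smul hF)
      (hc.fderiv_apply ℝ _).smul_right
  have i2 : Integrable fun p : ℝ × ℝ => φ p • deriv (fun x => F (x, p.2)) p.1 :=
    hli.integrable_smul_left_of_hasCompactSupport hφ.continuous hc
  rw [Measure.volume_eq_prod] at i1 i2 ⊢
  rw [integral_prod_symm _ i1, integral_prod_symm _ i2, ← integral_neg]
  congr 1
  ext1 t
  have e (x : ℝ) : fderiv ℝ φ (x, t) (1, 0) = deriv (fun x => φ (x, t)) x := by
    have h1 : HasDerivAt (fun x : ℝ => (x, t)) ((1, 0) : ℝ × ℝ) x :=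
      (hasDerivAt_id x).prodMk (hasDerivAt_const x t)
    have h2 := ((hφ.differentiable (by simp)) (x, t)).hasFDerivAt.comp_hasDerivAt x h1
    exact h2.deriv.symm
  simp only [e]
  obtain ⟨C, hC⟩ := hC |t|
  refine (hm t).integral_fderiv_smul (by fun_prop) (hC t le_rfl)
    ((hφ.of_le (by exact_mod_cast le_top)).comp (by fun_prop)) ?_
  have hcl : Topology.IsClosedEmbedding fun x : ℝ => (x, t) := by
    refine Topology.IsClosedEmbedding.of_continuous_injective_isClosedMap (by fun_prop)
      (fun x y h => (Prod.ext_iff.1 h).1) ?_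
    intro S hS
    have : (fun x : ℝ => (x, t)) '' S = S ×ˢ {t} := by ext ⟨a, b⟩; simp [eq_comm]
    rw [this]
    exact hS.prod isClosed_singleton
  exact hc.comp_isClosedEmbedding hcl

end Plane

/-! ### H¹ functions on a half line -/

section HalfLine

/-- Cauchy–Schwarz, read off from the nonnegative integral of the squared deviation of `h` from its
mean `A / d`. -/
theorem sq_intervalIntegral_le {h : ℝ → ℝ} {x y : ℝ} (hxy : x ≤ y)
    (hi : IntervalIntegrable h volume x y) (hi2 : IntervalIntegrable (fun s => h s ^ 2) volume x y) :
    (∫ s in x..y, h s) ^ 2 ≤ (y - x) * ∫ s in x..y, h s ^ 2 := by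
  rcases hxy.eq_or_lt with rfl | hlt
  · simp
  set A := ∫ s in x..y, h s
  set d := y - x
  have hd : 0 < d := sub_pos.2 hlt
  have h0 : 0 ≤ ∫ s in x..y, (h s - A / d) ^ 2 :=
    intervalIntegral.integral_nonneg hxy fun s _ => sq_nonneg _
  have e : ∫ s in x..y, (h s - A / d) ^ 2 =
      (∫ s in x..y, h s ^ 2) - 2 * (A / d) * A + d * (A / d) ^ 2 := by
    have : ∀ s, (h s - A / d) ^ 2 = h s ^ 2 - 2 * (A / d) * h s + (A / d) ^ 2 := fun s => by ring
    simp only [this]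
    rw [intervalIntegral.integral_add (hi2.sub (hi.const_mul _)) (by simp),
      intervalIntegral.integral_sub hi2 (hi.const_mul _), intervalIntegral.integral_const_mul]
    simp [d, A]
  rw [e] at h0
  have e2 : d * (A / d) ^ 2 = A * (A / d) := by field_simp
  have e3 : A ^ 2 = d * (A * (A / d)) := by field_simp
  nlinarith

theorem MemLp.intervalIntegrable_two {g : ℝ → ℂ} (hg : MemLp g 2) (x y : ℝ) :
    IntervalIntegrable g volume x y :=
  ((hg.locallyIntegrable (by norm_num)).integrableOn_isCompact
    isCompact_uIcc).intervalIntegrable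

theorem integrable_sq_norm_of_memLp {g : ℝ → ℂ} (hg : MemLp g 2) :
    Integrable fun s => ‖g s‖ ^ 2 :=
  (memLp_two_iff_integrable_sq_norm hg.1).1 hg

theorem norm_intervalIntegral_sq_le {g : ℝ → ℂ} (hg : MemLp g 2) {x y : ℝ} (hxy : x ≤ y) :
    ‖∫ s in x..y, g s‖ ^ 2 ≤ (y - x) * ∫ s in x..y, ‖g s‖ ^ 2 := by
  refine le_trans ?_ (sq_intervalIntegral_le hxy (MemLp.intervalIntegrable_two hg x y).norm
    (integrable_sq_norm_of_memLp hg).intervalIntegrable)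
  gcongr
  exact intervalIntegral.norm_integral_le_integral_norm hxy

theorem sqModulusOn_primitive {g : ℝ → ℂ} (hg : MemLp g 2) :
    SqModulusOn univ (fun x => ∫ s in (0:ℝ)..x, g s) (fun x => ∫ s in (0:ℝ)..x, ‖g s‖ ^ 2) := by
  intro x _ y _ hxy
  have i1 := MemLp.intervalIntegrable_two hg
  have i2 (a b : ℝ) : IntervalIntegrable (fun s => ‖g s‖ ^ 2) volume a b :=
    (integrable_sq_norm_of_memLp hg).intervalIntegrable
  rw [intervalIntegral.integral_interval_sub_left (i1 _ _) (i1 _ _),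
    intervalIntegral.integral_interval_sub_left (i2 _ _) (i2 _ _)]
  exact norm_intervalIntegral_sq_le hg hxy

theorem intervalIntegral_le_integral {h : ℝ → ℝ} (hi : Integrable h) (h0 : ∀ s, 0 ≤ h s) {x y : ℝ}
    (hxy : x ≤ y) : ∫ s in x..y, h s ≤ ∫ s, h s := by
  rw [intervalIntegral.integral_of_le hxy]
  exact setIntegral_le_integral hi (.of_forall h0)

theorem primitive_increment_le {h : ℝ → ℝ} (hi : Integrable h) (h0 : ∀ s, 0 ≤ h s) (x y : ℝ) :
    (∫ s in (0:ℝ)..y, h s) - ∫ s in (0:ℝ)..x, h s ≤ ∫ s, h s := by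
  rw [intervalIntegral.integral_interval_sub_left hi.intervalIntegrable hi.intervalIntegrable]
  rcases le_total x y with hxy | hxy
  · exact intervalIntegral_le_integral hi h0 hxy
  · rw [intervalIntegral.integral_symm]
    have := intervalIntegral.integral_nonneg (μ := volume) hxy fun s _ => h0 s
    have : 0 ≤ ∫ s, h s := integral_nonneg fun s => h0 s
    linarith

/-- `f` minus a primitive of its weak derivative has weak derivative zero on (0, ∞), so it is
constant there; continuity includes the endpoint 0. -/
theorem MemH1HalfLine.exists_primitive {f : ℝ → ℂ} (hf : MemH1HalfLine 0 f)
    (hc : ContinuousOn f (Ici 0)) :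
    ∃ g : ℝ → ℂ, MemLp g 2 ∧ ∀ x y, 0 ≤ x → x ≤ y → f y - f x = ∫ s in x..y, g s := by
  obtain ⟨g, hw, -, hg⟩ := hf
  set g₁ : ℝ → ℂ := (Ioi 0).indicator g with hg₁
  have hg₁L : MemLp g₁ 2 := (memLp_indicator_iff_restrict measurableSet_Ioi).2 hg
  refine ⟨g₁, hg₁L, ?_⟩
  set H : ℝ → ℂ := fun x => ∫ s in (0:ℝ)..x, g₁ s with hH
  have ii := MemLp.intervalIntegrable_two hg₁L
  have hHc : Continuous H := intervalIntegral.continuous_primitive (fun a b => ii a b) 0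
  have hHw : HasWeakDeriv univ (1:ℝ) H (deriv H) :=
    (sqModulusOn_primitive hg₁L).hasWeakDeriv hHc
      (primitive_increment_le (integrable_sq_norm_of_memLp hg₁L) fun _ => sq_nonneg _)
  have hderiv : ∀ᵐ x, deriv H x = g₁ x := by
    filter_upwards [LocallyIntegrable.ae_hasDerivAt_integral
      (hg₁L.locallyIntegrable (by norm_num))] with x hx using (hx 0).deriv
  -- Constant continuation to the left of 0, since `HasWeakDeriv.sub_eq_integral` asks for functions
  -- continuous on the whole line.
  set f₁ : ℝ → ℂ := fun x => f (max x 0) with hf₁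
  have hf₁c : Continuous f₁ := hc.comp_continuous (by fun_prop) fun x => mem_Ici.2 (le_max_right x 0)
  have hw₁ : HasWeakDeriv (Ioi 0) (1:ℝ) (f₁ - H) (fun _ => 0) := by
    refine (hw.sub measurableSet_Ioi (hHw.mono (subset_univ _))).congr ?_ ?_
    · refine (ae_restrict_iff' measurableSet_Ioi).2 (.of_forall fun x (hx : 0 < x) => ?_)
      simp [hf₁, max_eq_left hx.le]
    · refine (ae_restrict_iff' measurableSet_Ioi).2 (hderiv.mono fun x h (hx : 0 < x) => ?_)
      simp [h, hg₁, hx]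
  have hpos : ∀ x y, 0 < x → x ≤ y → f₁ y - f₁ x = ∫ s in x..y, g₁ s := by
    intro x y hx hxy
    have := hw₁.sub_eq_integral isOpen_Ioi (hf₁c.sub hHc) continuous_const (p := x) (s := y - x)
      (sub_nonneg.2 hxy) (fun r hr => by simp only [smul_eq_mul, mul_one, mem_Ioi]; linarith [hr.1])
    simp only [smul_eq_mul, mul_one, add_sub_cancel, Pi.sub_apply,
      intervalIntegral.integral_zero] at this
    have e : H y - H x = ∫ s in x..y, g₁ s :=
      intervalIntegral.integral_interval_sub_left (ii _ _) (ii _ _)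
    rw [← e]
    linear_combination this
  intro x y hx hxy
  have hfx (x : ℝ) (hx : 0 ≤ x) : f x = f₁ x := by simp [hf₁, max_eq_left hx]
  rw [hfx x hx, hfx y (hx.trans hxy)]
  have e (x y : ℝ) : H y - H x = ∫ s in x..y, g₁ s :=
      intervalIntegral.integral_interval_sub_left (ii _ _) (ii _ _)
  rw [← e]
  have lim (G : ℝ → ℂ) (hG : Continuous G) : Filter.Tendsto (fun ε : ℝ => G (y + ε) - G (x + ε))
      (nhdsWithin 0 (Ioi 0)) (nhds (G y - G x)) := by
    have : Continuous fun ε : ℝ => G (y + ε) - G (x + ε) := by fun_prop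
    simpa using (this.tendsto 0).mono_left nhdsWithin_le_nhds
  refine tendsto_nhds_unique_of_eventuallyEq (lim f₁ hf₁c) (lim H hHc) ?_
  filter_upwards [self_mem_nhdsWithin] with ε (hε : 0 < ε)
  rw [hpos _ _ (by linarith) (by linarith), e]

end HalfLine

/-! ### Geometry of the domain -/

/-- The curve `x = z(t)`, `t ≥ 0`, starts at the origin and is slower than the characteristics. -/
structure TimeLike (z : ℝ → ℝ) : Prop where
  continuousOn : ContinuousOn z (Ici 0)
  zero : z 0 = 0
  abs_sub_lt : ∀ s t, 0 ≤ s → s < t → |z t - z s| < t - s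

namespace TimeLike

variable {z : ℝ → ℝ} (hz : TimeLike z)
include hz

theorem abs_sub_le {s t : ℝ} (hs : 0 ≤ s) (hst : s ≤ t) : |z t - z s| ≤ t - s := by
  rcases hst.eq_or_lt with rfl | h
  · simp
  · exact (hz.abs_sub_lt s t hs h).le

theorem abs_le {t : ℝ} (ht : 0 ≤ t) : |z t| ≤ t := by
  simpa [hz.zero] using hz.abs_sub_le le_rfl ht

theorem continuous_max : Continuous fun t => z (max t 0) :=
  hz.continuousOn.comp_continuous (by fun_prop) fun t => mem_Ici.2 (le_max_right t 0)

/-- The curve is slower than the `u`-characteristics, which therefore never leave the domain forward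
in time. -/
theorem right_mem {x t h : ℝ} (ht : 0 ≤ t) (hx : z t ≤ x) (hh : 0 ≤ h) : z (t + h) ≤ x + h := by
  have := (abs_le'.1 (hz.abs_sub_le ht (le_add_of_nonneg_right hh))).1
  linarith

/-- If a `v`-characteristic ends in the domain, all its earlier points from time `t` on lie there:
backwards it moves to the right faster than the curve can. -/
theorem left_mem {x t h : ℝ} (ht : 0 ≤ t) (hx : z (t + h) ≤ x - h) {s : ℝ}
    (hs : s ∈ Icc 0 h) : z (t + s) ≤ x - s := by
  have h1 := (abs_le'.1 (hz.abs_sub_le (s := t + s) (t := t + h) (by linarith [hs.1])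
    (by linarith [hs.2]))).2
  linarith

/-- If x - t ≥ 0, the backward `u`-characteristic reaches t = 0. Otherwise the intermediate value
theorem for z(s) - s gives the time at which it meets the curve. -/
theorem exists_foot {x t : ℝ} (ht : 0 ≤ t) (hx : z t ≤ x) :
    ∃ τ ∈ Icc 0 t, z τ ≤ x - t + τ ∧ (τ = 0 ∨ z τ = x - t + τ) := by
  rcases le_or_gt 0 (x - t) with h | h
  · exact ⟨0, ⟨le_rfl, ht⟩, by rw [hz.zero]; linarith, .inl rfl⟩
  · have hc : ContinuousOn (fun s => z s - s) (Icc 0 t) :=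
      (hz.continuousOn.mono Icc_subset_Ici_self).sub continuousOn_id
    have := intermediate_value_Icc' ht hc
    obtain ⟨τ, hτ, h2⟩ := this (show x - t ∈ Icc (z t - t) (z 0 - 0) from
      ⟨by linarith, by rw [hz.zero]; linarith⟩)
    simp only at h2
    exact ⟨τ, hτ, by linarith, .inr (by linarith)⟩

end TimeLike

/-- The retraction of the plane onto `Omega z`. -/
def proj (z : ℝ → ℝ) (p : ℝ × ℝ) : ℝ × ℝ := (max p.1 (z (max p.2 0)), max p.2 0)

theorem proj_mem (z : ℝ → ℝ) (p : ℝ × ℝ) : proj z p ∈ Omega z :=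
  ⟨le_max_right _ _, le_max_right _ _⟩

theorem proj_eq {z : ℝ → ℝ} {p : ℝ × ℝ} (hp : p ∈ Omega z) : proj z p = p := by
  obtain ⟨h1, h2⟩ := hp
  simp [proj, max_eq_left h1, max_eq_left h2]

theorem TimeLike.continuous_proj {z : ℝ → ℝ} (hz : TimeLike z) : Continuous (proj z) := by
  have : Continuous fun p : ℝ × ℝ => z (max p.2 0) := hz.continuous_max.comp continuous_snd
  exact (continuous_fst.max this).prodMk (by fun_prop)

theorem TimeLike.isOpen_inner {z : ℝ → ℝ} (hz : TimeLike z) :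
    IsOpen {p : ℝ × ℝ | 0 < p.2 ∧ z p.2 < p.1} := by
  have h : {p : ℝ × ℝ | 0 < p.2 ∧ z p.2 < p.1} =
      {p : ℝ × ℝ | 0 < p.2} ∩ {p : ℝ × ℝ | z (max p.2 0) < p.1} := by
    ext p
    simp only [mem_ofPred_eq, mem_inter_iff]
    refine and_congr_right fun h => ?_
    rw [max_eq_left h.le]
  rw [h]
  exact (isOpen_lt continuous_const continuous_snd).inter
    (isOpen_lt (hz.continuous_max.comp continuous_snd) continuous_fst)

theorem TimeLike.isClosed_Omega {z : ℝ → ℝ} (hz : TimeLike z) : IsClosed (Omega z) := by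
  have h : Omega z = {p : ℝ × ℝ | 0 ≤ p.2} ∩ {p : ℝ × ℝ | z (max p.2 0) ≤ p.1} := by
    ext p
    simp only [Omega, mem_ofPred_eq, mem_inter_iff]
    refine and_congr_right fun h => ?_
    rw [max_eq_left h]
  rw [h]
  exact (isClosed_le continuous_const continuous_snd).inter
    (isClosed_le (hz.continuous_max.comp continuous_snd) continuous_fst)

theorem TimeLike.inner_subset {z : ℝ → ℝ} (hz : TimeLike z) :
    {p : ℝ × ℝ | 0 < p.2 ∧ z p.2 < p.1} ⊆ interior (Omega z) :=
  interior_maximal (fun _ hp => ⟨hp.1.le, hp.2.le⟩) hz.isOpen_inner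

/-- The part of `Omega z` on which the solution at the points with `x + t ≤ c`, `t ≤ T`
depends. -/
def depDomain (z : ℝ → ℝ) (T c : ℝ) : Set (ℝ × ℝ) := Omega z ∩ {p | p.2 ≤ T ∧ p.1 + p.2 ≤ c}

theorem TimeLike.isCompact_depDomain {z : ℝ → ℝ} (hz : TimeLike z) (T c : ℝ) :
    IsCompact (depDomain z T c) := by
  have hcl : IsClosed (depDomain z T c) :=
    hz.isClosed_Omega.inter ((isClosed_le continuous_snd continuous_const).inter
      (isClosed_le (continuous_fst.add continuous_snd) continuous_const))
  refine (isCompact_Icc (a := ((-T, 0) : ℝ × ℝ)) (b := (c, T))).of_isClosed_subset hcl ?_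
  rintro ⟨x, t⟩ ⟨⟨h1, h2⟩, h3, h4⟩
  simp only at h1 h2 h3 h4
  have := (_root_.abs_le.1 (hz.abs_le h1)).1
  exact ⟨⟨by simp only; linarith, h1⟩, ⟨by simp only; linarith, h3⟩⟩

/-! ### Characteristic solutions and uniqueness -/

/-- Lipschitz on bounded sets. -/
def LipOnBalls (F : ℂ × ℂ → ℂ) : Prop :=
  ∀ B : ℝ, ∃ L : ℝ, 0 ≤ L ∧ ∀ p q, ‖p‖ ≤ B → ‖q‖ ≤ B → ‖F p - F q‖ ≤ L * ‖p - q‖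

/-- Solutions of `u_t + u_x = F(u, v)`, `v_t - v_x = G(u, v)` integrated along characteristics
in `Omega z ∩ {t ≤ T}`, with the initial and boundary conditions. -/
structure IsCharSol (F G : ℂ × ℂ → ℂ) (z : ℝ → ℝ) (lam u₀ v₀ : ℝ → ℂ) (T : ℝ)
    (u v : ℝ × ℝ → ℂ) : Prop where
  continuous_u : Continuous u
  continuous_v : Continuous v
  eq_u : ∀ x t h, 0 ≤ t → z t ≤ x → 0 ≤ h → t + h ≤ T →
    u (x + h, t + h) - u (x, t) = ∫ s in (0:ℝ)..h, F (u (x + s, t + s), v (x + s, t + s))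
  eq_v : ∀ x t h, 0 ≤ t → 0 ≤ h → z (t + h) ≤ x - h → t + h ≤ T →
    v (x - h, t + h) - v (x, t) = ∫ s in (0:ℝ)..h, G (u (x - s, t + s), v (x - s, t + s))
  initial : ∀ x, 0 ≤ x → u (x, 0) = u₀ x ∧ v (x, 0) = v₀ x
  boundary : ∀ t, 0 ≤ t → t ≤ T → u (z t, t) = lam t * v (z t, t)

/-- Integration against the weight exp(Ks) gains a factor 1/K; this makes the estimates contractive
on time intervals of any length. -/
theorem norm_integral_le_exp {g : ℝ → ℂ} {a b K M : ℝ} (hab : a ≤ b) (hK : 0 < K) (hM : 0 ≤ M)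
    (hg : ∀ s ∈ Icc a b, ‖g s‖ ≤ M * Real.exp (K * s)) :
    ‖∫ s in a..b, g s‖ ≤ M / K * Real.exp (K * b) := by
  have h1 : ‖∫ s in a..b, g s‖ ≤ ∫ s in a..b, M * Real.exp (K * s) :=
    intervalIntegral.norm_integral_le_of_norm_le hab
      (.of_forall fun s hs => hg s (Ioc_subset_Icc_self hs))
      ((by fun_prop : Continuous fun s => M * Real.exp (K * s)).intervalIntegrable _ _)
  refine h1.trans ?_
  have h2 : ∀ s ∈ uIcc a b, HasDerivAt (fun s => M / K * Real.exp (K * s))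
      (M * Real.exp (K * s)) s := fun s _ => by
    have := (((hasDerivAt_id s).const_mul K).exp).const_mul (M / K)
    have e : M / K * (Real.exp (K * id s) * (K * 1)) = M * Real.exp (K * s) := by
      simp only [id, mul_one]
      field_simp
    rwa [e] at this
  rw [intervalIntegral.integral_eq_sub_of_hasDerivAt h2
    ((by fun_prop : Continuous fun s => M * Real.exp (K * s)).intervalIntegrable _ _)]
  have : 0 ≤ M / K * Real.exp (K * a) := by positivity
  linarith

/-- A weighted form of Gronwall's inequality on a compact set of points `(x, t)`. -/
theorem le_exp_of_contraction {Δ : Set (ℝ × ℝ)} (hΔ : IsCompact Δ) {r : ℝ × ℝ → ℝ}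
    (hr : ContinuousOn r Δ) (hr0 : ∀ p ∈ Δ, 0 ≤ r p) (ht : ∀ p ∈ Δ, 0 ≤ p.2) {A K : ℝ} (hA : 0 ≤ A)
    (hK : 0 ≤ K) (h : ∀ N : ℝ, 0 ≤ N → (∀ q ∈ Δ, r q ≤ N * Real.exp (K * q.2)) →
      ∀ p ∈ Δ, r p ≤ A + N / 2 * Real.exp (K * p.2)) :
    ∀ p ∈ Δ, r p ≤ 2 * A * Real.exp (K * p.2) := by
  intro p hp
  -- Compactness makes the weighted supremum `N` finite and attained. The hypothesis evaluated at
  -- the maximum point gives N ≤ A + N/2, that is N ≤ 2A.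
  obtain ⟨q, hq, hmax⟩ := hΔ.exists_isMaxOn ⟨p, hp⟩
    (f := fun p => r p * Real.exp (-(K * p.2))) (by fun_prop)
  set N := r q * Real.exp (-(K * q.2)) with hN
  have hN0 : 0 ≤ N := mul_nonneg (hr0 q hq) (Real.exp_pos _).le
  have hle : ∀ p ∈ Δ, r p ≤ N * Real.exp (K * p.2) := fun p hp => by
    have h1 : r p * Real.exp (-(K * p.2)) ≤ N := hmax hp
    have h2 : r p = r p * Real.exp (-(K * p.2)) * Real.exp (K * p.2) := by
      rw [mul_assoc, ← Real.exp_add]; simp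
    rw [h2]
    gcongr
  have h1 := h N hN0 hle q hq
  have h2 : N ≤ A * Real.exp (-(K * q.2)) + N / 2 := by
    have h3 := mul_le_mul_of_nonneg_right h1 (Real.exp_pos (-(K * q.2))).le
    rw [← hN, add_mul, mul_assoc, ← Real.exp_add] at h3
    simpa using h3
  have h3 : Real.exp (-(K * q.2)) ≤ 1 :=
    Real.exp_le_one_iff.2 (neg_nonpos.2 (mul_nonneg hK (ht q hq)))
  have h4 : N ≤ 2 * A := by nlinarith
  refine (hle p hp).trans ?_
  gcongr

section Unique

variable {F G : ℂ × ℂ → ℂ} {z : ℝ → ℝ} {lam u₀ v₀ : ℝ → ℂ} {T : ℝ} {u v u' v' : ℝ × ℝ → ℂ}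

theorem IsCharSol.mono {T' : ℝ} (h : IsCharSol F G z lam u₀ v₀ T u v) (hT : T' ≤ T) :
    IsCharSol F G z lam u₀ v₀ T' u v where
  continuous_u := h.continuous_u
  continuous_v := h.continuous_v
  eq_u x t r ht hx hr hT' := h.eq_u x t r ht hx hr (hT'.trans hT)
  eq_v x t r ht hr hx hT' := h.eq_v x t r ht hr hx (hT'.trans hT)
  initial := h.initial
  boundary t ht hT' := h.boundary t ht (hT'.trans hT)

theorem IsCharSol.v_eq (h : IsCharSol F G z lam u₀ v₀ T u v) (hz : TimeLike z) {x t : ℝ}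
    (ht : 0 ≤ t) (hx : z t ≤ x) (htT : t ≤ T) :
    v (x, t) = v₀ (x + t) + ∫ s in (0:ℝ)..t, G (u (x + t - s, s), v (x + t - s, s)) := by
  have h1 := h.eq_v (x + t) 0 t le_rfl ht (by simpa using hx) (by simpa using htT)
  have h2 : 0 ≤ x + t := by have := (_root_.abs_le.1 (hz.abs_le ht)).1; linarith
  simp only [add_sub_cancel_right, zero_add, (h.initial _ h2).2] at h1
  rw [← h1]; ring

theorem LipOnBalls.continuous {F : ℂ × ℂ → ℂ} (hF : LipOnBalls F) : Continuous F := by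
  rw [continuous_iff_continuousAt]
  intro p
  obtain ⟨L, hL0, hL⟩ := hF (‖p‖ + 1)
  have hlip : LipschitzOnWith L.toNNReal F (Metric.ball p 1) :=
    LipschitzOnWith.of_dist_le_mul fun x hx y hy => by
      rw [dist_eq_norm, dist_eq_norm, Real.coe_toNNReal L hL0]
      have bd (x) (hx : x ∈ Metric.ball p 1) : ‖x‖ ≤ ‖p‖ + 1 := by
        rw [mem_ball_iff_norm] at hx
        have := norm_le_norm_add_norm_sub' x p
        linarith
      exact hL x y (bd x hx) (bd y hy)
  exact hlip.continuousOn.continuousAt (Metric.ball_mem_nhds p one_pos)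

/-- Differences are compared on the compact domain of dependence of `p`. The difference of the `v`'s
is an integral starting at t = 0; that of the `u`'s starts at 0 on the initial line, or on the curve
with `lam` times the former. `le_exp_of_contraction` with `A = 0` forces them to vanish. -/
theorem IsCharSol.eqOn (hz : TimeLike z) (hF : LipOnBalls F) (hG : LipOnBalls G)
    (hlam : ContinuousOn lam (Ici 0)) (h : IsCharSol F G z lam u₀ v₀ T u v)
    (h' : IsCharSol F G z lam u₀ v₀ T u' v') {p : ℝ × ℝ} (hp : p ∈ Omega z) (hpT : p.2 ≤ T) :
    u' p = u p ∧ v' p = v p := by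
  set Δ := depDomain z T (p.1 + p.2) with hΔdef
  have hΔ : IsCompact Δ := hz.isCompact_depDomain _ _
  have hpΔ : p ∈ Δ := ⟨hp, hpT, le_rfl⟩
  set U : ℝ × ℝ → ℂ × ℂ := fun q => (u q, v q)
  set U' : ℝ × ℝ → ℂ × ℂ := fun q => (u' q, v' q)
  have hU : Continuous U := h.continuous_u.prodMk h.continuous_v
  have hU' : Continuous U' := h'.continuous_u.prodMk h'.continuous_v
  obtain ⟨B₁, hB₁⟩ := hΔ.exists_bound_of_continuousOn hU.continuousOn
  obtain ⟨B₂, hB₂⟩ := hΔ.exists_bound_of_continuousOn hU'.continuousOn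
  obtain ⟨L₁, hL₁, hF'⟩ := hF (max B₁ B₂)
  obtain ⟨L₂, hL₂, hG'⟩ := hG (max B₁ B₂)
  obtain ⟨Λ₀, hΛ₀⟩ := (isCompact_Icc (a := 0) (b := T)).exists_bound_of_continuousOn
    (hlam.mono Icc_subset_Ici_self)
  set Λ := max Λ₀ 0
  have hΛ0 : 0 ≤ Λ := le_max_right _ _
  set L := max L₁ L₂ + 1
  have hL : 0 < L := by have := le_max_left L₁ L₂; simp only [L]; linarith
  have hFL (q) (hq : q ∈ Δ) : ‖F (U' q) - F (U q)‖ ≤ L * ‖U' q - U q‖ :=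
    (hF' _ _ ((hB₂ q hq).trans (le_max_right _ _)) ((hB₁ q hq).trans (le_max_left _ _))).trans
      (by gcongr; have := le_max_left L₁ L₂; simp only [L]; linarith)
  have hGL (q) (hq : q ∈ Δ) : ‖G (U' q) - G (U q)‖ ≤ L * ‖U' q - U q‖ :=
    (hG' _ _ ((hB₂ q hq).trans (le_max_right _ _)) ((hB₁ q hq).trans (le_max_left _ _))).trans
      (by gcongr; have := le_max_right L₁ L₂; simp only [L]; linarith)
  have hFc := hF.continuous
  have hGc := hG.continuous
  -- The `v` estimate costs L/K and the reflected `u` estimate (1 + Λ)L/K, which this choice makes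
  -- equal to 1/2.
  set K := 2 * (1 + Λ) * L
  have hK : 0 < K := by positivity
  have main := le_exp_of_contraction hΔ (r := fun q => ‖U' q - U q‖) (by fun_prop)
    (fun _ _ => norm_nonneg _) (fun q hq => hq.1.1) (A := 0) (K := K) le_rfl hK.le ?_
  · have h0 : ‖U' p - U p‖ ≤ 0 := by simpa using main p hpΔ
    have h1 := sub_eq_zero.1 (norm_le_zero_iff.1 h0)
    exact ⟨congrArg Prod.fst h1, congrArg Prod.snd h1⟩
  intro N hN hr
  have hv : ∀ q ∈ Δ, ‖v' q - v q‖ ≤ L * N / K * Real.exp (K * q.2) := by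
    rintro ⟨x, t⟩ ⟨⟨ht, hx⟩, htT, hxc⟩
    simp only at ht hx htT hxc
    rw [h.v_eq hz ht hx htT, h'.v_eq hz ht hx htT, add_sub_add_left_eq_sub,
      ← intervalIntegral.integral_sub
        ((by fun_prop : Continuous fun s => G (U' (x + t - s, s))).intervalIntegrable _ _)
        ((by fun_prop : Continuous fun s => G (U (x + t - s, s))).intervalIntegrable _ _)]
    refine norm_integral_le_exp ht hK (by positivity) fun s hs => ?_
    have hmem : (x + t - s, s) ∈ Δ := by
      refine ⟨⟨hs.1, ?_⟩, hs.2.trans htT, by simp only; linarith⟩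
      have := hz.left_mem (x := x + t) le_rfl (by simpa using hx) hs
      simpa using this
    refine (hGL _ hmem).trans ?_
    rw [mul_assoc]
    gcongr
    exact hr _ hmem
  have hmul : L * N / K * (1 + Λ) = N / 2 := by simp only [K]; field_simp
  have hLNK : 0 ≤ L * N / K := by positivity
  rintro ⟨x, t⟩ hq
  have hvq := hv _ hq
  obtain ⟨⟨ht, hx⟩, htT, hxc⟩ := hq
  simp only at ht hx htT hxc hvq
  obtain ⟨τ, ⟨hτ0, hτt⟩, hτz, hτ⟩ := hz.exists_foot ht hx
  have huf : ‖u' (x - t + τ, τ) - u (x - t + τ, τ)‖ ≤ Λ * (L * N / K * Real.exp (K * t)) := by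
    rcases hτ with rfl | hτ
    · rw [hz.zero] at hτz
      rw [(h.initial _ hτz).1, (h'.initial _ hτz).1, sub_self, norm_zero]
      positivity
    · rw [← hτ, h.boundary τ hτ0 (hτt.trans htT), h'.boundary τ hτ0 (hτt.trans htT), ← mul_sub,
        norm_mul]
      gcongr
      · exact (hΛ₀ τ ⟨hτ0, hτt.trans htT⟩).trans (le_max_left _ _)
      · refine (hv (z τ, τ) ⟨⟨hτ0, le_rfl⟩, hτt.trans htT, by simp only; linarith⟩).trans ?_
        gcongr
  have hu : ‖u' (x, t) - u (x, t)‖ ≤ N / 2 * Real.exp (K * t) := by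
    have e1 := h.eq_u (x - t + τ) τ (t - τ) hτ0 hτz (by linarith) (by linarith)
    have e2 := h'.eq_u (x - t + τ) τ (t - τ) hτ0 hτz (by linarith) (by linarith)
    have e3 : x - t + τ + (t - τ) = x := by ring
    have e4 : τ + (t - τ) = t := by ring
    rw [e3, e4] at e1 e2
    have e5 : u' (x, t) - u (x, t) = (u' (x - t + τ, τ) - u (x - t + τ, τ)) +
        ∫ s in (0:ℝ)..t - τ, (F (U' (x - t + τ + s, τ + s)) - F (U (x - t + τ + s, τ + s))) := by
      rw [intervalIntegral.integral_sub
        ((by fun_prop : Continuous fun s => F (U' (x - t + τ + s, τ + s))).intervalIntegrable _ _)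
        ((by fun_prop : Continuous fun s => F (U (x - t + τ + s, τ + s))).intervalIntegrable _ _)]
      simp only [U, U']
      rw [← e1, ← e2]; ring
    have e6 : ‖∫ s in (0:ℝ)..t - τ,
        (F (U' (x - t + τ + s, τ + s)) - F (U (x - t + τ + s, τ + s)))‖ ≤
        L * N * Real.exp (K * τ) / K * Real.exp (K * (t - τ)) := by
      refine norm_integral_le_exp (by linarith) hK (by positivity) fun s hs => ?_
      have hmem : (x - t + τ + s, τ + s) ∈ Δ := by
        refine ⟨⟨by simp only; linarith [hs.1], hz.right_mem hτ0 hτz hs.1⟩, ?_, ?_⟩ <;>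
          simp only <;> linarith [hs.2]
      refine (hFL _ hmem).trans ?_
      rw [mul_assoc, mul_assoc, ← Real.exp_add, ← mul_add]
      gcongr
      exact hr _ hmem
    have e7 : L * N * Real.exp (K * τ) / K * Real.exp (K * (t - τ)) =
        L * N / K * Real.exp (K * t) := by
      have : Real.exp (K * t) = Real.exp (K * τ) * Real.exp (K * (t - τ)) := by
        rw [← Real.exp_add]; ring_nf
      rw [this]; ring
    rw [e5, ← hmul]
    refine (norm_add_le _ _).trans ?_
    rw [e7] at e6
    nlinarith
  rw [zero_add]
  refine max_le hu (hvq.trans ?_)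
  rw [← hmul]
  have := Real.exp_pos (K * t)
  gcongr
  nlinarith

end Unique

/-! ### The Dirac right-hand sides, and weak solutions as characteristic solutions -/

/-- Right-hand side of the equation for `u` along characteristics. -/
noncomputable def rhsU (m α β : ℝ) (p : ℂ × ℂ) : ℂ := -Complex.I * (-(m : ℂ) * p.2 + N₁ α β p.1 p.2)

/-- Right-hand side of the equation for `v` along characteristics. -/
noncomputable def rhsV (m α β : ℝ) (p : ℂ × ℂ) : ℂ := -Complex.I * (-(m : ℂ) * p.1 + N₂ α β p.1 p.2)

theorem lipOnBalls_of_contDiff {F : ℂ × ℂ → ℂ} (hF : ContDiff ℝ 1 F) : LipOnBalls F := by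
  intro B
  obtain ⟨C, hC⟩ := (isCompact_closedBall (0 : ℂ × ℂ) B).exists_bound_of_continuousOn
    (hF.continuous_fderiv (by simp)).continuousOn
  refine ⟨max C 0, le_max_right _ _, fun p q hp hq => ?_⟩
  refine (convex_closedBall (0 : ℂ × ℂ) B).norm_image_sub_le_of_norm_fderiv_le
    (𝕜 := ℝ) (fun x _ => hF.differentiable (by simp) x)
    (fun x hx => (hC x hx).trans (le_max_left _ _)) ?_ ?_
  · simpa using hq
  · simpa using hp

theorem ofReal_norm_sq (u : ℂ) : (‖u‖ : ℂ) ^ 2 = u * star u := by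
  have := Complex.mul_conj u
  rw [Complex.normSq_eq_norm_sq] at this
  push_cast at this
  exact this.symm

theorem contDiff_rhsU (m α β : ℝ) : ContDiff ℝ 1 (rhsU m α β) := by
  unfold rhsU N₁
  simp only [ofReal_norm_sq]
  have h1 : ContDiff ℝ 1 fun p : ℂ × ℂ => star p.1 := Complex.conjCLE.contDiff.comp contDiff_fst
  have h2 : ContDiff ℝ 1 fun p : ℂ × ℂ => star p.2 := Complex.conjCLE.contDiff.comp contDiff_snd
  fun_prop

theorem contDiff_rhsV (m α β : ℝ) : ContDiff ℝ 1 (rhsV m α β) := by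
  unfold rhsV N₂
  simp only [ofReal_norm_sq]
  have h1 : ContDiff ℝ 1 fun p : ℂ × ℂ => star p.1 := Complex.conjCLE.contDiff.comp contDiff_fst
  have h2 : ContDiff ℝ 1 fun p : ℂ × ℂ => star p.2 := Complex.conjCLE.contDiff.comp contDiff_snd
  fun_prop

/-- The sum u_t + u_x is the weak derivative of `u` in the direction (1, 1), and almost everywhere
it equals a continuous function of (u, v); likewise for `v`. Hence the integral equations hold on
segments in the interior, and by approximation on segments touching the boundary. -/
theorem isCharSol_of_isGlobalSolution {m α β : ℝ} {z : ℝ → ℝ} {lam u₀ v₀ : ℝ → ℂ}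
    {u v : ℝ × ℝ → ℂ} (hz : TimeLike z) (h : IsGlobalSolution m α β z lam u₀ v₀ u v) (T : ℝ) :
    IsCharSol (rhsU m α β) (rhsV m α β) z lam u₀ v₀ T (u ∘ proj z) (v ∘ proj z) := by
  have hcu : Continuous (u ∘ proj z) :=
    h.continuousOn_u.comp_continuous hz.continuous_proj (proj_mem z)
  have hcv : Continuous (v ∘ proj z) :=
    h.continuousOn_v.comp_continuous hz.continuous_proj (proj_mem z)
  set ue := u ∘ proj z with hue
  set ve := v ∘ proj z with hve
  have eu {p} (hp : p ∈ Omega z) : ue p = u p := by simp [hue, proj_eq hp]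
  have ev {p} (hp : p ∈ Omega z) : ve p = v p := by simp [hve, proj_eq hp]
  have hF := (contDiff_rhsU m α β).continuous
  have hG := (contDiff_rhsV m α β).continuous
  set F := rhsU m α β with hFdef
  set G := rhsV m α β with hGdef
  set I := {p : ℝ × ℝ | 0 < p.2 ∧ z p.2 < p.1} with hI
  have hIo : IsOpen I := hz.isOpen_inner
  have hIsub : I ⊆ interior (Omega z) := hz.inner_subset
  have hms : MeasurableSet (interior (Omega z)) := isOpen_interior.measurableSet
  have hae {f f' : ℝ × ℝ → ℂ} (hf : ∀ p ∈ Omega z, f p = f' p) :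
      f =ᵐ[volume.restrict (interior (Omega z))] f' :=
    (ae_restrict_iff' hms).2 (.of_forall fun p hp => hf p (interior_subset hp))
  obtain ⟨ux, ut, vx, vt, ⟨hux, hut, hvx, hvt⟩, -, hequ, heqv⟩ := h.equation
  have wu : HasWeakDeriv I ((1, 1) : ℝ × ℝ) ue (fun p => F (ue p, ve p)) := by
    have h1 := hux.add_dir hms hut
    have h2 : ((1, 0) + (0, 1) : ℝ × ℝ) = (1, 1) := by simp
    rw [h2] at h1
    refine (h1.congr (hae fun p hp => (eu hp).symm) ?_).mono hIsub
    filter_upwards [hequ, ae_restrict_mem hms] with p hp hpm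
    rw [eu (interior_subset hpm), ev (interior_subset hpm)]
    simp only [Pi.add_apply, hFdef, rhsU, ← hp]
    linear_combination (ux p + ut p) * Complex.I_mul_I
  have wv : HasWeakDeriv I ((-1, 1) : ℝ × ℝ) ve (fun p => G (ue p, ve p)) := by
    have h1 := hvx.neg_dir.add_dir hms hvt
    have h2 : (-(1, 0) + (0, 1) : ℝ × ℝ) = (-1, 1) := by simp
    rw [h2] at h1
    refine (h1.congr (hae fun p hp => (ev hp).symm) ?_).mono hIsub
    filter_upwards [heqv, ae_restrict_mem hms] with p hp hpm
    rw [eu (interior_subset hpm), ev (interior_subset hpm)]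
    simp only [Pi.add_apply, Pi.neg_apply, hGdef, rhsV, ← hp]
    linear_combination (vt p - vx p) * Complex.I_mul_I
  have lim {f g : ℝ → ℂ} (hf : Continuous f) (hg : Continuous g)
      (hfg : ∀ ε : ℝ, 0 < ε → f ε = g ε) : f 0 = g 0 := by
    have hf' := (hf.tendsto 0).mono_left (nhdsWithin_le_nhds (s := Ioi 0))
    have hg' := (hg.tendsto 0).mono_left (nhdsWithin_le_nhds (s := Ioi 0))
    refine tendsto_nhds_unique_of_eventuallyEq hf' hg' ?_
    filter_upwards [self_mem_nhdsWithin] with ε hε using hfg ε hε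
  refine ⟨hcu, hcv, fun x t r ht hx hr hT => ?_, fun x t r ht hr hx hT => ?_, fun x hx => ?_,
    fun t ht hT => ?_⟩
  -- Translation by (2ε, ε) moves the segment into the open domain: over a time ε the curve moves by
  -- at most ε, less than 2ε.
  · have := lim (f := fun ε => ue (x + 2 * ε + r, t + ε + r) - ue (x + 2 * ε, t + ε))
      (g := fun ε => ∫ s in (0:ℝ)..r,
        F (ue (x + 2 * ε + s, t + ε + s), ve (x + 2 * ε + s, t + ε + s)))
      (by fun_prop) (intervalIntegral.continuous_parametric_intervalIntegral_of_continuous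
        (by fun_prop) continuous_const) ?_
    · simpa using this
    · intro ε hε
      have := wu.sub_eq_integral hIo hcu (by fun_prop) (p := (x + 2 * ε, t + ε)) hr ?_
      · simpa using this
      · intro s hs
        have h1 := hz.right_mem ht hx (h := ε + s) (by linarith [hs.1])
        rw [← add_assoc] at h1
        simp only [hI, Prod.smul_mk, smul_eq_mul, mul_one, Prod.mk_add_mk, mem_ofPred_eq]
        constructor
        · linarith [hs.1]
        · linarith
  · have := lim (f := fun ε => ve (x + 2 * ε - r, t + ε + r) - ve (x + 2 * ε, t + ε))
      (g := fun ε => ∫ s in (0:ℝ)..r,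
        G (ue (x + 2 * ε - s, t + ε + s), ve (x + 2 * ε - s, t + ε + s)))
      (by fun_prop) (intervalIntegral.continuous_parametric_intervalIntegral_of_continuous
        (by fun_prop) continuous_const) ?_
    · simpa using this
    · intro ε hε
      have := wv.sub_eq_integral hIo hcv (by fun_prop) (p := (x + 2 * ε, t + ε)) hr ?_
      · simpa [← sub_eq_add_neg] using this
      · intro s hs
        have h0 := hz.left_mem ht hx hs
        have h1 := hz.right_mem (by linarith [hs.1]) h0 hε.le
        have h2 : t + s + ε = t + ε + s := by ring
        rw [h2] at h1
        simp only [hI, Prod.smul_mk, smul_eq_mul, mul_one, Prod.mk_add_mk, mem_ofPred_eq]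
        constructor
        · linarith [hs.1]
        · linarith
  · have hm : (x, (0:ℝ)) ∈ Omega z := ⟨le_rfl, by simpa [hz.zero] using hx⟩
    rw [eu hm, ev hm]
    exact h.initial x hx
  · have hm : (z t, t) ∈ Omega z := ⟨ht, le_rfl⟩
    rw [eu hm, ev hm]
    exact h.boundary t ht

/-! ### Existence for globally Lipschitz right-hand sides -/

section
open scoped ContDiff BoundedContinuousFunction

/-- The foot time must be continuous in ξ = x - t. With `z` frozen outside [0, T], the map t ↦ t -
z(t) is a strictly increasing continuous bijection of the line, so its inverse is continuous; the
foot time is this inverse at -ξ, cut off at 0. -/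
theorem TimeLike.exists_footTime {z : ℝ → ℝ} (hz : TimeLike z) {T : ℝ} (hT : 0 ≤ T) :
    ∃ τ : ℝ → ℝ, Continuous τ ∧ (∀ ξ, 0 ≤ τ ξ) ∧ (∀ ξ, 0 ≤ ξ → τ ξ = 0) ∧
      ∀ ξ t, 0 ≤ t → t ≤ T → z t - t ≤ ξ → τ ξ ≤ t ∧ (ξ ≤ 0 → z (τ ξ) - τ ξ = ξ) := by
  set c : ℝ → ℝ := fun t => max (min t T) 0 with hc
  have hc0 (t) : 0 ≤ c t := le_max_right _ _
  have hcid {t} (h0 : 0 ≤ t) (h1 : t ≤ T) : c t = t := by simp [hc, min_eq_left h1, max_eq_left h0]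
  have hcont : Continuous fun t => z (c t) :=
    hz.continuousOn.comp_continuous (by fun_prop) fun t => hc0 t
  set φ : ℝ → ℝ := fun t => t - z (c t) with hφ
  have hφc : Continuous φ := continuous_id.sub hcont
  have hφm : StrictMono φ := by
    intro s t hst
    have h1 : c s ≤ c t := max_le_max (min_le_min hst.le le_rfl) le_rfl
    have h2 : c t - c s ≤ t - s := by
      simp only [hc]
      rcases le_total s T with h | h <;> rcases le_total t T with h' | h' <;>
        simp only [min_eq_left h, min_eq_left h', min_eq_right h, min_eq_right h'] <;>
        rcases max_choice s 0 with h3 | h3 <;> rcases max_choice t 0 with h4 | h4 <;>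
        rcases max_choice T 0 with h5 | h5 <;> rw [max_eq_left hT] at * <;>
        have := le_max_left s 0 <;> have := le_max_right s 0 <;> have := le_max_left t 0 <;>
        have := le_max_right t 0 <;> linarith
    have h3 : z (c t) - z (c s) < t - s := by
      rcases h1.eq_or_lt with h | h
      · rw [h]; linarith
      · exact ((le_abs_self _).trans_lt (hz.abs_sub_lt _ _ (hc0 s) h)).trans_le h2
    simp only [hφ]; linarith
  have hzb (t) : |z (c t)| ≤ T :=
    (hz.abs_le (hc0 t)).trans (max_le (min_le_right _ _) hT)
  have hsurj : Function.Surjective φ := by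
    refine hφc.surjective ?_ ?_
    · refine Filter.tendsto_atTop_mono (fun t => ?_) (Filter.tendsto_atTop_add_const_right _ (-T)
        Filter.tendsto_id)
      have := (abs_le'.1 (hzb t)).1
      simp only [hφ, id]; linarith
    · refine Filter.tendsto_atBot_mono (fun t => ?_) (Filter.tendsto_atBot_add_const_right _ T
        Filter.tendsto_id)
      have := (abs_le'.1 (hzb t)).2
      simp only [hφ, id]; linarith
  set e := hφm.orderIsoOfSurjective φ hsurj
  have he (t) : e t = φ t := rfl
  have hec : Continuous e.symm := e.symm.continuous
  have hφ0 : φ 0 = 0 := by simp [hφ, hcid le_rfl hT, hz.zero]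
  refine ⟨fun ξ => max (e.symm (-ξ)) 0, by fun_prop, fun ξ => le_max_right _ _, fun ξ hξ => ?_,
    fun ξ t ht htT hzt => ?_⟩
  · apply max_eq_right
    rw [OrderIso.symm_apply_le, he, hφ0]; linarith
  · have h1 : e.symm (-ξ) ≤ t := by
      rw [OrderIso.symm_apply_le, he]; simp only [hφ, hcid ht htT]; linarith
    refine ⟨max_le h1 ht, fun hξ => ?_⟩
    have h2 : 0 ≤ e.symm (-ξ) := by rw [OrderIso.le_symm_apply, he, hφ0]; linarith
    simp only [max_eq_left h2]
    have h3 := e.apply_symm_apply (-ξ)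
    rw [he] at h3
    simp only [hφ, hcid h2 (h1.trans htT)] at h3
    linarith

section Existence

variable {F G : ℂ × ℂ → ℂ} {L : ℝ} {z : ℝ → ℝ} {lam u₀ v₀ : ℝ → ℂ} {T : ℝ}

/-- `u` and `v` are continuously differentiable along the characteristics of the whole plane, with
derivatives `P` and `Q`. -/
structure Transport (u v P Q : ℝ × ℝ → ℂ) : Prop where
  continuous_u : Continuous u
  continuous_v : Continuous v
  continuous_P : Continuous P
  continuous_Q : Continuous Q
  eq_u : ∀ x t h, u (x + h, t + h) - u (x, t) = ∫ s in (0:ℝ)..h, P (x + s, t + s)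
  eq_v : ∀ x t h, v (x - h, t + h) - v (x, t) = ∫ s in (0:ℝ)..h, Q (x - s, t + s)

/-- Along a characteristic the coordinate x - t (or x + t) is constant, so only the upper limit of
the integral moves. -/
theorem transport_of_primitive {f g : ℝ → ℂ} {τ : ℝ → ℝ} (hf : Continuous f) (hg : Continuous g)
    (hτ : Continuous τ) {P Q : ℝ × ℝ → ℂ} (hP : Continuous P) (hQ : Continuous Q) :
    Transport (fun q => f (q.1 - q.2) + ∫ s in τ (q.1 - q.2)..q.2, P (q.1 - q.2 + s, s))
      (fun q => g (q.1 + q.2) + ∫ s in (0:ℝ)..q.2, Q (q.1 + q.2 - s, s)) P Q := by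
  have iP (ξ a b : ℝ) : IntervalIntegrable (fun s => P (ξ + s, s)) volume a b :=
    (by fun_prop : Continuous fun s => P (ξ + s, s)).intervalIntegrable _ _
  have iQ (ξ a b : ℝ) : IntervalIntegrable (fun s => Q (ξ - s, s)) volume a b :=
    (by fun_prop : Continuous fun s => Q (ξ - s, s)).intervalIntegrable _ _
  have prim (σ : ℝ × ℝ → ℝ) (hσ : Continuous σ) :
      Continuous fun q : ℝ × ℝ => ∫ s in (0:ℝ)..σ q, P (q.1 - q.2 + s, s) :=
    intervalIntegral.continuous_parametric_intervalIntegral_of_continuous (by fun_prop) hσ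
  refine ⟨?_, ?_, hP, hQ, fun x t h => ?_, fun x t h => ?_⟩
  · have e (q : ℝ × ℝ) : ∫ s in τ (q.1 - q.2)..q.2, P (q.1 - q.2 + s, s) =
        (∫ s in (0:ℝ)..q.2, P (q.1 - q.2 + s, s)) -
          ∫ s in (0:ℝ)..τ (q.1 - q.2), P (q.1 - q.2 + s, s) :=
      (intervalIntegral.integral_interval_sub_left (iP _ _ _) (iP _ _ _)).symm
    simp only [e]
    exact (by fun_prop : Continuous fun q : ℝ × ℝ => f (q.1 - q.2)).add
      ((prim _ continuous_snd).sub (prim _ (by fun_prop)))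
  · exact (by fun_prop : Continuous fun q : ℝ × ℝ => g (q.1 + q.2)).add
      (intervalIntegral.continuous_parametric_intervalIntegral_of_continuous (by fun_prop)
        continuous_snd)
  · have e1 : x + h - (t + h) = x - t := by ring
    simp only [e1]
    rw [add_sub_add_left_eq_sub, intervalIntegral.integral_interval_sub_left (iP _ _ _) (iP _ _ _)]
    have := intervalIntegral.integral_comp_add_left (a := 0) (b := h) (fun s => P (x - t + s, s)) t
    rw [add_zero] at this
    rw [← this]
    congr 1; ext s; congr 2; ring
  · have e1 : x - h + (t + h) = x + t := by ring
    simp only [e1]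
    rw [add_sub_add_left_eq_sub, intervalIntegral.integral_interval_sub_left (iQ _ _ _) (iQ _ _ _)]
    have := intervalIntegral.integral_comp_add_left (a := 0) (b := h) (fun s => Q (x + t - s, s)) t
    rw [add_zero] at this
    rw [← this]
    congr 1; ext s; congr 2; ring

/-- Contraction principle for the integral equations in bounded continuous functions on the whole
plane. The unknown is (u, v) divided by exp(Kt); times are clamped to [0, T] and data extended
constantly, so that the operators are defined everywhere. Vanishing of `F` and `G` at 0 keeps the
image of 0 bounded. -/
theorem exists_transport (hL : 0 ≤ L) (hF : ∀ p q, ‖F p - F q‖ ≤ L * ‖p - q‖)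
    (hG : ∀ p q, ‖G p - G q‖ ≤ L * ‖p - q‖) (hF0 : F 0 = 0) (hG0 : G 0 = 0) (hz : TimeLike z)
    (hlam : ContinuousOn lam (Ici 0)) (hu₀ : ContinuousOn u₀ (Ici 0))
    (hv₀ : ContinuousOn v₀ (Ici 0)) {B : ℝ} (hBu : ∀ x, 0 ≤ x → ‖u₀ x‖ ≤ B)
    (hBv : ∀ x, 0 ≤ x → ‖v₀ x‖ ≤ B) (hcomp : u₀ 0 = lam 0 * v₀ 0) (hT : 0 ≤ T) :
    ∃ u v P Q : ℝ × ℝ → ℂ, Transport u v P Q ∧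
      (∀ p ∈ Omega z, p.2 ≤ T → P p = F (u p, v p) ∧ Q p = G (u p, v p)) ∧
      (∀ x, 0 ≤ x → u (x, 0) = u₀ x ∧ v (x, 0) = v₀ x) ∧
      (∀ t, 0 ≤ t → t ≤ T → u (z t, t) = lam t * v (z t, t)) := by
  have hFc : Continuous F := (LipschitzWith.of_dist_le_mul (K := L.toNNReal) fun p q => by
    rw [dist_eq_norm, dist_eq_norm, Real.coe_toNNReal L hL]; exact hF p q).continuous
  have hGc : Continuous G := (LipschitzWith.of_dist_le_mul (K := L.toNNReal) fun p q => by
    rw [dist_eq_norm, dist_eq_norm, Real.coe_toNNReal L hL]; exact hG p q).continuous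
  obtain ⟨τ, hτc, hτ0, hτpos, hτ⟩ := hz.exists_footTime hT
  obtain ⟨Λ₀, hΛ₀⟩ := (isCompact_Icc (a := 0) (b := T)).exists_bound_of_continuousOn
    (hlam.mono Icc_subset_Ici_self)
  set Λ := max Λ₀ 0
  have hΛ : 0 ≤ Λ := le_max_right _ _
  have hB : 0 ≤ B := (norm_nonneg _).trans (hBu 0 le_rfl)
  set c : ℝ → ℝ := fun t => max (min t T) 0 with hc
  have hc0 (t) : 0 ≤ c t := le_max_right _ _
  have hcT (t) : c t ≤ T := max_le (min_le_right _ _) hT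
  have hcid {t} (h0 : 0 ≤ t) (h1 : t ≤ T) : c t = t := by simp [hc, min_eq_left h1, max_eq_left h0]
  have hcc : Continuous c := by fun_prop
  set zT : ℝ → ℝ := fun t => z (c t) with hzT
  have hzTc : Continuous zT := hz.continuousOn.comp_continuous hcc fun t => hc0 t
  set lamT : ℝ → ℂ := fun t => lam (c t) with hlamT
  have hlamTc : Continuous lamT := hlam.comp_continuous hcc fun t => hc0 t
  have hlamTb (t) : ‖lamT t‖ ≤ Λ := (hΛ₀ _ ⟨hc0 t, hcT t⟩).trans (le_max_left _ _)
  set ue : ℝ → ℂ := fun x => u₀ (max x 0) with hue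
  have huec : Continuous ue := hu₀.comp_continuous (by fun_prop) fun x => le_max_right x 0
  set ve : ℝ → ℂ := fun x => v₀ (max x 0) with hve
  have hvec : Continuous ve := hv₀.comp_continuous (by fun_prop) fun x => le_max_right x 0
  -- The minimum ensures that the foot never exceeds the clamped time, also outside the domain; on
  -- the domain up to time `T` it changes nothing.
  set σ : ℝ × ℝ → ℝ := fun q => min (τ (q.1 - c q.2)) (c q.2) with hσ
  have hσc : Continuous σ := by fun_prop
  have hσ0 (q) : 0 ≤ σ q := le_min (hτ0 _) (hc0 _)
  have hσle (q) : σ q ≤ c q.2 := min_le_right _ _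
  -- Makes the Lipschitz constant (1 + Λ)L/K of the weighted operator at most 1/2; L + 1 in place of
  -- `L` keeps `K` positive.
  set K := 2 * (1 + Λ) * (L + 1) with hK
  have hKpos : 0 < K := by positivity
  set Vop : (ℝ × ℝ → ℂ × ℂ) → ℝ × ℝ → ℂ := fun P q => ve (q.1 + c q.2) +
    ∫ s in (0:ℝ)..c q.2, G (Real.exp (K * s) • P (q.1 + c q.2 - s, s)) with hVop
  -- One formula for both kinds of feet. For x - t ≥ 0 the foot time is 0 and the bracket vanishes.
  -- For x - t ≤ 0 the extended datum is `u₀ 0`, which cancels `lam 0 * v₀ 0` by compatibility and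
  -- leaves the boundary condition. Hence continuity across x = t.
  set Uop : (ℝ × ℝ → ℂ × ℂ) → ℝ × ℝ → ℂ := fun P q => ue (q.1 - c q.2) +
    (lamT (σ q) * Vop P (zT (σ q), σ q) - lam 0 * v₀ 0) +
    ∫ s in σ q..c q.2, F (Real.exp (K * s) • P (q.1 - c q.2 + s, s)) with hUop
  set Φ : (ℝ × ℝ → ℂ × ℂ) → ℝ × ℝ → ℂ × ℂ := fun P q =>
    Real.exp (-(K * c q.2)) • (Uop P q, Vop P q) with hΦ
  have iF {P : ℝ × ℝ → ℂ × ℂ} (hP : Continuous P) (x a b : ℝ) :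
      IntervalIntegrable (fun s => F (Real.exp (K * s) • P (x + s, s))) volume a b :=
    (by fun_prop : Continuous fun s => F (Real.exp (K * s) • P (x + s, s))).intervalIntegrable _ _
  have iG {P : ℝ × ℝ → ℂ × ℂ} (hP : Continuous P) (x a b : ℝ) :
      IntervalIntegrable (fun s => G (Real.exp (K * s) • P (x - s, s))) volume a b :=
    (by fun_prop : Continuous fun s => G (Real.exp (K * s) • P (x - s, s))).intervalIntegrable _ _
  have hVc {P : ℝ × ℝ → ℂ × ℂ} (hP : Continuous P) : Continuous (Vop P) :=
    (by fun_prop : Continuous fun q : ℝ × ℝ => ve (q.1 + c q.2)).add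
      (intervalIntegral.continuous_parametric_intervalIntegral_of_continuous (by fun_prop)
        (by fun_prop))
  have hUc {P : ℝ × ℝ → ℂ × ℂ} (hP : Continuous P) : Continuous (Uop P) := by
    have e (q : ℝ × ℝ) : ∫ s in σ q..c q.2, F (Real.exp (K * s) • P (q.1 - c q.2 + s, s)) =
        (∫ s in (0:ℝ)..c q.2, F (Real.exp (K * s) • P (q.1 - c q.2 + s, s))) -
          ∫ s in (0:ℝ)..σ q, F (Real.exp (K * s) • P (q.1 - c q.2 + s, s)) :=
      (intervalIntegral.integral_interval_sub_left (iF hP _ _ _) (iF hP _ _ _)).symm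
    have prim (ρ : ℝ × ℝ → ℝ) (hρ : Continuous ρ) : Continuous fun q : ℝ × ℝ =>
        ∫ s in (0:ℝ)..ρ q, F (Real.exp (K * s) • P (q.1 - c q.2 + s, s)) :=
      intervalIntegral.continuous_parametric_intervalIntegral_of_continuous (by fun_prop) hρ
    simp only [hUop, e]
    have := hVc hP
    exact (by fun_prop : Continuous fun q : ℝ × ℝ => ue (q.1 - c q.2) +
      (lamT (σ q) * Vop P (zT (σ q), σ q) - lam 0 * v₀ 0)).add
        ((prim _ (by fun_prop)).sub (prim _ hσc))
  have hΦc {P : ℝ × ℝ → ℂ × ℂ} (hP : Continuous P) : Continuous (Φ P) :=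
    (by fun_prop : Continuous fun q : ℝ × ℝ => Real.exp (-(K * c q.2))).smul
      ((hUc hP).prodMk (hVc hP))
  have hscale {P P' : ℝ × ℝ → ℂ × ℂ} {D : ℝ} (hD : ∀ q, ‖P q - P' q‖ ≤ D) {H : ℂ × ℂ → ℂ}
      (hH : ∀ p q, ‖H p - H q‖ ≤ L * ‖p - q‖) (s : ℝ) (y : ℝ × ℝ) :
      ‖H (Real.exp (K * s) • P y) - H (Real.exp (K * s) • P' y)‖ ≤
        L * D * Real.exp (K * s) := by
    refine (hH _ _).trans ?_
    rw [← smul_sub, norm_smul, Real.norm_of_nonneg (Real.exp_pos _).le]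
    have h1 := mul_le_mul_of_nonneg_left (hD y) (Real.exp_pos (K * s)).le
    have h2 := mul_le_mul_of_nonneg_left h1 hL
    linarith
  have estV {P P' : ℝ × ℝ → ℂ × ℂ} (hP : Continuous P) (hP' : Continuous P') {D : ℝ} (hD0 : 0 ≤ D)
      (hD : ∀ q, ‖P q - P' q‖ ≤ D) (q) :
      ‖Vop P q - Vop P' q‖ ≤ L * D / K * Real.exp (K * c q.2) := by
    simp only [hVop]
    rw [add_sub_add_left_eq_sub, ← intervalIntegral.integral_sub (iG hP _ _ _) (iG hP' _ _ _)]
    exact norm_integral_le_exp (hc0 _) hKpos (by positivity) fun s _ => hscale hD hG s _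
  have estU {P P' : ℝ × ℝ → ℂ × ℂ} (hP : Continuous P) (hP' : Continuous P') {D : ℝ} (hD0 : 0 ≤ D)
      (hD : ∀ q, ‖P q - P' q‖ ≤ D) (q) :
      ‖Uop P q - Uop P' q‖ ≤ (1 + Λ) * (L * D / K * Real.exp (K * c q.2)) := by
    have e : Uop P q - Uop P' q = lamT (σ q) * (Vop P (zT (σ q), σ q) - Vop P' (zT (σ q), σ q)) +
        ((∫ s in σ q..c q.2, F (Real.exp (K * s) • P (q.1 - c q.2 + s, s))) -
        ∫ s in σ q..c q.2, F (Real.exp (K * s) • P' (q.1 - c q.2 + s, s))) := by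
      simp only [hUop]; ring
    rw [e, ← intervalIntegral.integral_sub (iF hP _ _ _) (iF hP' _ _ _)]
    have h1 : ‖∫ s in σ q..c q.2, (F (Real.exp (K * s) • P (q.1 - c q.2 + s, s)) -
        F (Real.exp (K * s) • P' (q.1 - c q.2 + s, s)))‖ ≤ L * D / K * Real.exp (K * c q.2) :=
      norm_integral_le_exp (hσle _) hKpos (by positivity) fun s _ => hscale hD hF s _
    have h2 : ‖lamT (σ q) * (Vop P (zT (σ q), σ q) - Vop P' (zT (σ q), σ q))‖ ≤
        Λ * (L * D / K * Real.exp (K * c q.2)) := by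
      rw [norm_mul]
      gcongr
      · exact hlamTb _
      · refine (estV hP hP' hD0 hD _).trans ?_
        have : c (σ q) ≤ c q.2 := by
          rw [hcid (hσ0 q) ((hσle q).trans (hcT _))]; exact hσle q
        gcongr
    refine (norm_add_le _ _).trans ?_
    linarith
  have estΦ {P P' : ℝ × ℝ → ℂ × ℂ} (hP : Continuous P) (hP' : Continuous P') {D : ℝ} (hD0 : 0 ≤ D)
      (hD : ∀ q, ‖P q - P' q‖ ≤ D) (q) : ‖Φ P q - Φ P' q‖ ≤ D / 2 := by
    simp only [hΦ]
    rw [← smul_sub, norm_smul, Real.norm_of_nonneg (Real.exp_pos _).le, Prod.mk_sub_mk]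
    have hX : 0 ≤ L * D / K * Real.exp (K * c q.2) := by positivity
    have h1 : ‖(Uop P q - Uop P' q, Vop P q - Vop P' q)‖ ≤
        (1 + Λ) * (L * D / K * Real.exp (K * c q.2)) :=
      max_le (estU hP hP' hD0 hD q) ((estV hP hP' hD0 hD q).trans (by nlinarith))
    calc _ ≤ Real.exp (-(K * c q.2)) * ((1 + Λ) * (L * D / K * Real.exp (K * c q.2))) := by
          gcongr
      _ = (1 + Λ) * (L * D / K) * (Real.exp (-(K * c q.2)) * Real.exp (K * c q.2)) := by ring
      _ = (1 + Λ) * (L * D / K) := by rw [← Real.exp_add]; simp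
      _ = L / (L + 1) * (D / 2) := by rw [hK]; field_simp
      _ ≤ 1 * (D / 2) := by
          gcongr
          rw [div_le_one (by positivity)]; linarith
      _ = D / 2 := one_mul _
  have bdΦ0 (q) : ‖Φ (fun _ => 0) q‖ ≤ B + (Λ * B + Λ * B) := by
    have hve' (x) : ‖ve x‖ ≤ B := hBv _ (le_max_right _ _)
    have hV0 (q) : Vop (fun _ => 0) q = ve (q.1 + c q.2) := by simp [hVop, hG0]
    have hl0 : ‖lam 0‖ ≤ Λ := (hΛ₀ _ ⟨le_rfl, hT⟩).trans (le_max_left _ _)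
    have hU0 : Uop (fun _ => 0) q = ue (q.1 - c q.2) +
      (lamT (σ q) * Vop (fun _ => 0) (zT (σ q), σ q) - lam 0 * v₀ 0) := by simp [hUop, hF0]
    have hle : Real.exp (-(K * c q.2)) ≤ 1 :=
      Real.exp_le_one_iff.2 (neg_nonpos.2 (mul_nonneg hKpos.le (hc0 _)))
    simp only [hΦ]
    rw [norm_smul, Real.norm_of_nonneg (Real.exp_pos _).le]
    have h1 : ‖(Uop (fun _ => 0) q, Vop (fun _ => 0) q)‖ ≤ B + (Λ * B + Λ * B) := by
      refine max_le ?_ ?_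
      · simp only
        rw [hU0, hV0]
        refine (norm_add_le _ _).trans (add_le_add (hBu _ (le_max_right _ _)) ?_)
        refine (norm_sub_le _ _).trans (add_le_add ?_ ?_) <;> rw [norm_mul]
        · gcongr
          · exact hlamTb _
          · exact hve' _
        · gcongr
          exact hBv 0 le_rfl
      · simp only
        rw [hV0]
        have := hve' (q.1 + c q.2)
        have : 0 ≤ Λ * B := by positivity
        linarith
    calc _ ≤ 1 * (B + (Λ * B + Λ * B)) := by gcongr
      _ = _ := one_mul _
  set Ψ : (ℝ × ℝ →ᵇ ℂ × ℂ) → (ℝ × ℝ →ᵇ ℂ × ℂ) := fun P =>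
    BoundedContinuousFunction.ofNormedAddCommGroup (Φ P) (hΦc P.continuous)
      (‖P‖ / 2 + (B + (Λ * B + Λ * B))) (fun q => by
        have h1 := estΦ P.continuous (continuous_const (y := (0 : ℂ × ℂ))) (norm_nonneg P)
          (fun q => by simpa using P.norm_coe_le_norm q) q
        have h2 := bdΦ0 q
        have h3 := norm_le_norm_add_norm_sub' (Φ P q) (Φ (fun _ => 0) q)
        linarith) with hΨ
  have hcontr : ContractingWith (1 / 2) Ψ := by
    refine ⟨by norm_num, LipschitzWith.of_dist_le_mul fun P P' => ?_⟩
    refine (BoundedContinuousFunction.dist_le (by positivity)).2 fun q => ?_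
    rw [dist_eq_norm]
    have := estΦ P.continuous P'.continuous dist_nonneg (D := dist P P')
      (fun q => by rw [← dist_eq_norm]; exact BoundedContinuousFunction.dist_coe_le_dist q) q
    simp only [hΨ, BoundedContinuousFunction.coe_ofNormedAddCommGroup, NNReal.coe_div,
      NNReal.coe_one, NNReal.coe_ofNat]
    linarith
  obtain ⟨P, hfix⟩ : ∃ P, Ψ P = P := ⟨_, hcontr.fixedPoint_isFixedPt⟩
  have hPfix (q) : P q = Φ P q := by
    conv_lhs => rw [← hfix]
    rfl
  have hPc := P.continuous
  set p : ℝ × ℝ → ℂ × ℂ := fun q => Real.exp (K * q.2) • P q with hp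
  have hpc : Continuous p := by fun_prop
  have hp_eq {q : ℝ × ℝ} (h0 : 0 ≤ q.2) (h1 : q.2 ≤ T) : p q = (Uop P q, Vop P q) := by
    simp only [hp]
    rw [hPfix]
    simp only [hΦ, smul_smul, hcid h0 h1]
    rw [← Real.exp_add]; simp
  -- The fixed point obeys the equations only in the strip. `u` and `v` are rebuilt from it without
  -- clamped times, so that the transport identities hold on the whole plane; in the strip nothing
  -- changes.
  set v : ℝ × ℝ → ℂ := fun q => ve (q.1 + q.2) + ∫ s in (0:ℝ)..q.2, G (p (q.1 + q.2 - s, s))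
    with hv
  have hvV {x t : ℝ} (h0 : 0 ≤ t) (h1 : t ≤ T) : v (x, t) = Vop P (x, t) := by
    simp only [hv, hVop, hp, hcid h0 h1]
  set base : ℝ → ℂ := fun ξ => ue ξ + (lamT (τ ξ) * v (zT (τ ξ), τ ξ) - lam 0 * v₀ 0) with hbase
  set u : ℝ × ℝ → ℂ := fun q => base (q.1 - q.2) +
    ∫ s in τ (q.1 - q.2)..q.2, F (p (q.1 - q.2 + s, s)) with hu
  have hPc' : Continuous fun q => F (p q) := by fun_prop
  have hQc' : Continuous fun q => G (p q) := by fun_prop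
  have hvc : Continuous v := (transport_of_primitive huec hvec hτc hPc' hQc').continuous_v
  have hbasec : Continuous base := by fun_prop
  have htr : Transport u v (fun q => F (p q)) (fun q => G (p q)) :=
    transport_of_primitive hbasec hvec hτc hPc' hQc'
  have hpuv : ∀ q ∈ Omega z, q.2 ≤ T → p q = (u q, v q) := by
    rintro ⟨x, t⟩ ⟨h0, h1⟩ h2
    simp only at h0 h1 h2
    have h3 := hτ (x - t) t h0 h2 (by linarith)
    have h4 : σ (x, t) = τ (x - t) := by
      simp only [hσ, hcid h0 h2]; exact min_eq_left h3.1
    rw [hp_eq h0 h2, hvV h0 h2]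
    congr 1
    simp only [hUop, h4, hu, hbase, hcid h0 h2]
    rw [← hvV (hτ0 _) (h3.1.trans h2)]
  refine ⟨u, v, _, _, htr, fun q hq hqT => by simp only [hpuv q hq hqT, and_self],
    fun x hx => ⟨?_, ?_⟩, fun t ht htT => ?_⟩
  · simp only [hu, hbase, sub_zero, hτpos x hx, intervalIntegral.integral_same, add_zero, hlamT, hzT,
      hcid le_rfl hT, hz.zero, hv, hve, hue]
    simp [max_eq_left hx]
  · simp only [hv, hve, add_zero, max_eq_left hx, intervalIntegral.integral_same]
  · have h1 : z t - t ≤ 0 := by have := (abs_le'.1 (hz.abs_le ht)).1; linarith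
    obtain ⟨h2, h3⟩ := hτ (z t - t) t ht htT le_rfl
    have h4 := h3 h1
    have h5 : τ (z t - t) = t := by
      by_contra hne
      have h6 := (abs_lt.1 (hz.abs_sub_lt _ _ (hτ0 _) (lt_of_le_of_ne h2 hne))).2
      linarith
    simp only [hu, hbase, h5, intervalIntegral.integral_same, add_zero, hlamT, hzT, hcid ht htT,
      hue, max_eq_right h1, hcomp]
    ring

end Existence

end

/-! ### Differentiation of integrals with moving limits -/

section Leibniz

theorem continuous_primitive_uncurry {U : ℝ → ℝ → ℝ} (hU : Continuous (Function.uncurry U)) :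
    Continuous fun q : ℝ × ℝ => ∫ ξ in (0:ℝ)..q.1, U ξ q.2 :=
  intervalIntegral.continuous_parametric_intervalIntegral_of_continuous
    (f := fun (q : ℝ × ℝ) ξ => U ξ q.2)
    (hU.comp (by fun_prop : Continuous fun r : (ℝ × ℝ) × ℝ => (r.2, r.1.2))) continuous_fst

theorem hasDerivAt_integral_of_continuous {U U' : ℝ → ℝ → ℝ} (hU : Continuous (Function.uncurry U))
    (hU' : Continuous (Function.uncurry U')) (hd : ∀ ξ s, HasDerivAt (U ξ) (U' ξ s) s) (a t : ℝ) :
    HasDerivAt (fun s => ∫ ξ in (0:ℝ)..a, U ξ s) (∫ ξ in (0:ℝ)..a, U' ξ t) t := by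
  obtain ⟨C, hC⟩ := ((isCompact_uIcc (a := (0:ℝ)) (b := a)).prod
    (isCompact_closedBall t 1)).exists_bound_of_continuousOn hU'.continuousOn
  have sl {W : ℝ → ℝ → ℝ} (hW : Continuous (Function.uncurry W)) (s : ℝ) :
      Continuous fun ξ => W ξ s := hW.comp (by fun_prop : Continuous fun ξ : ℝ => (ξ, s))
  exact (intervalIntegral.hasDerivAt_integral_of_dominated_loc_of_deriv_le
    (F := fun s ξ => U ξ s) (F' := fun s ξ => U' ξ s) (bound := fun _ => C)
    (Metric.ball_mem_nhds t one_pos)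
    (.of_forall fun s => (sl hU s).aestronglyMeasurable)
    ((sl hU t).intervalIntegrable _ _) (sl hU' t).aestronglyMeasurable
    (.of_forall fun ξ hξ s hs => hC (ξ, s) ⟨uIoc_subset_uIcc hξ, Metric.ball_subset_closedBall hs⟩)
    (by simp) (.of_forall fun ξ _ s _ => hd ξ s)).2

/-- Leibniz' rule with moving limits. -/
theorem hasDerivAt_integral_moving {U U' : ℝ → ℝ → ℝ} (hU : Continuous (Function.uncurry U))
    (hU' : Continuous (Function.uncurry U')) (hd : ∀ ξ s, HasDerivAt (U ξ) (U' ξ s) s)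
    {A B : ℝ → ℝ} {A' B' t : ℝ} (hA : HasDerivAt A A' t) (hB : HasDerivAt B B' t) :
    HasDerivAt (fun s => ∫ ξ in A s..B s, U ξ s)
      ((∫ ξ in A t..B t, U' ξ t) + B' * U (B t) t - A' * U (A t) t) t := by
  have sl {W : ℝ → ℝ → ℝ} (hW : Continuous (Function.uncurry W)) (s : ℝ) :
      Continuous fun ξ => W ξ s := hW.comp (by fun_prop : Continuous fun ξ : ℝ => (ξ, s))
  have ii {W : ℝ → ℝ → ℝ} (hW : Continuous (Function.uncurry W)) (s a b : ℝ) :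
    IntervalIntegrable (fun ξ => W ξ s) volume a b := (sl hW s).intervalIntegrable _ _
  set H : ℝ → ℝ → ℝ := fun a s => ∫ ξ in (0:ℝ)..a, U ξ s with hH
  have key {C : ℝ → ℝ} {C' : ℝ} (hC : HasDerivAt C C' t) :
      HasDerivAt (fun s => H (C s) s) ((∫ ξ in (0:ℝ)..C t, U' ξ t) + C' * U (C t) t) t := by
    -- Both partial derivatives of `H` are continuous, so `H` is differentiable as a function of two
    -- variables and the chain rule applies along s ↦ (C s, s).
    have h1 := hasStrictFDerivAt_uncurry_coprod (𝕜 := ℝ) (u := (C t, t)) (f := H)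
      (f₁ := fun a s => ContinuousLinearMap.toSpanSingleton ℝ (U a s))
      (f₂ := fun a s => ContinuousLinearMap.toSpanSingleton ℝ (∫ ξ in (0:ℝ)..a, U' ξ s))
      (.of_forall fun q => ?_) (.of_forall fun q => ?_) ?_ ?_
    · have h0 : HasFDerivAt (fun q : ℝ × ℝ => H q.1 q.2) _ (C t, t) := h1.hasFDerivAt
      have hl : HasDerivAt (fun s => (C s, s)) (C', (1:ℝ)) t := hC.prodMk (hasDerivAt_id t)
      have h2 := HasFDerivAt.comp_hasDerivAt_of_eq t h0 hl rfl
      have e : ((ContinuousLinearMap.toSpanSingleton ℝ (U (C t) t)).coprod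
        (ContinuousLinearMap.toSpanSingleton ℝ (∫ ξ in (0:ℝ)..C t, U' ξ t))) (C', 1) =
          (∫ ξ in (0:ℝ)..C t, U' ξ t) + C' * U (C t) t := by
        simp [ContinuousLinearMap.coprod_apply]; ring
      rw [← e]
      exact h2
    · exact (intervalIntegral.integral_hasDerivAt_right (ii hU _ _ _)
        ((sl hU _).stronglyMeasurableAtFilter _ _) (sl hU _).continuousAt).hasFDerivAt
    · exact (hasDerivAt_integral_of_continuous hU hU' hd _ _).hasFDerivAt
    · exact (ContinuousLinearMap.toSpanSingletonCLE (𝕜 := ℝ) (E := ℝ)).continuous.comp hU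
        |>.continuousAt
    · exact (ContinuousLinearMap.toSpanSingletonCLE (𝕜 := ℝ) (E := ℝ)).continuous.comp
        (continuous_primitive_uncurry hU') |>.continuousAt
  have h3 := (key hB).sub (key hA)
  have e1 : (fun s => ∫ ξ in A s..B s, U ξ s) = (fun s => H (B s) s) - fun s => H (A s) s := by
    ext s
    exact (intervalIntegral.integral_interval_sub_left (ii hU _ _ _) (ii hU _ _ _)).symm
  rw [e1]
  refine h3.congr_deriv ?_
  have e2 : (∫ ξ in (0:ℝ)..B t, U' ξ t) - ∫ ξ in (0:ℝ)..A t, U' ξ t = ∫ ξ in A t..B t, U' ξ t :=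
    intervalIntegral.integral_interval_sub_left (ii hU' _ _ _) (ii hU' _ _ _)
  linear_combination e2

end Leibniz

/-! ### Conservation of charge -/

/-- The structural properties of the nonlinearity: conservation of charge, and a growth bound
along characteristics. -/
structure Conservative (m b : ℝ) (F G : ℂ × ℂ → ℂ) : Prop where
  cancel : ∀ p, inner ℝ p.1 (F p) + inner ℝ p.2 (G p) = 0
  growth : ∀ p, |2 * inner ℝ p.1 (F p)| ≤
    m * (‖p.1‖ ^ 2 + ‖p.2‖ ^ 2) + b * (‖p.1‖ ^ 2 * ‖p.2‖ ^ 2)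

/-- The `α` term is an imaginary multiple of `u`, hence orthogonal to it. What remains depends only
on the real and imaginary parts of ūv, and occurs with the opposite sign in the equation for `v`. -/
theorem inner_rhsU_smul (m α β : ℝ) (u v : ℂ) (c : ℝ) :
    inner ℝ u (rhsU m α β (c • (u, v))) =
      -c * m * (u.re * v.im - u.im * v.re) +
        4 * c ^ 3 * β * ((u.re * v.re + u.im * v.im) * (u.re * v.im - u.im * v.re)) := by
  simp only [rhsU, N₁, ofReal_norm_sq, Complex.inner,
    Complex.real_smul, Prod.smul_mk, Complex.star_def]
  simp
  ring

theorem inner_rhsV_smul (m α β : ℝ) (u v : ℂ) (c : ℝ) :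
    inner ℝ v (rhsV m α β (c • (u, v))) =
      -(-c * m * (u.re * v.im - u.im * v.re) +
        4 * c ^ 3 * β * ((u.re * v.re + u.im * v.im) * (u.re * v.im - u.im * v.re))) := by
  simp only [rhsV, N₂, ofReal_norm_sq, Complex.inner,
    Complex.real_smul, Prod.smul_mk, Complex.star_def]
  simp
  ring

/-- The truncated right-hand sides have this form with a scalar factor in [0, 1], so the constants
do not see the truncation radius. The bounds are 2|Im ūv| ≤ |u|² + |v|² and 2|Re ūv · Im ūv| ≤
|u|²|v|². -/
theorem conservative_rhs_comp {m : ℝ} (hm : 0 ≤ m) (α β : ℝ) {c : ℂ × ℂ → ℝ} (hc0 : ∀ p, 0 ≤ c p)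
    (hc1 : ∀ p, c p ≤ 1) :
    Conservative m (4 * |β|) (fun p => rhsU m α β (c p • p)) (fun p => rhsV m α β (c p • p)) := by
  refine ⟨fun p => ?_, fun p => ?_⟩
  · have h1 := inner_rhsU_smul m α β p.1 p.2 (c p)
    have h2 := inner_rhsV_smul m α β p.1 p.2 (c p)
    rw [Prod.mk.eta] at h1 h2
    rw [h1, h2]; ring
  · have h1 := inner_rhsU_smul m α β p.1 p.2 (c p)
    rw [Prod.mk.eta] at h1
    rw [h1, ← Complex.normSq_eq_norm_sq, ← Complex.normSq_eq_norm_sq, Complex.normSq_apply,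
      Complex.normSq_apply]
    set a := p.1.re
    set b := p.1.im
    set d := p.2.re
    set e := p.2.im
    have hs : |2 * (a * e - b * d)| ≤ a * a + b * b + (d * d + e * e) := by
      rw [abs_le]; constructor <;> nlinarith [sq_nonneg (a - e), sq_nonneg (a + e),
        sq_nonneg (b - d), sq_nonneg (b + d)]
    have hr : |2 * ((a * d + b * e) * (a * e - b * d))| ≤ (a * a + b * b) * (d * d + e * e) := by
      rw [abs_le]
      constructor <;> nlinarith [sq_nonneg ((a * d + b * e) - (a * e - b * d)),
        sq_nonneg ((a * d + b * e) + (a * e - b * d))]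
    have h0 := hc0 p
    have hle := hc1 p
    have hc3 : c p ^ 3 ≤ 1 := pow_le_one₀ h0 hle
    have e1 : 2 * (-c p * m * (a * e - b * d) + 4 * c p ^ 3 * β *
        ((a * d + b * e) * (a * e - b * d))) = -(c p * m * (2 * (a * e - b * d))) +
        c p ^ 3 * (4 * β) * (2 * ((a * d + b * e) * (a * e - b * d))) := by ring
    rw [e1]
    refine (abs_add_le _ _).trans (add_le_add ?_ ?_)
    · rw [abs_neg, abs_mul, abs_of_nonneg (by positivity)]
      exact mul_le_mul (by nlinarith) hs (abs_nonneg _) hm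
    · rw [abs_mul, abs_mul, abs_mul, abs_of_nonneg (pow_nonneg h0 3), abs_of_nonneg (by norm_num)]
      refine mul_le_mul ?_ hr (abs_nonneg _) (by positivity)
      exact mul_le_of_le_one_left (by positivity) hc3

section Charge

variable {u v P Q : ℝ × ℝ → ℂ}

theorem Transport.hasDerivAt_u (h : Transport u v P Q) (ξ s : ℝ) :
    HasDerivAt (fun s => u (ξ + s, s)) (P (ξ + s, s)) s := by
  have hP := h.continuous_P
  have e : (fun s => u (ξ + s, s)) = fun s => u (ξ, 0) + ∫ r in (0:ℝ)..s, P (ξ + r, r) := by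
    ext s
    have := h.eq_u ξ 0 s
    simp only [zero_add] at this
    rw [← this]; ring
  rw [e]
  exact ((intervalIntegral.integral_hasDerivAt_right
    ((by fun_prop : Continuous fun r => P (ξ + r, r)).intervalIntegrable _ _)
    ((by fun_prop : Continuous fun r => P (ξ + r, r)).stronglyMeasurableAtFilter _ _)
    (by fun_prop : Continuous fun r => P (ξ + r, r)).continuousAt)).const_add _

theorem Transport.hasDerivAt_v (h : Transport u v P Q) (η s : ℝ) :
    HasDerivAt (fun s => v (η - s, s)) (Q (η - s, s)) s := by
  have hQ := h.continuous_Q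
  have e : (fun s => v (η - s, s)) = fun s => v (η, 0) + ∫ r in (0:ℝ)..s, Q (η - r, r) := by
    ext s
    have := h.eq_v η 0 s
    simp only [zero_add] at this
    rw [← this]; ring
  rw [e]
  exact ((intervalIntegral.integral_hasDerivAt_right
    ((by fun_prop : Continuous fun r => Q (η - r, r)).intervalIntegrable _ _)
    ((by fun_prop : Continuous fun r => Q (η - r, r)).stronglyMeasurableAtFilter _ _)
    (by fun_prop : Continuous fun r => Q (η - r, r)).continuousAt)).const_add _

/-- The charge density. -/
noncomputable def density (u v : ℝ × ℝ → ℂ) (p : ℝ × ℝ) : ℝ := ‖u p‖ ^ 2 + ‖v p‖ ^ 2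

theorem Transport.continuous_density (h : Transport u v P Q) : Continuous (density u v) := by
  have := h.continuous_u
  have := h.continuous_v
  unfold density
  fun_prop

theorem density_nonneg (p : ℝ × ℝ) : 0 ≤ density u v p := by unfold density; positivity

/-- Each half of the density is written in its characteristic coordinate, y - t for `u` and y + t
for `v`. The integrands are then differentiable in time although `u` and `v` need not be; the bulk
terms cancel and the fluxes at the two ends remain. -/
theorem Transport.hasDerivAt_charge (h : Transport u v P Q) {a b : ℝ → ℝ} {a' b' t : ℝ}
    (ha : HasDerivAt a a' t) (hb : HasDerivAt b b' t) (hab : a t ≤ b t)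
    (hPQ : ∀ y ∈ Icc (a t) (b t),
      inner ℝ (u (y, t)) (P (y, t)) + inner ℝ (v (y, t)) (Q (y, t)) = 0) :
    HasDerivAt (fun s => ∫ y in a s..b s, density u v (y, s))
      ((b' - 1) * ‖u (b t, t)‖ ^ 2 + (b' + 1) * ‖v (b t, t)‖ ^ 2
        - (a' - 1) * ‖u (a t, t)‖ ^ 2 - (a' + 1) * ‖v (a t, t)‖ ^ 2) t := by
  have hu := h.continuous_u
  have hv := h.continuous_v
  have hP := h.continuous_P
  have hQ := h.continuous_Q
  have d1 := hasDerivAt_integral_moving (U := fun ξ s => ‖u (ξ + s, s)‖ ^ 2)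
    (U' := fun ξ s => 2 * inner ℝ (u (ξ + s, s)) (P (ξ + s, s)))
    (by simp only [Function.uncurry_def]; fun_prop) (by simp only [Function.uncurry_def]; fun_prop)
    (fun ξ s => (h.hasDerivAt_u ξ s).norm_sq) (ha.sub (hasDerivAt_id t)) (hb.sub (hasDerivAt_id t))
  have d2 := hasDerivAt_integral_moving (U := fun ξ s => ‖v (ξ - s, s)‖ ^ 2)
    (U' := fun ξ s => 2 * inner ℝ (v (ξ - s, s)) (Q (ξ - s, s)))
    (by simp only [Function.uncurry_def]; fun_prop) (by simp only [Function.uncurry_def]; fun_prop)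
    (fun ξ s => (h.hasDerivAt_v ξ s).norm_sq) (ha.add (hasDerivAt_id t)) (hb.add (hasDerivAt_id t))
  have d3 := d1.add d2
  simp only [Pi.sub_apply, Pi.add_apply, id] at d3
  have e : (fun s => ∫ y in a s..b s, density u v (y, s)) =
      (fun s => ∫ ξ in a s - s..b s - s, ‖u (ξ + s, s)‖ ^ 2) +
        fun s => ∫ ξ in a s + s..b s + s, ‖v (ξ - s, s)‖ ^ 2 := by
    ext s
    simp only [Pi.add_apply, density]
    rw [intervalIntegral.integral_comp_add_right (fun y => ‖u (y, s)‖ ^ 2),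
      intervalIntegral.integral_comp_sub_right (fun y => ‖v (y, s)‖ ^ 2),
      intervalIntegral.integral_add
        ((by fun_prop : Continuous fun y => ‖u (y, s)‖ ^ 2).intervalIntegrable _ _)
        ((by fun_prop : Continuous fun y => ‖v (y, s)‖ ^ 2).intervalIntegrable _ _)]
    simp
  rw [e]
  refine d3.congr_deriv ?_
  have e1 : (∫ ξ in a t - t..b t - t, 2 * inner ℝ (u (ξ + t, t)) (P (ξ + t, t))) +
      ∫ ξ in a t + t..b t + t, 2 * inner ℝ (v (ξ - t, t)) (Q (ξ - t, t)) = 0 := by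
    rw [intervalIntegral.integral_comp_add_right
        (fun y => 2 * inner ℝ (u (y, t)) (P (y, t))),
      intervalIntegral.integral_comp_sub_right (fun y => 2 * inner ℝ (v (y, t)) (Q (y, t)))]
    simp only [sub_add_cancel, add_sub_cancel_right]
    rw [← intervalIntegral.integral_add
      ((by fun_prop : Continuous fun y => 2 * inner ℝ (u (y, t)) (P (y, t))).intervalIntegrable _ _)
      ((by fun_prop : Continuous fun y => 2 * inner ℝ (v (y, t)) (Q (y, t))).intervalIntegrable _ _)]
    rw [intervalIntegral.integral_congr (g := fun _ => (0:ℝ)), intervalIntegral.integral_zero]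
    intro y hy
    rw [uIcc_of_le hab] at hy
    have := hPQ y hy
    simp only
    linarith
  simp only [sub_add_cancel, add_sub_cancel_right]
  linear_combination e1

theorem continuousOn_charge (h : Transport u v P Q) {a b : ℝ → ℝ} {s : Set ℝ}
    (ha : ContinuousOn a s) (hb : ContinuousOn b s) :
    ContinuousOn (fun t => ∫ y in a t..b t, density u v (y, t)) s := by
  have hd := h.continuous_density
  have hH := continuous_primitive_uncurry (U := fun y t => density u v (y, t))
    (by simpa [Function.uncurry_def] using hd)
  have e : (fun t => ∫ y in a t..b t, density u v (y, t)) = fun t =>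
      (∫ y in (0:ℝ)..b t, density u v (y, t)) - ∫ y in (0:ℝ)..a t, density u v (y, t) := by
    ext t
    have i (c d) : IntervalIntegrable (fun y => density u v (y, t)) volume c d :=
      (by fun_prop : Continuous fun y => density u v (y, t)).intervalIntegrable _ _
    exact (intervalIntegral.integral_interval_sub_left (i _ _) (i _ _)).symm
  rw [e]
  exact (hH.comp_continuousOn (hb.prodMk continuousOn_id)).sub
    (hH.comp_continuousOn (ha.prodMk continuousOn_id))

/-- Gronwall by an integrating factor; as `k` is nonnegative, that factor is at most 1 and the
source `j` enters undamped. No sign of `f` is needed. -/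
theorem le_of_deriv_le_mul_add {f f' k j : ℝ → ℝ} {a b : ℝ} (hab : a ≤ b) (hk : Continuous k)
    (hj : Continuous j) (hk0 : ∀ s, 0 ≤ k s) (hj0 : ∀ s, 0 ≤ j s)
    (hf : ∀ s, HasDerivAt f (f' s) s) (hle : ∀ s ∈ Icc a b, f' s ≤ k s * f s + j s) :
    f b ≤ (f a + ∫ s in a..b, j s) * Real.exp (∫ s in a..b, k s) := by
  have hK (s) : HasDerivAt (fun s => ∫ r in a..s, k r) (k s) s :=
    intervalIntegral.integral_hasDerivAt_right (hk.intervalIntegrable _ _)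
      (hk.stronglyMeasurableAtFilter _ _) hk.continuousAt
  have hJ (s) : HasDerivAt (fun s => ∫ r in a..s, j r) (j s) s :=
    intervalIntegral.integral_hasDerivAt_right (hj.intervalIntegrable _ _)
      (hj.stronglyMeasurableAtFilter _ _) hj.continuousAt
  have hφ (s) : HasDerivAt (fun s => f s * Real.exp (-∫ r in a..s, k r) - ∫ r in a..s, j r)
      (f' s * Real.exp (-∫ r in a..s, k r) +
        f s * (Real.exp (-∫ r in a..s, k r) * -k s) - j s) s :=
    ((hf s).mul (hK s).neg.exp).sub (hJ s)
  have hanti : AntitoneOn (fun s => f s * Real.exp (-∫ r in a..s, k r) - ∫ r in a..s, j r)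
      (Icc a b) := by
    refine antitoneOn_of_hasDerivWithinAt_nonpos (convex_Icc a b)
      (fun s _ => (hφ s).continuousAt.continuousWithinAt) (fun s _ => (hφ s).hasDerivWithinAt)
      fun s hs => ?_
    rw [interior_Icc] at hs
    have h1 := hle s (Ioo_subset_Icc_self hs)
    have h2 : Real.exp (-∫ r in a..s, k r) ≤ 1 := Real.exp_le_one_iff.2
      (neg_nonpos.2 (intervalIntegral.integral_nonneg hs.1.le fun r _ => hk0 r))
    have h3 := Real.exp_pos (-∫ r in a..s, k r)
    have h4 := hj0 s
    nlinarith
  have h1 := hanti ⟨le_rfl, hab⟩ ⟨hab, le_rfl⟩ hab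
  simp only [intervalIntegral.integral_same, neg_zero, Real.exp_zero, mul_one, sub_zero] at h1
  have h2 : f b * Real.exp (-∫ r in a..b, k r) ≤ f a + ∫ r in a..b, j r := by linarith
  have h3 := mul_le_mul_of_nonneg_right h2 (Real.exp_pos (∫ r in a..b, k r)).le
  rwa [mul_assoc, ← Real.exp_add, neg_add_cancel, Real.exp_zero, mul_one] at h3

end Charge

/-! ### A priori bound independent of the truncation -/

/-- The boundary condition does not create charge. -/
def Dissipative (z : ℝ → ℝ) (lam : ℝ → ℂ) : Prop :=
  ∀ t, 0 < t → ∃ d, HasDerivAt z d t ∧ ‖lam t‖ ^ 2 * (1 - d) ≤ 1 + d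

section Flux

variable {u v P Q : ℝ × ℝ → ℂ} {z : ℝ → ℝ} {lam : ℝ → ℂ} {T : ℝ}

/-- Charge balance between the curve and the `v`-characteristic through (x, t). The flux at the
curve is ((1 - z')|lam|² - (1 + z'))|v|² ≤ 0, and through the characteristic charge leaves at the
rate 2|u|². -/
theorem Transport.charge_le (h : Transport u v P Q) (hz : TimeLike z) (hd : Dissipative z lam)
    (hPQ : ∀ p ∈ Omega z, p.2 ≤ T → inner ℝ (u p) (P p) + inner ℝ (v p) (Q p) = 0)
    (hb : ∀ t, 0 ≤ t → t ≤ T → u (z t, t) = lam t * v (z t, t)) {x t : ℝ} (ht : 0 ≤ t)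
    (hx : z t ≤ x) (htT : t ≤ T) :
    (∫ y in z t..x, density u v (y, t)) + 2 * ∫ s in (0:ℝ)..t, ‖u (x + t - s, s)‖ ^ 2 ≤
      ∫ y in (0:ℝ)..x + t, density u v (y, 0) := by
  have hu := h.continuous_u
  set c := x + t
  have huc : Continuous fun s => ‖u (c - s, s)‖ ^ 2 := by fun_prop
  have hI (s) : HasDerivAt (fun s => ∫ r in (0:ℝ)..s, ‖u (c - r, r)‖ ^ 2) (‖u (c - s, s)‖ ^ 2) s :=
    intervalIntegral.integral_hasDerivAt_right (huc.intervalIntegrable _ _)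
      (huc.stronglyMeasurableAtFilter _ _) huc.continuousAt
  have hmem {s : ℝ} (hs : s ∈ Icc 0 t) : z s ≤ c - s := by
    have := hz.left_mem (x := c) le_rfl (by simpa [c] using hx) hs
    simpa using this
  set g : ℝ → ℝ := fun s => (∫ y in z s..c - s, density u v (y, s)) +
    2 * ∫ r in (0:ℝ)..s, ‖u (c - r, r)‖ ^ 2 with hg
  have hanti : AntitoneOn g (Icc 0 t) := by
    refine antitoneOn_of_deriv_nonpos (convex_Icc 0 t) ?_ ?_ ?_
    · refine ContinuousOn.add (continuousOn_charge h (hz.continuousOn.mono Icc_subset_Ici_self)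
        (by fun_prop)) ?_
      exact fun s _ => ((hI s).const_mul 2).continuousAt.continuousWithinAt
    all_goals
      intro s hs
      rw [interior_Icc] at hs
      obtain ⟨d, hzd, hld⟩ := hd s hs.1
      have hm := hmem (Ioo_subset_Icc_self hs)
      have hsT : s ≤ T := hs.2.le.trans htT
      have h1 := (h.hasDerivAt_charge hzd ((hasDerivAt_id s).const_sub c) hm fun y hy =>
        hPQ (y, s) ⟨hs.1.le, hy.1⟩ hsT).add ((hI s).const_mul 2)
    · exact h1.differentiableAt.differentiableWithinAt
    · have h2 : deriv g s = _ := h1.deriv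
      rw [h2, hb s hs.1.le hsT, norm_mul, mul_pow]
      have : 0 ≤ ‖v (z s, s)‖ ^ 2 := by positivity
      simp only [id]
      nlinarith
  have := hanti ⟨le_rfl, ht⟩ ⟨ht, le_rfl⟩ ht
  simpa [hg, hz.zero, c] using this

/-- Charge balance between the `u`- and `v`-characteristics through (x, t), from time `τ` on. Charge
leaves through the left side at the rate 2|v|², and the charge at time `τ` is bounded by
`Transport.charge_le`. -/
theorem Transport.integral_norm_v_sq_le (h : Transport u v P Q) (hz : TimeLike z)
    (hd : Dissipative z lam)
    (hPQ : ∀ p ∈ Omega z, p.2 ≤ T → inner ℝ (u p) (P p) + inner ℝ (v p) (Q p) = 0)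
    (hb : ∀ t, 0 ≤ t → t ≤ T → u (z t, t) = lam t * v (z t, t)) {x t τ : ℝ} (hτ : 0 ≤ τ)
    (hτt : τ ≤ t) (hx : z τ ≤ x - t + τ) (htT : t ≤ T) :
    2 * ∫ s in τ..t, ‖v (x - t + s, s)‖ ^ 2 ≤ ∫ y in (0:ℝ)..x + t, density u v (y, 0) := by
  have hv := h.continuous_v
  have hu := h.continuous_u
  have hvc : Continuous fun s => ‖v (x - t + s, s)‖ ^ 2 := by fun_prop
  have hI (s) : HasDerivAt (fun s => ∫ r in τ..s, ‖v (x - t + r, r)‖ ^ 2)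
      (‖v (x - t + s, s)‖ ^ 2) s :=
    intervalIntegral.integral_hasDerivAt_right (hvc.intervalIntegrable _ _)
      (hvc.stronglyMeasurableAtFilter _ _) hvc.continuousAt
  have hmem {s : ℝ} (hs : s ∈ Icc τ t) : z s ≤ x - t + s := by
    have := hz.right_mem hτ hx (h := s - τ) (by linarith [hs.1])
    rw [add_sub_cancel] at this
    linarith
  set g : ℝ → ℝ := fun s => (∫ y in x - t + s..x + t - s, density u v (y, s)) +
    2 * ∫ r in τ..s, ‖v (x - t + r, r)‖ ^ 2 with hg
  have hanti : AntitoneOn g (Icc τ t) := by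
    refine antitoneOn_of_deriv_nonpos (convex_Icc τ t) ?_ ?_ ?_
    · refine ContinuousOn.add (continuousOn_charge h (by fun_prop) (by fun_prop)) ?_
      exact fun s _ => ((hI s).const_mul 2).continuousAt.continuousWithinAt
    all_goals
      intro s hs
      rw [interior_Icc] at hs
      have hm := hmem (Ioo_subset_Icc_self hs)
      have h1 := (h.hasDerivAt_charge ((hasDerivAt_id s).const_add (x - t))
        ((hasDerivAt_id s).const_sub (x + t)) (by simp only [id]; linarith [hs.2]) fun y hy =>
          hPQ (y, s) ⟨hτ.trans hs.1.le, hm.trans hy.1⟩ (hs.2.le.trans htT)).add ((hI s).const_mul 2)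
    · exact h1.differentiableAt.differentiableWithinAt
    · have h2 : deriv g s = _ := h1.deriv
      rw [h2]
      simp only [id]
      nlinarith [sq_nonneg ‖u (x + t - s, s)‖]
  have h1 := hanti ⟨le_rfl, hτt⟩ ⟨hτt, le_rfl⟩ hτt
  have e : x - t + t = x + t - t := by ring
  simp only [hg, intervalIntegral.integral_same, mul_zero, add_zero, e, zero_add] at h1
  have hdc := h.continuous_density
  have h2 := h.charge_le hz hd hPQ hb (x := x + t - τ) hτ (by linarith) (hτt.trans htT)
  rw [sub_add_cancel] at h2
  have ii (a b : ℝ) : IntervalIntegrable (fun y => density u v (y, τ)) volume a b :=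
    (by fun_prop : Continuous fun y => density u v (y, τ)).intervalIntegrable _ _
  have h3 := intervalIntegral.integral_add_adjacent_intervals (ii (z τ) (x - t + τ))
    (ii (x - t + τ) (x + t - τ))
  have h4 : 0 ≤ ∫ y in z τ..x - t + τ, density u v (y, τ) :=
    intervalIntegral.integral_nonneg hx fun _ _ => density_nonneg _
  have h5 : 0 ≤ ∫ s in (0:ℝ)..τ, ‖u (x + t - s, s)‖ ^ 2 :=
    intervalIntegral.integral_nonneg hτ fun _ _ => by positivity
  linarith

/-- `R` is fixed before `F` and `G`, so it may serve as truncation radius. Gronwall's inequality for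
|v|² and |u|² along their characteristics has coefficients whose integrals the charge controls; `v`
is bounded first, since a reflected `u` starts from `lam` times `v`. -/
theorem exists_bound_transport (hz : TimeLike z) (hd : Dissipative z lam)
    (hlam : ContinuousOn lam (Ici 0)) {m b B M : ℝ} (hm : 0 ≤ m) (hb0 : 0 ≤ b) (T : ℝ)
    {u₀ v₀ : ℝ → ℂ} (hBu : ∀ x, 0 ≤ x → ‖u₀ x‖ ≤ B) (hBv : ∀ x, 0 ≤ x → ‖v₀ x‖ ≤ B)
    (hM : ∀ c, 0 ≤ c → ∫ y in (0:ℝ)..c, (‖u₀ y‖ ^ 2 + ‖v₀ y‖ ^ 2) ≤ M) :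
    ∃ R : ℝ, ∀ (F G : ℂ × ℂ → ℂ) (u v P Q : ℝ × ℝ → ℂ), Conservative m b F G →
      Transport u v P Q → (∀ p ∈ Omega z, p.2 ≤ T → P p = F (u p, v p) ∧ Q p = G (u p, v p)) →
      (∀ x, 0 ≤ x → u (x, 0) = u₀ x ∧ v (x, 0) = v₀ x) →
      (∀ t, 0 ≤ t → t ≤ T → u (z t, t) = lam t * v (z t, t)) →
      ∀ p ∈ Omega z, p.2 ≤ T → ‖u p‖ ≤ R ∧ ‖v p‖ ≤ R := by
  obtain ⟨Λ₀, hΛ₀⟩ := (isCompact_Icc (a := 0) (b := T)).exists_bound_of_continuousOn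
    (hlam.mono Icc_subset_Ici_self)
  set Λ := max Λ₀ 0
  have hΛ : 0 ≤ Λ := le_max_right _ _
  have hM0 : 0 ≤ M := by simpa using hM 0 le_rfl
  have hB : 0 ≤ B := (norm_nonneg _).trans (hBu 0 le_rfl)
  -- The charge estimates bound twice the integral of the other component by `M`; hence the halves
  -- here and in `Rv`, `Ru`.
  set E := Real.exp (m * T + b * M / 2) with hE
  have hE0 : 0 < E := Real.exp_pos _
  set Rv := (B ^ 2 + m * M / 2) * E with hRv
  have hRv0 : 0 ≤ Rv := by positivity
  set Ru := (B ^ 2 + Λ ^ 2 * Rv + m * M / 2) * E with hRu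
  refine ⟨√(Ru + Rv), ?_⟩
  intro F G u v P Q hFG h hPQ hinit hbdry
  have hu := h.continuous_u
  have hv := h.continuous_v
  have hcancel : ∀ p ∈ Omega z, p.2 ≤ T → inner ℝ (u p) (P p) + inner ℝ (v p) (Q p) = 0 := by
    intro p hp hpT
    rw [(hPQ p hp hpT).1, (hPQ p hp hpT).2]
    exact hFG.cancel (u p, v p)
  have hmass (c) (hc : 0 ≤ c) : ∫ y in (0:ℝ)..c, density u v (y, 0) ≤ M := by
    refine le_trans (le_of_eq ?_) (hM c hc)
    refine intervalIntegral.integral_congr fun y hy => ?_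
    rw [uIcc_of_le hc] at hy
    simp only [density, (hinit y hy.1).1, (hinit y hy.1).2]
  have exp_le {a t : ℝ} (ha : 0 ≤ a) (hat : a ≤ t) (htT : t ≤ T) {w : ℝ → ℝ} (hw : Continuous w)
      (hI : 2 * ∫ s in a..t, w s ≤ M) :
      Real.exp (∫ s in a..t, (m + b * w s)) ≤ E ∧ ∫ s in a..t, m * w s ≤ m * M / 2 := by
    constructor
    · apply Real.exp_le_exp.2
      rw [intervalIntegral.integral_add (by simp) ((hw.const_mul b).intervalIntegrable _ _),
        intervalIntegral.integral_const_mul]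
      simp only [intervalIntegral.integral_const, smul_eq_mul]
      nlinarith
    · rw [intervalIntegral.integral_const_mul]; nlinarith
  have hvb : ∀ x t, 0 ≤ t → z t ≤ x → t ≤ T → ‖v (x, t)‖ ^ 2 ≤ Rv := by
    intro x t ht hx htT
    have hc : 0 ≤ x + t := by have := (_root_.abs_le.1 (hz.abs_le ht)).1; linarith
    have hI : 2 * ∫ s in (0:ℝ)..t, ‖u (x + t - s, s)‖ ^ 2 ≤ M := by
      have h1 := h.charge_le hz hd hcancel hbdry ht hx htT
      have h2 := hmass _ hc
      have h3 : 0 ≤ ∫ y in z t..x, density u v (y, t) :=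
        intervalIntegral.integral_nonneg hx fun _ _ => density_nonneg _
      linarith
    have hw : Continuous fun s => ‖u (x + t - s, s)‖ ^ 2 := by fun_prop
    obtain ⟨h1, h2⟩ := exp_le le_rfl ht htT hw hI
    have key := le_of_deriv_le_mul_add (f := fun s => ‖v (x + t - s, s)‖ ^ 2)
      (k := fun s => m + b * ‖u (x + t - s, s)‖ ^ 2) (j := fun s => m * ‖u (x + t - s, s)‖ ^ 2)
      ht (by fun_prop) (by fun_prop) (fun s => by positivity) (fun s => by positivity)
      (fun s => (h.hasDerivAt_v (x + t) s).norm_sq) (fun s hs => by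
        have hmem : (x + t - s, s) ∈ Omega z := ⟨hs.1, by
          have := hz.left_mem (x := x + t) le_rfl (by simpa using hx) hs
          simpa using this⟩
        have hsT : s ≤ T := hs.2.trans htT
        have g1 := hcancel _ hmem hsT
        have g2 := hFG.growth (u (x + t - s, s), v (x + t - s, s))
        simp only at g2
        rw [← (hPQ _ hmem hsT).1] at g2
        have g3 := (abs_le.1 g2).1
        linarith)
    simp only [add_sub_cancel_right, sub_zero, (hinit _ hc).2] at key
    have g : ‖v₀ (x + t)‖ ^ 2 ≤ B ^ 2 := by gcongr; exact hBv _ hc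
    refine key.trans ?_
    rw [hRv]
    have g0 : 0 ≤ ∫ s in (0:ℝ)..t, m * ‖u (x + t - s, s)‖ ^ 2 :=
      intervalIntegral.integral_nonneg ht fun _ _ => by positivity
    exact mul_le_mul (by linarith) h1 (Real.exp_pos _).le (by positivity)
  have hub : ∀ x t, 0 ≤ t → z t ≤ x → t ≤ T → ‖u (x, t)‖ ^ 2 ≤ Ru := by
    intro x t ht hx htT
    have hc : 0 ≤ x + t := by have := (_root_.abs_le.1 (hz.abs_le ht)).1; linarith
    obtain ⟨τ, ⟨hτ0, hτt⟩, hτz, hτ⟩ := hz.exists_foot ht hx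
    have hI : 2 * ∫ s in τ..t, ‖v (x - t + s, s)‖ ^ 2 ≤ M :=
      (h.integral_norm_v_sq_le hz hd hcancel hbdry hτ0 hτt hτz htT).trans (hmass _ hc)
    have hw : Continuous fun s => ‖v (x - t + s, s)‖ ^ 2 := by fun_prop
    obtain ⟨h1, h2⟩ := exp_le hτ0 hτt htT hw hI
    have key := le_of_deriv_le_mul_add (f := fun s => ‖u (x - t + s, s)‖ ^ 2)
      (k := fun s => m + b * ‖v (x - t + s, s)‖ ^ 2) (j := fun s => m * ‖v (x - t + s, s)‖ ^ 2)
      hτt (by fun_prop) (by fun_prop) (fun s => by positivity) (fun s => by positivity)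
      (fun s => (h.hasDerivAt_u (x - t) s).norm_sq) (fun s hs => by
        have hmem : (x - t + s, s) ∈ Omega z := ⟨hτ0.trans hs.1, by
          have := hz.right_mem hτ0 hτz (h := s - τ) (by linarith [hs.1])
          rw [add_sub_cancel] at this
          simp only
          linarith⟩
        have hsT : s ≤ T := hs.2.trans htT
        have g2 := hFG.growth (u (x - t + s, s), v (x - t + s, s))
        simp only at g2
        rw [← (hPQ _ hmem hsT).1] at g2
        have g3 := (abs_le.1 g2).2
        linarith)
    simp only [sub_add_cancel] at key
    have g : ‖u (x - t + τ, τ)‖ ^ 2 ≤ B ^ 2 + Λ ^ 2 * Rv := by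
      rcases hτ with rfl | hτ
      · rw [hz.zero] at hτz
        rw [(hinit _ hτz).1]
        have : ‖u₀ (x - t + 0)‖ ^ 2 ≤ B ^ 2 := by gcongr; exact hBu _ hτz
        have : 0 ≤ Λ ^ 2 * Rv := by positivity
        linarith
      · rw [← hτ, hbdry τ hτ0 (hτt.trans htT), norm_mul, mul_pow]
        have g1 := hvb (z τ) τ hτ0 le_rfl (hτt.trans htT)
        have g2 : ‖lam τ‖ ≤ Λ := (hΛ₀ τ ⟨hτ0, hτt.trans htT⟩).trans (le_max_left _ _)
        have g3 : ‖lam τ‖ ^ 2 * ‖v (z τ, τ)‖ ^ 2 ≤ Λ ^ 2 * Rv := by gcongr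
        nlinarith [sq_nonneg B]
    refine key.trans ?_
    rw [hRu]
    have g0 : 0 ≤ ∫ s in τ..t, m * ‖v (x - t + s, s)‖ ^ 2 :=
      intervalIntegral.integral_nonneg hτt fun _ _ => by positivity
    exact mul_le_mul (by linarith) h1 (Real.exp_pos _).le (by positivity)
  rintro ⟨x, t⟩ ⟨ht, hx⟩ htT
  have hRu0 : 0 ≤ Ru := by positivity
  constructor <;> apply Real.le_sqrt_of_sq_le
  · have := hub x t ht hx htT; linarith
  · have := hvb x t ht hx htT; linarith

end Flux

/-! ### Radial truncation -/

/-- The scaling factor of the radial retraction onto the ball of radius `R`. -/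
noncomputable def radialFactor (R : ℝ) (p : ℂ × ℂ) : ℝ := R / max R ‖p‖

section Truncation

variable {R : ℝ} (hR : 0 < R)
include hR

theorem radialFactor_nonneg (p : ℂ × ℂ) : 0 ≤ radialFactor R p :=
  div_nonneg hR.le (hR.le.trans (le_max_left _ _))

theorem radialFactor_le_one (p : ℂ × ℂ) : radialFactor R p ≤ 1 :=
  (div_le_one (hR.trans_le (le_max_left _ _))).2 (le_max_left _ _)

theorem radialFactor_eq_one {p : ℂ × ℂ} (hp : ‖p‖ ≤ R) : radialFactor R p = 1 := by
  rw [radialFactor, max_eq_left hp, div_self hR.ne']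

theorem norm_radialFactor_smul_le (p : ℂ × ℂ) : ‖radialFactor R p • p‖ ≤ R := by
  rw [norm_smul, Real.norm_of_nonneg (radialFactor_nonneg hR p), radialFactor, div_mul_eq_mul_div,
    div_le_iff₀ (hR.trans_le (le_max_left _ _))]
  gcongr
  exact le_max_right _ _

/-- The points and the scaling factors each contribute ‖p - q‖: the factors differ through max(R,
‖·‖), which is 1-Lipschitz, and ‖q‖ is absorbed by the denominator. -/
theorem norm_radialFactor_smul_sub_le (p q : ℂ × ℂ) :
    ‖radialFactor R p • p - radialFactor R q • q‖ ≤ 2 * ‖p - q‖ := by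
  have e : radialFactor R p • p - radialFactor R q • q =
      radialFactor R p • (p - q) + (radialFactor R p - radialFactor R q) • q := by
    rw [smul_sub, sub_smul]; abel
  have hp : 0 < max R ‖p‖ := hR.trans_le (le_max_left _ _)
  have hq : 0 < max R ‖q‖ := hR.trans_le (le_max_left _ _)
  have h1 : ‖radialFactor R p • (p - q)‖ ≤ ‖p - q‖ := by
    rw [norm_smul, Real.norm_of_nonneg (radialFactor_nonneg hR p)]
    exact mul_le_of_le_one_left (norm_nonneg _) (radialFactor_le_one hR p)
  have h2 : ‖(radialFactor R p - radialFactor R q) • q‖ ≤ ‖p - q‖ := by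
    have e2 : radialFactor R p - radialFactor R q =
        radialFactor R p * ((max R ‖q‖ - max R ‖p‖) / max R ‖q‖) := by
      unfold radialFactor; field_simp
    have h3 : |max R ‖q‖ - max R ‖p‖| ≤ ‖p - q‖ := by
      refine (abs_max_sub_max_le_max R ‖q‖ R ‖p‖).trans ?_
      simp only [sub_self, abs_zero]
      refine max_le (norm_nonneg _) ?_
      rw [abs_sub_comm]
      exact abs_norm_sub_norm_le p q
    rw [e2, norm_smul, norm_mul, Real.norm_of_nonneg (radialFactor_nonneg hR p), norm_div,
      Real.norm_eq_abs, Real.norm_of_nonneg hq.le]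
    have h4 : |max R ‖q‖ - max R ‖p‖| / max R ‖q‖ * ‖q‖ ≤ ‖p - q‖ := by
      rw [div_mul_eq_mul_div, div_le_iff₀ hq]
      exact mul_le_mul h3 (le_max_right _ _) (norm_nonneg _) (norm_nonneg _)
    rw [mul_assoc]
    exact (mul_le_of_le_one_left (by positivity) (radialFactor_le_one hR p)).trans h4
  rw [e]
  refine (norm_add_le _ _).trans ?_
  linarith

theorem LipOnBalls.exists_lipschitz_comp_radial {F : ℂ × ℂ → ℂ} (hF : LipOnBalls F) :
    ∃ L, 0 ≤ L ∧ ∀ p q, ‖F (radialFactor R p • p) - F (radialFactor R q • q)‖ ≤ L * ‖p - q‖ := by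
  obtain ⟨L, hL0, hL⟩ := hF R
  refine ⟨L * 2, by positivity, fun p q => ?_⟩
  refine (hL _ _ (norm_radialFactor_smul_le hR p) (norm_radialFactor_smul_le hR q)).trans ?_
  rw [mul_assoc]
  gcongr
  exact norm_radialFactor_smul_sub_le hR p q

end Truncation

theorem lipOnBalls_rhsU (m α β : ℝ) : LipOnBalls (rhsU m α β) :=
  lipOnBalls_of_contDiff (contDiff_rhsU m α β)

theorem lipOnBalls_rhsV (m α β : ℝ) : LipOnBalls (rhsV m α β) :=
  lipOnBalls_of_contDiff (contDiff_rhsV m α β)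

theorem rhsU_zero (m α β : ℝ) : rhsU m α β 0 = 0 := by simp [rhsU, N₁]

theorem rhsV_zero (m α β : ℝ) : rhsV m α β 0 = 0 := by simp [rhsV, N₂]

/-! ### Global characteristic solutions -/

section Global

variable {m α β : ℝ} {z : ℝ → ℝ} {lam u₀ v₀ : ℝ → ℂ} {B M : ℝ}

/-- The truncation radius is at least the a priori bound, so the retraction acts as the identity on
the values of the solution. -/
theorem exists_isCharSol (hm : 0 ≤ m) (hz : TimeLike z) (hd : Dissipative z lam)
    (hlam : ContinuousOn lam (Ici 0)) (hu₀ : ContinuousOn u₀ (Ici 0))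
    (hv₀ : ContinuousOn v₀ (Ici 0)) (hBu : ∀ x, 0 ≤ x → ‖u₀ x‖ ≤ B)
    (hBv : ∀ x, 0 ≤ x → ‖v₀ x‖ ≤ B)
    (hM : ∀ c, 0 ≤ c → ∫ y in (0:ℝ)..c, (‖u₀ y‖ ^ 2 + ‖v₀ y‖ ^ 2) ≤ M)
    (hcomp : u₀ 0 = lam 0 * v₀ 0) {T : ℝ} (hT : 0 ≤ T) :
    ∃ u v, IsCharSol (rhsU m α β) (rhsV m α β) z lam u₀ v₀ T u v ∧
      ∃ R, ∀ p ∈ Omega z, p.2 ≤ T → ‖u p‖ ≤ R ∧ ‖v p‖ ≤ R := by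
  obtain ⟨R₀, hR₀⟩ := exists_bound_transport hz hd hlam hm (b := 4 * |β|) (by positivity) T
    hBu hBv hM
  set R := max R₀ 1
  have hR : 0 < R := one_pos.trans_le (le_max_right _ _)
  obtain ⟨L₁, hL₁, hF⟩ := (lipOnBalls_rhsU m α β).exists_lipschitz_comp_radial hR
  obtain ⟨L₂, hL₂, hG⟩ := (lipOnBalls_rhsV m α β).exists_lipschitz_comp_radial hR
  obtain ⟨u, v, P, Q, htr, hPQ, hinit, hbdry⟩ := exists_transport (L := max L₁ L₂)
    (F := fun p => rhsU m α β (radialFactor R p • p))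
    (G := fun p => rhsV m α β (radialFactor R p • p)) (le_max_of_le_left hL₁)
    (fun p q => (hF p q).trans (by gcongr; exact le_max_left _ _))
    (fun p q => (hG p q).trans (by gcongr; exact le_max_right _ _))
    (by simp [rhsU_zero]) (by simp [rhsV_zero]) hz hlam hu₀ hv₀ hBu hBv hcomp hT
  have hbound := hR₀ _ _ u v P Q
    (conservative_rhs_comp hm α β (radialFactor_nonneg hR) (radialFactor_le_one hR))
    htr hPQ hinit hbdry
  have hPQ' : ∀ p ∈ Omega z, p.2 ≤ T →
      P p = rhsU m α β (u p, v p) ∧ Q p = rhsV m α β (u p, v p) := by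
    intro p hp hpT
    have h1 := hPQ p hp hpT
    have h2 := hbound p hp hpT
    rwa [radialFactor_eq_one hR (max_le (h2.1.trans (le_max_left _ _))
      (h2.2.trans (le_max_left _ _))), one_smul] at h1
  refine ⟨u, v, ⟨htr.continuous_u, htr.continuous_v, fun x t h ht hx hh hhT => ?_,
    fun x t h ht hh hx hhT => ?_, hinit, hbdry⟩, R₀, hbound⟩
  · rw [htr.eq_u]
    refine intervalIntegral.integral_congr fun s hs => ?_
    rw [uIcc_of_le hh] at hs
    exact (hPQ' _ ⟨by simp only; linarith [hs.1], hz.right_mem ht hx hs.1⟩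
      (by simp only; linarith [hs.2])).1
  · rw [htr.eq_v]
    refine intervalIntegral.integral_congr fun s hs => ?_
    rw [uIcc_of_le hh] at hs
    exact (hPQ' _ ⟨by simp only; linarith [hs.1], hz.left_mem ht hx hs⟩
      (by simp only; linarith [hs.2])).2

/-- Strip solutions of integer heights agree where they overlap, by uniqueness. Composition with
`proj` makes the glued functions continuous on the whole plane. -/
theorem exists_global_isCharSol (hm : 0 ≤ m) (hz : TimeLike z) (hd : Dissipative z lam)
    (hlam : ContinuousOn lam (Ici 0)) (hu₀ : ContinuousOn u₀ (Ici 0))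
    (hv₀ : ContinuousOn v₀ (Ici 0)) (hBu : ∀ x, 0 ≤ x → ‖u₀ x‖ ≤ B)
    (hBv : ∀ x, 0 ≤ x → ‖v₀ x‖ ≤ B)
    (hM : ∀ c, 0 ≤ c → ∫ y in (0:ℝ)..c, (‖u₀ y‖ ^ 2 + ‖v₀ y‖ ^ 2) ≤ M)
    (hcomp : u₀ 0 = lam 0 * v₀ 0) :
    ∃ u v : ℝ × ℝ → ℂ, (∀ p, u (proj z p) = u p ∧ v (proj z p) = v p) ∧
      (∀ T, IsCharSol (rhsU m α β) (rhsV m α β) z lam u₀ v₀ T u v) ∧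
      ∀ T, ∃ R, ∀ p ∈ Omega z, p.2 ≤ T → ‖u p‖ ≤ R ∧ ‖v p‖ ≤ R := by
  choose U V hUV R hR using fun n : ℕ => exists_isCharSol (α := α) (β := β) hm hz hd hlam hu₀ hv₀
    hBu hBv hM hcomp (Nat.cast_nonneg n)
  set k : ℝ × ℝ → ℕ := fun p => ⌈p.2⌉₊ with hk
  set u : ℝ × ℝ → ℂ := fun p => U (k p) (proj z p) with hu
  set v : ℝ × ℝ → ℂ := fun p => V (k p) (proj z p) with hv
  have agree {n l : ℕ} {p : ℝ × ℝ} (hp : p ∈ Omega z) (hn : p.2 ≤ n) (hl : p.2 ≤ l) :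
      U n p = U l p ∧ V n p = V l p :=
    IsCharSol.eqOn (T := min n l) hz (lipOnBalls_rhsU m α β) (lipOnBalls_rhsV m α β) hlam
      ((hUV l).mono (min_le_right _ _)) ((hUV n).mono (min_le_left _ _)) hp (le_min hn hl)
  have hkp (p : ℝ × ℝ) : (proj z p).2 ≤ k p := max_le (Nat.le_ceil _) (Nat.cast_nonneg _)
  have huv {n : ℕ} {p : ℝ × ℝ} (hn : p.2 ≤ n) :
      u p = U n (proj z p) ∧ v p = V n (proj z p) :=
    agree (proj_mem z p) (hkp p) (max_le hn (Nat.cast_nonneg _))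
  have huv' {n : ℕ} {p : ℝ × ℝ} (hp : p ∈ Omega z) (hn : p.2 ≤ n) : u p = U n p ∧ v p = V n p := by
    have := huv hn
    rwa [proj_eq hp] at this
  have near (p : ℝ × ℝ) : ∃ n : ℕ, ∀ᶠ q : ℝ × ℝ in nhds p, q.2 ≤ (n : ℝ) := by
    obtain ⟨n, hn⟩ := exists_nat_gt p.2
    exact ⟨n, ((isOpen_lt continuous_snd continuous_const).eventually_mem hn).mono
      fun q hq => (show q.2 < n from hq).le⟩
  refine ⟨u, v, fun p => ?_, fun T => ?_, fun T => ?_⟩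
  · have h1 := huv (n := k p) (Nat.le_ceil p.2)
    have h2 := huv' (n := k p) (proj_mem z p) (hkp p)
    exact ⟨h2.1.trans h1.1.symm, h2.2.trans h1.2.symm⟩
  · obtain ⟨n, hn⟩ := exists_nat_ge T
    refine ⟨?_, ?_, fun x t h ht hx hh hhT => ?_, fun x t h ht hh hx hhT => ?_, fun x hx => ?_,
      fun t ht htT => ?_⟩
    · refine continuous_iff_continuousAt.2 fun p => ?_
      obtain ⟨l, hl⟩ := near p
      exact (((hUV l).continuous_u.comp hz.continuous_proj).continuousAt).congr
        (hl.mono fun q hq => (huv hq).1.symm)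
    · refine continuous_iff_continuousAt.2 fun p => ?_
      obtain ⟨l, hl⟩ := near p
      exact (((hUV l).continuous_v.comp hz.continuous_proj).continuousAt).congr
        (hl.mono fun q hq => (huv hq).2.symm)
    · have hmem {s} (hs : s ∈ Icc 0 h) : (x + s, t + s) ∈ Omega z ∧ (t + s : ℝ) ≤ n :=
        ⟨⟨by simp only; linarith [hs.1], hz.right_mem ht hx hs.1⟩, by linarith [hs.2]⟩
      have h0 : (x, t) ∈ Omega z := ⟨ht, hx⟩
      have hh' := hmem ⟨hh, le_rfl⟩
      rw [(huv' hh'.1 hh'.2).1, (huv' h0 (n := n) (by simp only; linarith)).1,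
        (hUV n).eq_u x t h ht hx hh (hhT.trans hn)]
      refine intervalIntegral.integral_congr fun s hs => ?_
      rw [uIcc_of_le hh] at hs
      have := huv' (hmem hs).1 (hmem hs).2
      simp only [this.1, this.2]
    · have hmem {s} (hs : s ∈ Icc 0 h) : (x - s, t + s) ∈ Omega z ∧ (t + s : ℝ) ≤ n :=
        ⟨⟨by simp only; linarith [hs.1], hz.left_mem ht hx hs⟩, by linarith [hs.2]⟩
      have h0 := hmem ⟨le_rfl, hh⟩
      rw [sub_zero, add_zero] at h0
      have hh' := hmem ⟨hh, le_rfl⟩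
      rw [(huv' hh'.1 hh'.2).2, (huv' h0.1 h0.2).2, (hUV n).eq_v x t h ht hh hx (hhT.trans hn)]
      refine intervalIntegral.integral_congr fun s hs => ?_
      rw [uIcc_of_le hh] at hs
      have := huv' (hmem hs).1 (hmem hs).2
      simp only [this.1, this.2]
    · have h0 : (x, (0:ℝ)) ∈ Omega z := ⟨le_rfl, by simpa [hz.zero] using hx⟩
      have := huv' h0 (n := n + 1) (by simp only; positivity)
      rw [this.1, this.2]
      exact (hUV _).initial x hx
    · have h0 : (z t, t) ∈ Omega z := ⟨ht, le_rfl⟩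
      have := huv' h0 (htT.trans hn)
      rw [this.1, this.2]
      exact (hUV n).boundary t ht (htT.trans hn)
  · obtain ⟨n, hn⟩ := exists_nat_ge T
    refine ⟨R n, fun p hp hpT => ?_⟩
    have := huv' hp (hpT.trans hn)
    rw [this.1, this.2]
    exact hR n p hp (hpT.trans hn)

end Global

/-! ### Energy densities of the initial data -/

section Density

/-- `ρ` dominates `|f|²` and `|f'|²` on the half line `(0, ∞)`. -/
structure EnergyDensity (ρ : ℝ → ℝ) (f : ℝ → ℂ) : Prop where
  sq_sub_le : ∀ x y, 0 ≤ x → x ≤ y → ‖f y - f x‖ ^ 2 ≤ (y - x) * ∫ s in x..y, ρ s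
  sq_le : ∀ x, 0 ≤ x → ‖f x‖ ^ 2 ≤ 2 * ∫ s in x..x + 1, ρ s
  sq_le_self : ∀ x, 0 < x → ‖f x‖ ^ 2 ≤ ρ x

theorem EnergyDensity.mono {ρ ρ' : ℝ → ℝ} {f : ℝ → ℂ} (h : EnergyDensity ρ f)
    (hρ : Integrable ρ) (hρ' : Integrable ρ') (hle : ∀ x, ρ x ≤ ρ' x) : EnergyDensity ρ' f where
  sq_sub_le x y hx hxy := (h.sq_sub_le x y hx hxy).trans
    (mul_le_mul_of_nonneg_left (intervalIntegral.integral_mono hxy hρ.intervalIntegrable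
      hρ'.intervalIntegrable hle) (sub_nonneg.2 hxy))
  sq_le x hx := (h.sq_le x hx).trans
    (mul_le_mul_of_nonneg_left (intervalIntegral.integral_mono (by linarith) hρ.intervalIntegrable
      hρ'.intervalIntegrable hle) two_pos.le)
  sq_le_self x hx := (h.sq_le_self x hx).trans (hle x)

theorem MemH1HalfLine.exists_energyDensity {f : ℝ → ℂ} (hf : MemH1HalfLine 0 f)
    (hc : ContinuousOn f (Ici 0)) :
    ∃ ρ : ℝ → ℝ, Integrable ρ ∧ (∀ x, 0 ≤ ρ x) ∧ EnergyDensity ρ f := by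
  obtain ⟨g, hg, hfg⟩ := hf.exists_primitive hc
  have hfL : MemLp ((Ioi 0).indicator f) 2 := by
    obtain ⟨_, _, h, _⟩ := hf
    exact (memLp_indicator_iff_restrict measurableSet_Ioi).2 h
  have i1 := integrable_sq_norm_of_memLp hfL
  have i2 := integrable_sq_norm_of_memLp hg
  have hsub (x y : ℝ) (hx : 0 ≤ x) (hxy : x ≤ y) :
      ‖f y - f x‖ ^ 2 ≤ (y - x) * ∫ s in x..y, ‖g s‖ ^ 2 := by
    rw [hfg x y hx hxy]; exact norm_intervalIntegral_sq_le hg hxy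
  refine ⟨fun x => ‖(Ioi 0).indicator f x‖ ^ 2 + ‖g x‖ ^ 2, i1.add i2, fun x => by positivity,
    ⟨fun x y hx hxy => (hsub x y hx hxy).trans ?_, fun x hx => ?_, fun x hx => ?_⟩⟩
  · refine mul_le_mul_of_nonneg_left (intervalIntegral.integral_mono hxy i2.intervalIntegrable
      (i1.add i2).intervalIntegrable fun s => ?_) (sub_nonneg.2 hxy)
    nlinarith [sq_nonneg ‖(Ioi 0).indicator f s‖]
  -- Local Sobolev bound: |f(x)|² ≤ 2|f(y)|² + 2|f(y) - f(x)|², averaged over y in [x, x + 1].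
  · set A := ∫ s in x..x + 1, ‖g s‖ ^ 2 with hA
    have key : ∀ y ∈ Icc x (x + 1), ‖f x‖ ^ 2 / 2 - A ≤ ‖f y‖ ^ 2 := by
      intro y hy
      have h1 := hsub x y hx hy.1
      have h2 : ∫ s in x..y, ‖g s‖ ^ 2 ≤ A :=
        intervalIntegral.integral_mono_interval le_rfl hy.1 hy.2
          (.of_forall fun s => by positivity) i2.intervalIntegrable
      have h3 : 0 ≤ ∫ s in x..y, ‖g s‖ ^ 2 :=
        intervalIntegral.integral_nonneg hy.1 fun s _ => by positivity
      have h4 : ‖f y - f x‖ ^ 2 ≤ A := h1.trans (by nlinarith [hy.1, hy.2])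
      have h5 : ‖f x‖ ≤ ‖f y‖ + ‖f y - f x‖ := norm_le_norm_add_norm_sub _ _
      nlinarith [norm_nonneg (f x), sq_nonneg (‖f y‖ - ‖f y - f x‖)]
    have h1 : ∫ _ in x..x + 1, (‖f x‖ ^ 2 / 2 - A) ≤
        ∫ y in x..x + 1, ‖(Ioi 0).indicator f y‖ ^ 2 := by
      refine intervalIntegral.integral_mono_on_of_le_Ioo (by linarith) intervalIntegrable_const
        i1.intervalIntegrable fun y hy => ?_
      rw [indicator_of_mem (mem_Ioi.2 (hx.trans_lt hy.1))]
      exact key y (Ioo_subset_Icc_self hy)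
    rw [intervalIntegral.integral_const] at h1
    rw [intervalIntegral.integral_add i1.intervalIntegrable i2.intervalIntegrable]
    simp only [add_sub_cancel_left, one_smul] at h1
    linarith
  · simp only [indicator_of_mem (mem_Ioi.2 hx)]
    nlinarith [sq_nonneg ‖g x‖]

end Density

/-! ### Auxiliary integral inequalities -/

section Tools

theorem norm_integral_sq_le_of_sq_le {g : ℝ → ℂ} (hg : Continuous g) {a : ℝ → ℝ} {δ : ℝ}
    (hδ : 0 ≤ δ) (ha : IntervalIntegrable a volume 0 δ) (h : ∀ s ∈ Icc 0 δ, ‖g s‖ ^ 2 ≤ a s) :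
    ‖∫ s in (0:ℝ)..δ, g s‖ ^ 2 ≤ δ * ∫ s in (0:ℝ)..δ, a s := by
  have h1 : ‖∫ s in (0:ℝ)..δ, g s‖ ^ 2 ≤ (∫ s in (0:ℝ)..δ, ‖g s‖) ^ 2 := by
    gcongr; exact intervalIntegral.norm_integral_le_integral_norm hδ
  have h2 := sq_intervalIntegral_le (h := fun s => ‖g s‖) hδ (hg.norm.intervalIntegrable _ _)
    ((hg.norm.pow 2).intervalIntegrable _ _)
  rw [sub_zero] at h2
  refine h1.trans (h2.trans (mul_le_mul_of_nonneg_left ?_ hδ))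
  exact intervalIntegral.integral_mono_on hδ ((hg.norm.pow 2).intervalIntegrable _ _) ha h

theorem le_exp_of_le_integral {φ : ℝ → ℝ} (hφ : Continuous φ) {a b L M : ℝ} (hab : a ≤ b)
    (hL : 0 ≤ L) (h : ∀ s ∈ Icc a b, φ s ≤ M + L * ∫ r in a..s, φ r) :
    φ b ≤ M * Real.exp (L * (b - a)) := by
  have hI (s) : HasDerivAt (fun s => ∫ r in a..s, φ r) (φ s) s :=
    intervalIntegral.integral_hasDerivAt_right (hφ.intervalIntegrable _ _)
      (hφ.stronglyMeasurableAtFilter _ _) hφ.continuousAt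
  have h1 := le_of_deriv_le_mul_add (f := fun s => M + L * ∫ r in a..s, φ r)
    (f' := fun s => L * φ s) (k := fun _ => L) (j := fun _ => 0) hab continuous_const
    continuous_const (fun _ => hL) (fun _ => le_rfl) (fun s => ((hI s).const_mul L).const_add M)
    fun s hs => by rw [add_zero]; exact mul_le_mul_of_nonneg_left (h s hs) hL
  refine (h b ⟨hab, le_rfl⟩).trans (h1.trans ?_)
  simp [mul_comm]

/-- The window integral is the convolution of `ρ` with the indicator of [-w, w); this half-open
interval turns, under s ↦ x - s, into the interval (x - w, x + w] of the interval integral. -/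
theorem integrable_window {ρ : ℝ → ℝ} (hρ : Integrable ρ) {w : ℝ} (hw : 0 ≤ w) :
    Integrable fun x => ∫ s in (x - w)..(x + w), ρ s := by
  have hind : Integrable ((Ico (-w) w).indicator fun _ => (1:ℝ)) :=
    (integrableOn_const (by simp)).integrable_indicator measurableSet_Ico
  have := hρ.integrable_convolution (ContinuousLinearMap.mul ℝ ℝ) hind
  refine this.congr (.of_forall fun x => ?_)
  simp only [convolution_def, ContinuousLinearMap.mul_apply']
  rw [intervalIntegral.integral_of_le (by linarith), ← integral_indicator measurableSet_Ioc]
  congr 1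
  ext t
  by_cases ht : t ∈ Ioc (x - w) (x + w)
  · rw [indicator_of_mem ht, indicator_of_mem (by constructor <;> linarith [ht.1, ht.2]), mul_one]
  · rw [indicator_of_notMem ht, indicator_of_notMem, mul_zero]
    exact fun h => ht (by constructor <;> linarith [h.1, h.2])

end Tools

/-! ### Integrable envelopes of the solution -/

/-- A solution in the strip `t ≤ T` taking values in a ball on which the right-hand sides are
Lipschitz. -/
structure IsStripSol (F G : ℂ × ℂ → ℂ) (z : ℝ → ℝ) (lam u₀ v₀ : ℝ → ℂ) (T L R : ℝ)
    (u v : ℝ × ℝ → ℂ) : Prop extends IsCharSol F G z lam u₀ v₀ T u v where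
  timeLike : TimeLike z
  continuous_F : Continuous F
  continuous_G : Continuous G
  F_zero : F 0 = 0
  G_zero : G 0 = 0
  L_nonneg : 0 ≤ L
  R_nonneg : 0 ≤ R
  bound : ∀ p ∈ Omega z, p.2 ≤ T → ‖(u p, v p)‖ ≤ R
  lip_F : ∀ p q, ‖p‖ ≤ R → ‖q‖ ≤ R → ‖F p - F q‖ ≤ L * ‖p - q‖
  lip_G : ∀ p q, ‖p‖ ≤ R → ‖q‖ ≤ R → ‖G p - G q‖ ≤ L * ‖p - q‖

namespace IsStripSol

variable {F G : ℂ × ℂ → ℂ} {z : ℝ → ℝ} {lam u₀ v₀ : ℝ → ℂ} {T L R : ℝ} {u v : ℝ × ℝ → ℂ}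
  (h : IsStripSol F G z lam u₀ v₀ T L R u v)
include h

theorem norm_F_le {p : ℝ × ℝ} (hp : p ∈ Omega z) (hpT : p.2 ≤ T) :
    ‖F (u p, v p)‖ ≤ L * ‖(u p, v p)‖ := by
  have := h.lip_F (u p, v p) 0 (h.bound p hp hpT) (by simpa using h.R_nonneg)
  simpa [h.F_zero] using this

theorem norm_G_le {p : ℝ × ℝ} (hp : p ∈ Omega z) (hpT : p.2 ≤ T) :
    ‖G (u p, v p)‖ ≤ L * ‖(u p, v p)‖ := by
  have := h.lip_G (u p, v p) 0 (h.bound p hp hpT) (by simpa using h.R_nonneg)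
  simpa [h.G_zero] using this

theorem continuous_comp_F {c : ℝ → ℝ × ℝ} (hc : Continuous c) :
    Continuous fun s => F (u (c s), v (c s)) :=
  h.continuous_F.comp ((h.continuous_u.comp hc).prodMk (h.continuous_v.comp hc))

theorem continuous_comp_G {c : ℝ → ℝ × ℝ} (hc : Continuous c) :
    Continuous fun s => G (u (c s), v (c s)) :=
  h.continuous_G.comp ((h.continuous_u.comp hc).prodMk (h.continuous_v.comp hc))

/-- For x ≥ t the backward triangle misses the interior side of the boundary problem: both
components trace back to the initial line. The weighted Gronwall inequality gives |(u, v)| ≤ 2A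
exp(KT) with A² twice the energy of the data near the base. -/
theorem norm_sq_le_of_le {ρ : ℝ → ℝ} (hρ : Integrable ρ) (hρ0 : ∀ x, 0 ≤ ρ x)
    (hu₀ : EnergyDensity ρ u₀) (hv₀ : EnergyDensity ρ v₀) {x t : ℝ} (ht : 0 ≤ t) (htT : t ≤ T)
    (hx : t ≤ x) :
    ‖(u (x, t), v (x, t))‖ ^ 2 ≤
      8 * Real.exp ((2 * L + 1) * T) ^ 2 * ∫ s in (x - t)..(x + t + 1), ρ s := by
  set Δ : Set (ℝ × ℝ) := {p | (0 ≤ p.2 ∧ x - t ≤ p.1 - p.2) ∧ p.1 + p.2 ≤ x + t} with hΔdef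
  have hΔ : IsCompact Δ := by
    have hcl : IsClosed Δ :=
      ((isClosed_le continuous_const continuous_snd).inter (isClosed_le continuous_const
        (continuous_fst.sub continuous_snd))).inter
        (isClosed_le (continuous_fst.add continuous_snd) continuous_const)
    refine (isCompact_Icc (a := ((x - t, 0) : ℝ × ℝ)) (b := (x + t, t))).of_isClosed_subset hcl ?_
    rintro ⟨y, s⟩ ⟨⟨h1, h2⟩, h3⟩
    simp only at h1 h2 h3
    exact ⟨⟨by simp only; linarith, h1⟩, ⟨by simp only; linarith, by simp only; linarith⟩⟩
  have hmem : ∀ p ∈ Δ, p ∈ Omega z ∧ p.2 ≤ T := by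
    rintro ⟨y, s⟩ ⟨⟨h1, h2⟩, h3⟩
    simp only at h1 h2 h3
    have := (_root_.abs_le.1 (h.timeLike.abs_le h1)).2
    exact ⟨⟨h1, by simp only; linarith⟩, by simp only; linarith⟩
  set I := ∫ s in (x - t)..(x + t + 1), ρ s with hI
  have hI0 : 0 ≤ I := intervalIntegral.integral_nonneg (by linarith) fun s _ => hρ0 s
  set A := √(2 * I) with hA
  have hA2 : A ^ 2 = 2 * I := Real.sq_sqrt (by positivity)
  have data {f : ℝ → ℂ} (hf : EnergyDensity ρ f) {y : ℝ} (h1 : x - t ≤ y) (h2 : y ≤ x + t) :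
      ‖f y‖ ≤ A := by
    refine Real.le_sqrt_of_sq_le ((hf.sq_le y (by linarith)).trans ?_)
    gcongr
    exact intervalIntegral.integral_mono_interval h1 (by linarith) (by linarith)
      (.of_forall hρ0) hρ.intervalIntegrable
  have hL := h.L_nonneg
  set K := 2 * L + 1
  have hK : 0 < K := by positivity
  have hc : Continuous fun p => ‖(u p, v p)‖ := (h.continuous_u.prodMk h.continuous_v).norm
  have main := le_exp_of_contraction hΔ (r := fun p => ‖(u p, v p)‖) hc.continuousOn
    (fun _ _ => norm_nonneg _) (fun p hp => hp.1.1) (A := A) (K := K) (Real.sqrt_nonneg _)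
    hK.le ?_
  · have h1 := main (x, t) ⟨⟨ht, le_rfl⟩, le_rfl⟩
    simp only at h1
    calc ‖(u (x, t), v (x, t))‖ ^ 2 ≤ (2 * A * Real.exp (K * T)) ^ 2 := by
          gcongr; exact h1.trans (by gcongr)
      _ = _ := by rw [mul_pow, mul_pow, hA2]; ring
  intro N hN hr
  have hLN : L * N / K ≤ N / 2 := by
    rw [div_le_div_iff₀ hK two_pos]; simp only [K]; nlinarith
  rintro ⟨y, s⟩ hp
  have hps := hp
  obtain ⟨⟨h1, h2⟩, h3⟩ := hps
  simp only at h1 h2 h3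
  have hsT := (hmem _ hp).2
  have hyz := (hmem _ hp).1.2
  simp only at hsT hyz
  have est {g : ℝ → ℂ} (hg : ∀ r ∈ Icc 0 s, ‖g r‖ ≤ L * (N * Real.exp (K * r))) :
      ‖∫ r in (0:ℝ)..s, g r‖ ≤ N / 2 * Real.exp (K * s) := by
    refine (norm_integral_le_exp (M := L * N) h1 hK (by positivity) fun r hr => ?_).trans
      (by gcongr)
    rw [mul_assoc]; exact hg r hr
  refine max_le ?_ ?_
  · have e1 := h.eq_u (y - s) 0 s le_rfl (by rw [h.timeLike.zero]; linarith) h1 (by linarith)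
    rw [(h.initial _ (by linarith)).1, sub_add_cancel, zero_add, sub_eq_iff_eq_add'] at e1
    simp only [e1]
    refine (norm_add_le _ _).trans (add_le_add (data hu₀ h2 (by linarith)) (est fun r hr' => ?_))
    have hq : (y - s + r, 0 + r) ∈ Δ :=
      ⟨⟨by simp only; linarith [hr'.1], by simp only; linarith⟩, by simp only; linarith [hr'.2]⟩
    refine (h.norm_F_le (hmem _ hq).1 (hmem _ hq).2).trans ?_
    gcongr
    simpa using hr _ hq
  · simp only
    rw [h.v_eq h.timeLike h1 hyz hsT]
    refine (norm_add_le _ _).trans (add_le_add (data hv₀ (by linarith) h3) (est fun r hr' => ?_))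
    have hq : (y + s - r, r) ∈ Δ :=
      ⟨⟨hr'.1, by simp only; linarith [hr'.2]⟩, by simp only; linarith⟩
    refine (h.norm_G_le (hmem _ hq).1 (hmem _ hq).2).trans ?_
    gcongr
    exact hr _ hq

/-- An integrable bound for the squared size of the solution, uniform over an interval of length
`T` to the right. -/
theorem exists_envelope {ρ : ℝ → ℝ} (hρ : Integrable ρ) (hρ0 : ∀ x, 0 ≤ ρ x)
    (hu₀ : EnergyDensity ρ u₀) (hv₀ : EnergyDensity ρ v₀) (hT : 0 ≤ T) :
    ∃ A : ℝ → ℝ, Integrable A ∧ (∀ x, 0 ≤ A x) ∧ (∃ M, ∀ x, A x ≤ M) ∧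
      ∀ x y t, 0 ≤ t → t ≤ T → z t ≤ y → x ≤ y → y ≤ x + T →
        ‖(u (y, t), v (y, t))‖ ^ 2 ≤ A x := by
  set C := 8 * Real.exp ((2 * L + 1) * T) ^ 2
  have hC : 0 ≤ C := by positivity
  -- For x ≤ y ≤ x + T and t ≤ T, the window of half-width `w` about `x` contains the interval [y -
  -- t, y + t + 1] on which the data matter.
  set w := 2 * T + 1 with hw
  have hI0 {a b : ℝ} (hab : a ≤ b) : 0 ≤ ∫ s in a..b, ρ s :=
    intervalIntegral.integral_nonneg hab fun s _ => hρ0 s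
  have hind0 (x) : 0 ≤ (Icc (-(2 * T)) T).indicator (fun _ => R ^ 2) x :=
    indicator_nonneg (fun _ _ => sq_nonneg R) x
  refine ⟨fun x => (Icc (-(2 * T)) T).indicator (fun _ => R ^ 2) x +
    C * ∫ s in (x - w)..(x + w), ρ s,
    ((integrableOn_const (by simp)).integrable_indicator measurableSet_Icc).add
      ((integrable_window hρ (by positivity)).const_mul C),
    fun x => add_nonneg (hind0 x) (mul_nonneg hC (hI0 (by linarith))),
    ⟨R ^ 2 + C * ∫ s, ρ s, fun x => ?_⟩, fun x y t ht htT hy hxy hyT => ?_⟩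
  · have h1 : (Icc (-(2 * T)) T).indicator (fun _ => R ^ 2) x ≤ R ^ 2 :=
      indicator_le_self' (fun _ _ => sq_nonneg R) x
    have h2 := intervalIntegral_le_integral hρ hρ0 (x := x - w) (y := x + w) (by linarith)
    have := mul_le_mul_of_nonneg_left h2 hC
    exact add_le_add h1 this
  · rcases le_or_gt t y with hty | hty
    · refine (h.norm_sq_le_of_le hρ hρ0 hu₀ hv₀ ht htT hty).trans ?_
      refine le_add_of_nonneg_of_le (hind0 x) (mul_le_mul_of_nonneg_left ?_ hC)
      exact intervalIntegral.integral_mono_interval (by linarith) (by linarith) (by linarith)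
        (.of_forall hρ0) hρ.intervalIntegrable
    · have h1 := (_root_.abs_le.1 (h.timeLike.abs_le ht)).1
      -- Left of the line x = t only the sup bound `R` is available, but this concerns a bounded
      -- range of x: y lies in [-T, T] and x in [y - T, y].
      have hmem : x ∈ Icc (-(2 * T)) T := ⟨by linarith, by linarith⟩
      beta_reduce
      rw [indicator_of_mem hmem]
      refine le_add_of_le_of_nonneg ?_ (mul_nonneg hC (hI0 (by linarith)))
      have := h.bound (y, t) ⟨ht, hy⟩ htT
      gcongr

end IsStripSol

/-! ### Horizontal increments of `v` -/

namespace IsStripSol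

variable {F G : ℂ × ℂ → ℂ} {z : ℝ → ℝ} {lam u₀ v₀ : ℝ → ℂ} {T L R : ℝ} {u v : ℝ × ℝ → ℂ}
  {A ρ : ℝ → ℝ}

/-- `A` is an integrable bound of the squared size of `(u, v)` in the strip `t ≤ T`, uniform over
intervals of length `T` to the right. -/
structure IsEnvelope (z : ℝ → ℝ) (T : ℝ) (u v : ℝ × ℝ → ℂ) (A : ℝ → ℝ) : Prop where
  integrable : Integrable A
  nonneg : ∀ x, 0 ≤ A x
  sq_le : ∀ x y t, 0 ≤ t → t ≤ T → z t ≤ y → x ≤ y → y ≤ x + T →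
    ‖(u (y, t), v (y, t))‖ ^ 2 ≤ A x

/-- The anchor `x` may differ from `y` by up to `T`: the envelope bounds the point y + s by its
value at x + s. Increments along characteristics at different positions can thus all be charged to
the same interval. -/
theorem sq_norm_sub_u_le (h : IsStripSol F G z lam u₀ v₀ T L R u v) (hA : IsEnvelope z T u v A)
    {x y t δ : ℝ} (ht : 0 ≤ t) (hy : z t ≤ y) (hδ : 0 ≤ δ) (htT : t + δ ≤ T) (hxy : x ≤ y)
    (hyx : y ≤ x + T) :
    ‖u (y + δ, t + δ) - u (y, t)‖ ^ 2 ≤ δ * (L ^ 2 * ∫ s in x..x + δ, A s) := by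
  rw [h.eq_u y t δ ht hy hδ htT]
  refine (norm_integral_sq_le_of_sq_le (a := fun s => L ^ 2 * A (x + s))
    (h.continuous_comp_F (by fun_prop)) hδ ?_ fun s hs => ?_).trans_eq ?_
  · exact (((hA.integrable.comp_add_left x).const_mul _).intervalIntegrable)
  · have hp : (y + s, t + s) ∈ Omega z :=
      ⟨by simp only; linarith [hs.1], h.timeLike.right_mem ht hy hs.1⟩
    have hsT : t + s ≤ T := by linarith [hs.2]
    calc _ ≤ (L * ‖(u (y + s, t + s), v (y + s, t + s))‖) ^ 2 := by
          gcongr; exact h.norm_F_le hp hsT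
      _ = L ^ 2 * ‖(u (y + s, t + s), v (y + s, t + s))‖ ^ 2 := mul_pow _ _ _
      _ ≤ _ := by
          gcongr
          exact hA.sq_le _ _ _ hp.1 hsT hp.2 (by linarith) (by linarith)
  · rw [intervalIntegral.integral_const_mul, intervalIntegral.integral_comp_add_left (f := A),
      add_zero]

theorem sq_norm_sub_v_le (h : IsStripSol F G z lam u₀ v₀ T L R u v) (hA : IsEnvelope z T u v A)
    {x y t δ : ℝ} (ht : 0 ≤ t) (hδ : 0 ≤ δ) (hy : z (t + δ) ≤ y - δ) (htT : t + δ ≤ T)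
    (hxy : x ≤ y) (hyx : y ≤ x + T) :
    ‖v (y - δ, t + δ) - v (y, t)‖ ^ 2 ≤ δ * (L ^ 2 * ∫ s in (x - δ)..x, A s) := by
  rw [h.eq_v y t δ ht hδ hy htT]
  refine (norm_integral_sq_le_of_sq_le (a := fun s => L ^ 2 * A (x - s))
    (h.continuous_comp_G (by fun_prop)) hδ ?_ fun s hs => ?_).trans_eq ?_
  · exact (((hA.integrable.comp_sub_left x).const_mul _).intervalIntegrable)
  · have hp : (y - s, t + s) ∈ Omega z :=
      ⟨by simp only; linarith [hs.1], h.timeLike.left_mem ht hy hs⟩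
    have hsT : t + s ≤ T := by linarith [hs.2]
    calc _ ≤ (L * ‖(u (y - s, t + s), v (y - s, t + s))‖) ^ 2 := by
          gcongr; exact h.norm_G_le hp hsT
      _ = L ^ 2 * ‖(u (y - s, t + s), v (y - s, t + s))‖ ^ 2 := mul_pow _ _ _
      _ ≤ _ := by
          gcongr
          exact hA.sq_le _ _ _ hp.1 hsT hp.2 (by linarith) (by linarith)
  · rw [intervalIntegral.integral_const_mul, intervalIntegral.integral_comp_sub_left (f := A),
      sub_zero]

/-- Propagation of diagonal increments of `v` along its characteristics. -/
theorem norm_diag_sub_v_le (h : IsStripSol F G z lam u₀ v₀ (T + 1) L R u v)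
    (hA : IsEnvelope z (T + 1) u v A) {x t δ : ℝ} (ht : 0 ≤ t) (htT : t ≤ T) (hx : z t ≤ x)
    (hδ : 0 ≤ δ) (hδ1 : δ ≤ 1) :
    ‖v (x + δ, t + δ) - v (x, t)‖ ≤ (‖v (x + t + δ, δ) - v (x + t, 0)‖ +
      L * T * √(δ * (L ^ 2 * ∫ s in x..x + δ, A s))) * Real.exp (L * T) := by
  have hL := h.L_nonneg
  have hz := h.timeLike
  set ε := √(δ * (L ^ 2 * ∫ s in x..x + δ, A s)) with hε
  have hε0 : 0 ≤ ε := Real.sqrt_nonneg _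
  set f : ℝ → ℂ := fun s => v (x + t + δ - s, δ + s) - v (x + t - s, s) with hf
  have hfc : Continuous f :=
    (h.continuous_v.comp (by fun_prop : Continuous fun s : ℝ => (x + t + δ - s, δ + s))).sub
      (h.continuous_v.comp (by fun_prop : Continuous fun s : ℝ => (x + t - s, s)))
  have hmem {s : ℝ} (hs : s ∈ Icc 0 t) : z s ≤ x + t - s := by
    simpa using hz.left_mem (x := x + t) le_rfl (by simpa using hx) hs
  have hmem' {s : ℝ} (hs : s ∈ Icc 0 t) : z (δ + s) ≤ x + t + δ - s := by
    have := hz.right_mem hs.1 (hmem hs) hδ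
    rw [add_comm δ]; linarith
  -- The shift (δ, δ) moves `u` along its own characteristic, so this increment is controlled by the
  -- equation alone; Gronwall is then needed only for `v`.
  have hu {s : ℝ} (hs : s ∈ Icc 0 t) :
      ‖u (x + t + δ - s, δ + s) - u (x + t - s, s)‖ ≤ ε := by
    refine Real.le_sqrt_of_sq_le ?_
    have := h.sq_norm_sub_u_le hA (x := x) hs.1 (hmem hs) hδ (by linarith [hs.2])
      (by linarith [hs.2]) (by linarith [hs.1])
    rwa [add_comm s, show x + t - s + δ = x + t + δ - s by ring] at this
  have hGd {s : ℝ} (hs : s ∈ Icc 0 t) :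
      ‖G (u (x + t + δ - s, δ + s), v (x + t + δ - s, δ + s)) - G (u (x + t - s, s), v (x + t - s, s))‖
        ≤ L * (ε + ‖f s‖) := by
    refine (h.lip_G _ _ (h.bound _ ⟨?_, hmem' hs⟩ ?_) (h.bound _ ⟨hs.1, hmem hs⟩ ?_)).trans ?_
    · simp only; linarith [hs.1]
    · simp only; linarith [hs.2]
    · simp only; linarith [hs.2]
    · gcongr
      exact max_le ((hu hs).trans (le_add_of_nonneg_right (norm_nonneg _)))
        (le_add_of_nonneg_left hε0)
  have key := le_exp_of_le_integral (φ := fun s => ‖f s‖) hfc.norm (M := ‖f 0‖ + L * T * ε) ht hL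
    fun s hs => ?_
  · have e : f t = v (x + δ, t + δ) - v (x, t) := by
      simp only [hf]; congr 3 <;> ring
    rw [e] at key
    refine key.trans ?_
    have e0 : f 0 = v (x + t + δ, δ) - v (x + t, 0) := by simp [hf]
    rw [e0]
    have : 0 ≤ T := ht.trans htT
    gcongr
    linarith
  have hs' {r} (hr : r ∈ Icc 0 s) : r ∈ Icc 0 t := ⟨hr.1, hr.2.trans hs.2⟩
  have e1 := h.eq_v (x + t) 0 s le_rfl hs.1 (by simpa using hmem hs) (by linarith [hs.2])
  have e2 := h.eq_v (x + t + δ) δ s hδ hs.1 (hmem' hs) (by linarith [hs.2])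
  simp only [zero_add] at e1
  have c1 : Continuous fun r => G (u (x + t - r, r), v (x + t - r, r)) :=
    h.continuous_comp_G (by fun_prop)
  have c2 : Continuous fun r => G (u (x + t + δ - r, δ + r), v (x + t + δ - r, δ + r)) :=
    h.continuous_comp_G (by fun_prop)
  have e3 : f s = f 0 + ∫ r in (0:ℝ)..s,
      (G (u (x + t + δ - r, δ + r), v (x + t + δ - r, δ + r)) -
        G (u (x + t - r, r), v (x + t - r, r))) := by
    rw [intervalIntegral.integral_sub (c2.intervalIntegrable _ _) (c1.intervalIntegrable _ _),
      ← e1, ← e2]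
    simp only [hf, sub_zero, add_zero]
    ring
  rw [e3]
  refine (norm_add_le _ _).trans ((add_le_add le_rfl ?_).trans_eq (add_assoc _ _ _).symm)
  calc _ ≤ ∫ r in (0:ℝ)..s, L * (ε + ‖f r‖) :=
        intervalIntegral.norm_integral_le_of_norm_le hs.1
          (.of_forall fun r hr => hGd (hs' (Ioc_subset_Icc_self hr)))
          ((by fun_prop : Continuous fun r => L * (ε + ‖f r‖)).intervalIntegrable _ _)
    _ = L * s * ε + L * ∫ r in (0:ℝ)..s, ‖f r‖ := by
        rw [intervalIntegral.integral_const_mul, intervalIntegral.integral_add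
          (by simp) (hfc.norm.intervalIntegrable _ _)]
        simp; ring
    _ ≤ _ := by gcongr; exact hs.2.trans htT

/-- From (x, t) go to (x + δ, t + δ), then down the `v`-characteristic to (x + 2δ, t). The first
increment propagates down to t = 0, where it splits into a piece of a `v`-characteristic and an
increment of `v₀`. The strip of height T + 1 leaves room for the excursion. -/
theorem sqModulusOn_v (h : IsStripSol F G z lam u₀ v₀ (T + 1) L R u v)
    (hA : IsEnvelope z (T + 1) u v A) (hρ : Integrable ρ) (hρ0 : ∀ x, 0 ≤ ρ x)
    (hv₀ : EnergyDensity ρ v₀) {t : ℝ} (ht : 0 ≤ t) (htT : t ≤ T) :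
    SqModulusOn (Ici (z t)) (fun x => v (x, t)) fun x =>
      3 * Real.exp (L * T) ^ 2 * (2 + 4 * L ^ 2 + L ^ 4 * T ^ 2) *
        ((∫ s in (0:ℝ)..x, A s) + ∫ s in (0:ℝ)..x + t, ρ s) := by
  have hz := h.timeLike
  -- Steps of length at most 2 give δ ≤ 1, so the path stays below time T + 1.
  refine sqModulusOn_of_step (ordConnected_Ici) two_pos fun x hx y hy hxy hy2 => ?_
  obtain ⟨δ, rfl⟩ : ∃ δ, y = x + 2 * δ := ⟨(y - x) / 2, by ring⟩
  have hδ : 0 ≤ δ := by linarith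
  have hδ1 : δ ≤ 1 := by linarith
  simp only [mem_Ici] at hx
  rw [← mul_sub, add_sub_add_comm, intervalIntegral.integral_interval_sub_left
    hA.integrable.intervalIntegrable hA.integrable.intervalIntegrable,
    intervalIntegral.integral_interval_sub_left hρ.intervalIntegrable hρ.intervalIntegrable]
  set J := ∫ s in x..x + 2 * δ, A s
  set P := ∫ s in x + t..x + 2 * δ + t, ρ s with hP
  have hJ0 : 0 ≤ J := intervalIntegral.integral_nonneg hxy fun s _ => hA.nonneg s
  have hP0 : 0 ≤ P := intervalIntegral.integral_nonneg (by linarith) fun s _ => hρ0 s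
  have hJ {a b : ℝ} (h1 : x ≤ a) (h2 : a ≤ b) (h3 : b ≤ x + 2 * δ) : ∫ s in a..b, A s ≤ J :=
    intervalIntegral.integral_mono_interval h1 h2 h3 (.of_forall hA.nonneg)
      hA.integrable.intervalIntegrable
  have hxt : 0 ≤ x + t := by linarith [(_root_.abs_le.1 (hz.abs_le ht)).1]
  set E := Real.exp (L * T)
  have hT : 0 ≤ T := ht.trans htT
  have hL := h.L_nonneg
  have hE : 1 ≤ E := Real.one_le_exp (by positivity)
  have h1 := h.norm_diag_sub_v_le hA ht htT hx hδ hδ1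
  set ε := √(δ * (L ^ 2 * ∫ s in x..x + δ, A s))
  have hε2 : ε ^ 2 ≤ δ * (L ^ 2 * J) := by
    rw [Real.sq_sqrt]
    · gcongr; exact hJ le_rfl (by linarith) (by linarith)
    · have : 0 ≤ ∫ s in x..x + δ, A s :=
        intervalIntegral.integral_nonneg (by linarith) fun s _ => hA.nonneg s
      positivity
  have h2 : ‖v (x + δ, t + δ) - v (x + 2 * δ, t)‖ ^ 2 ≤ δ * (L ^ 2 * J) := by
    have := h.sq_norm_sub_v_le hA (x := x + 2 * δ) (y := x + 2 * δ) ht hδ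
      (by have := hz.right_mem ht hx hδ; linarith) (by linarith) le_rfl (by linarith)
    rw [show x + 2 * δ - δ = x + δ by ring] at this
    exact this.trans (by gcongr; exact hJ (by linarith) (by linarith) le_rfl)
  have h3 : ‖v (x + t + δ, δ) - v (x + t + 2 * δ, 0)‖ ^ 2 ≤ δ * (L ^ 2 * J) := by
    have := h.sq_norm_sub_v_le hA (x := x + 2 * δ) (y := x + t + 2 * δ) (t := 0) le_rfl hδ
      (by have := (_root_.abs_le.1 (hz.abs_le hδ)).2; rw [zero_add]; linarith) (by linarith)
      (by linarith) (by linarith)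
    rw [show x + t + 2 * δ - δ = x + t + δ by ring, show x + 2 * δ - δ = x + δ by ring,
      zero_add] at this
    exact this.trans (by gcongr; exact hJ (by linarith) (by linarith) le_rfl)
  have h4 : ‖v (x + t + 2 * δ, 0) - v (x + t, 0)‖ ^ 2 ≤ 2 * δ * P := by
    rw [(h.initial _ hxt).2, (h.initial _ (by linarith)).2]
    refine (hv₀.sq_sub_le _ _ hxt (by linarith)).trans_eq ?_
    rw [hP]; ring_nf
  set a := ‖v (x + δ, t + δ) - v (x, t)‖
  set b := ‖v (x + δ, t + δ) - v (x + 2 * δ, t)‖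
  set c := ‖v (x + t + δ, δ) - v (x + t + 2 * δ, 0)‖
  set d := ‖v (x + t + 2 * δ, 0) - v (x + t, 0)‖
  have h5 : ‖v (x + t + δ, δ) - v (x + t, 0)‖ ≤ c + d := norm_sub_le_norm_sub_add_norm_sub _ _ _
  have h6 : ‖v (x + 2 * δ, t) - v (x, t)‖ ≤ b + a := by
    have := norm_sub_le_norm_sub_add_norm_sub (v (x + 2 * δ, t)) (v (x + δ, t + δ)) (v (x, t))
    rwa [norm_sub_rev (v (x + 2 * δ, t)) (v (x + δ, t + δ))] at this
  have hb : 0 ≤ b := norm_nonneg _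
  have hc : 0 ≤ c := norm_nonneg _
  have hd : 0 ≤ d := norm_nonneg _
  have hε0 : 0 ≤ ε := Real.sqrt_nonneg _
  have h7 : ‖v (x + 2 * δ, t) - v (x, t)‖ ≤ E * ((b + c) + d + L * T * ε) := by
    refine h6.trans ?_
    have : b ≤ E * b := le_mul_of_one_le_left hb hE
    have h8 : a ≤ (c + d + L * T * ε) * E := h1.trans (by gcongr)
    linarith
  calc _ ≤ (E * ((b + c) + d + L * T * ε)) ^ 2 := by gcongr
    _ ≤ E ^ 2 * (3 * ((b + c) ^ 2 + d ^ 2 + (L * T * ε) ^ 2)) := by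
        rw [mul_pow]; gcongr
        nlinarith [sq_nonneg (b + c - d), sq_nonneg (d - L * T * ε),
          sq_nonneg (b + c - L * T * ε)]
    _ ≤ E ^ 2 * (3 * (4 * (δ * (L ^ 2 * J)) + 2 * δ * P + L ^ 2 * T ^ 2 * (δ * (L ^ 2 * J)))) := by
        gcongr
        · nlinarith [sq_nonneg (b - c)]
        · rw [mul_pow, mul_pow]; gcongr
    _ = 3 * E ^ 2 * (δ * ((4 * L ^ 2 + L ^ 4 * T ^ 2) * J + 2 * P)) := by ring
    _ ≤ 3 * E ^ 2 * ((2 * δ) * ((2 + 4 * L ^ 2 + L ^ 4 * T ^ 2) * (J + P))) := by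
        have h9 : (4 * L ^ 2 + L ^ 4 * T ^ 2) * J + 2 * P ≤
            2 * ((2 + 4 * L ^ 2 + L ^ 4 * T ^ 2) * (J + P)) := by
          have : 0 ≤ (4 * L ^ 2 + L ^ 4 * T ^ 2) * J := by positivity
          have : 0 ≤ (4 * L ^ 2 + L ^ 4 * T ^ 2) * P := by positivity
          linarith
        calc _ ≤ 3 * E ^ 2 * (δ * (2 * ((2 + 4 * L ^ 2 + L ^ 4 * T ^ 2) * (J + P)))) := by gcongr
          _ = _ := by ring
    _ = _ := by ring

end IsStripSol

/-! ### Horizontal increments of `u` -/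

namespace IsStripSol

variable {F G : ℂ × ℂ → ℂ} {z : ℝ → ℝ} {lam u₀ v₀ : ℝ → ℂ} {T L R : ℝ} {u v : ℝ × ℝ → ℂ}

/-- Propagation of horizontal increments of `u` along its characteristics. -/
theorem sq_norm_shift_u_le (h : IsStripSol F G z lam u₀ v₀ (T + 1) L R u v)
    {e : ℝ → ℝ} (he : Continuous e) (he0 : ∀ s, 0 ≤ e s) {ξ ξ' τ t : ℝ} (hξ : ξ ≤ ξ')
    (hτ : 0 ≤ τ) (hτt : τ ≤ t) (htT : t ≤ T) (hz : z τ ≤ ξ + τ)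
    (hv : ∀ s ∈ Icc τ t, ‖v (ξ' + s, s) - v (ξ + s, s)‖ ^ 2 ≤ (ξ' - ξ) * e s) :
    ‖u (ξ' + t, t) - u (ξ + t, t)‖ ^ 2 ≤ 2 * Real.exp (L * T) ^ 2 *
      (‖u (ξ' + τ, τ) - u (ξ + τ, τ)‖ ^ 2 +
        L ^ 2 * T * ((ξ' - ξ) * ∫ s in (0:ℝ)..T, e s)) := by
  have hL := h.L_nonneg
  have hT : 0 ≤ T := by linarith
  obtain ⟨l, rfl⟩ : ∃ l, t = τ + l := ⟨t - τ, by ring⟩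
  have hl : 0 ≤ l := by linarith
  set w : ℝ → ℂ := fun r => u (ξ' + τ + r, τ + r) - u (ξ + τ + r, τ + r) with hw
  set d : ℝ → ℂ := fun r => v (ξ' + τ + r, τ + r) - v (ξ + τ + r, τ + r) with hd
  have wc : Continuous w :=
    (h.continuous_u.comp (by fun_prop : Continuous fun r : ℝ => (ξ' + τ + r, τ + r))).sub
      (h.continuous_u.comp (by fun_prop : Continuous fun r : ℝ => (ξ + τ + r, τ + r)))
  have dc : Continuous d :=
    (h.continuous_v.comp (by fun_prop : Continuous fun r : ℝ => (ξ' + τ + r, τ + r))).sub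
      (h.continuous_v.comp (by fun_prop : Continuous fun r : ℝ => (ξ + τ + r, τ + r)))
  have hmem {r : ℝ} (hr : r ∈ Icc 0 l) : z (τ + r) ≤ ξ + τ + r := h.timeLike.right_mem hτ hz hr.1
  have hd2 : ∀ r ∈ Icc 0 l, ‖d r‖ ^ 2 ≤ (ξ' - ξ) * e (τ + r) := by
    intro r hr
    have := hv (τ + r) ⟨by linarith [hr.1], by linarith [hr.2]⟩
    rwa [← add_assoc, ← add_assoc] at this
  set I := ∫ r in (0:ℝ)..l, ‖d r‖ with hI
  have hI0 : 0 ≤ I := intervalIntegral.integral_nonneg hl fun _ _ => norm_nonneg _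
  have hI2 : I ^ 2 ≤ T * ((ξ' - ξ) * ∫ s in (0:ℝ)..T, e s) := by
    have h1 := sq_intervalIntegral_le (h := fun s => ‖d s‖) hl (dc.norm.intervalIntegrable _ _)
      ((dc.norm.pow 2).intervalIntegrable _ _)
    rw [sub_zero] at h1
    have h2 : ∫ r in (0:ℝ)..l, ‖d r‖ ^ 2 ≤ ∫ r in (0:ℝ)..l, (ξ' - ξ) * e (τ + r) :=
      intervalIntegral.integral_mono_on hl ((dc.norm.pow 2).intervalIntegrable _ _)
        ((by fun_prop : Continuous fun r => (ξ' - ξ) * e (τ + r)).intervalIntegrable _ _) hd2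
    rw [intervalIntegral.integral_const_mul, intervalIntegral.integral_comp_add_left (f := e),
      add_zero] at h2
    have h3 : ∫ s in τ..τ + l, e s ≤ ∫ s in (0:ℝ)..T, e s :=
      intervalIntegral.integral_mono_interval hτ hτt htT (.of_forall he0)
        (he.intervalIntegrable _ _)
    have h4 : 0 ≤ ∫ r in (0:ℝ)..l, ‖d r‖ ^ 2 :=
      intervalIntegral.integral_nonneg hl fun _ _ => by positivity
    refine h1.trans (mul_le_mul (by linarith) (h2.trans ?_) h4 hT)
    exact mul_le_mul_of_nonneg_left h3 (sub_nonneg.2 hξ)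
  have hFd {r : ℝ} (hr : r ∈ Icc 0 l) :
      ‖F (u (ξ' + τ + r, τ + r), v (ξ' + τ + r, τ + r)) -
        F (u (ξ + τ + r, τ + r), v (ξ + τ + r, τ + r))‖ ≤ L * (‖w r‖ + ‖d r‖) := by
    have h1 := hmem hr
    have h2 : 0 ≤ τ + r := by linarith [hr.1]
    have h3 : τ + r ≤ T + 1 := by linarith [hr.2]
    refine (h.lip_F _ _ (h.bound _ ⟨h2, by simp only; linarith⟩ h3)
      (h.bound _ ⟨h2, h1⟩ h3)).trans ?_
    gcongr
    exact max_le (le_add_of_nonneg_right (norm_nonneg _)) (le_add_of_nonneg_left (norm_nonneg _))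
  have key := le_exp_of_le_integral (φ := fun s => ‖w s‖) wc.norm (M := ‖w 0‖ + L * I) hl hL
    fun s hs => ?_
  · have e1 : w l = u (ξ' + (τ + l), τ + l) - u (ξ + (τ + l), τ + l) := by
      simp only [hw, add_assoc]
    have e0 : w 0 = u (ξ' + τ, τ) - u (ξ + τ, τ) := by simp only [hw, add_zero]
    rw [← e1, ← e0]
    have h5 : Real.exp (L * (l - 0)) ≤ Real.exp (L * T) := by gcongr; linarith
    calc ‖w l‖ ^ 2 ≤ ((‖w 0‖ + L * I) * Real.exp (L * T)) ^ 2 := by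
          gcongr; exact key.trans (by gcongr)
      _ = Real.exp (L * T) ^ 2 * (‖w 0‖ + L * I) ^ 2 := by ring
      _ ≤ Real.exp (L * T) ^ 2 * (2 * (‖w 0‖ ^ 2 + L ^ 2 * I ^ 2)) := by
          gcongr; nlinarith [sq_nonneg (‖w 0‖ - L * I)]
      _ ≤ Real.exp (L * T) ^ 2 * (2 * (‖w 0‖ ^ 2 +
            L ^ 2 * (T * ((ξ' - ξ) * ∫ s in (0:ℝ)..T, e s)))) := by gcongr
      _ = _ := by ring
  have e1 := h.eq_u (ξ' + τ) τ s hτ (by linarith) hs.1 (by linarith [hs.2])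
  have e2 := h.eq_u (ξ + τ) τ s hτ hz hs.1 (by linarith [hs.2])
  have c1 : Continuous fun r => F (u (ξ' + τ + r, τ + r), v (ξ' + τ + r, τ + r)) :=
    h.continuous_comp_F (by fun_prop)
  have c2 : Continuous fun r => F (u (ξ + τ + r, τ + r), v (ξ + τ + r, τ + r)) :=
    h.continuous_comp_F (by fun_prop)
  have e3 : w s = w 0 + ∫ r in (0:ℝ)..s,
      (F (u (ξ' + τ + r, τ + r), v (ξ' + τ + r, τ + r)) -
        F (u (ξ + τ + r, τ + r), v (ξ + τ + r, τ + r))) := by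
    rw [intervalIntegral.integral_sub (c1.intervalIntegrable _ _) (c2.intervalIntegrable _ _),
      ← e1, ← e2]
    simp only [hw, add_zero]
    ring
  rw [e3]
  refine (norm_add_le _ _).trans ((add_le_add le_rfl ?_).trans_eq (add_assoc _ _ _).symm)
  calc _ ≤ ∫ r in (0:ℝ)..s, L * (‖w r‖ + ‖d r‖) :=
        intervalIntegral.norm_integral_le_of_norm_le hs.1
          (.of_forall fun r hr => hFd ⟨hr.1.le, hr.2.trans hs.2⟩)
          ((by fun_prop : Continuous fun r => L * (‖w r‖ + ‖d r‖)).intervalIntegrable _ _)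
    _ = L * (∫ r in (0:ℝ)..s, ‖d r‖) + L * ∫ r in (0:ℝ)..s, ‖w r‖ := by
        rw [intervalIntegral.integral_const_mul, intervalIntegral.integral_add
          (wc.norm.intervalIntegrable _ _) (dc.norm.intervalIntegrable _ _)]
        ring
    _ ≤ _ := by
        gcongr
        exact intervalIntegral.integral_mono_interval le_rfl hs.1 hs.2
          (.of_forall fun _ => norm_nonneg _) (dc.norm.intervalIntegrable _ _)

theorem norm_segment_F_le (h : IsStripSol F G z lam u₀ v₀ T L R u v) {x t δ : ℝ} (ht : 0 ≤ t)
    (hx : z t ≤ x) (hδ : 0 ≤ δ) (htT : t + δ ≤ T) :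
    ‖u (x + δ, t + δ) - u (x, t)‖ ≤ L * R * δ := by
  rw [h.eq_u x t δ ht hx hδ htT]
  refine (intervalIntegral.norm_integral_le_of_norm_le_const (C := L * R)
    fun s hs => ?_).trans_eq (by rw [sub_zero, abs_of_nonneg hδ])
  rw [uIoc_of_le hδ] at hs
  have hp : (x + s, t + s) ∈ Omega z :=
    ⟨by simp only; linarith [hs.1], h.timeLike.right_mem ht hx hs.1.le⟩
  have hsT : t + s ≤ T := by linarith [hs.2]
  exact (h.norm_F_le hp hsT).trans (mul_le_mul_of_nonneg_left (h.bound _ hp hsT) h.L_nonneg)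

theorem norm_segment_G_le (h : IsStripSol F G z lam u₀ v₀ T L R u v) {x t δ : ℝ} (ht : 0 ≤ t)
    (hδ : 0 ≤ δ) (hx : z (t + δ) ≤ x - δ) (htT : t + δ ≤ T) :
    ‖v (x - δ, t + δ) - v (x, t)‖ ≤ L * R * δ := by
  rw [h.eq_v x t δ ht hδ hx htT]
  refine (intervalIntegral.norm_integral_le_of_norm_le_const (C := L * R)
    fun s hs => ?_).trans_eq (by rw [sub_zero, abs_of_nonneg hδ])
  rw [uIoc_of_le hδ] at hs
  have hp : (x - s, t + s) ∈ Omega z :=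
    ⟨by simp only; linarith [hs.1], h.timeLike.left_mem ht hx ⟨hs.1.le, hs.2⟩⟩
  have hsT : t + s ≤ T := by linarith [hs.2]
  exact (h.norm_G_le hp hsT).trans (mul_le_mul_of_nonneg_left (h.bound _ hp hsT) h.L_nonneg)

/-- Increments of `u` between two characteristics starting on the boundary. -/
theorem sq_norm_sub_boundary_le (h : IsStripSol F G z lam u₀ v₀ T L R u v) {Λ Λ' q τ' τ : ℝ}
    (hΛ0 : 0 ≤ Λ) (hΛ'0 : 0 ≤ Λ') (hΛ : ∀ t ∈ Icc 0 T, ‖lam t‖ ≤ Λ)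
    (hΛ' : ∀ s ∈ Icc 0 T, ∀ t ∈ Icc 0 T, s ≤ t → ‖lam t - lam s‖ ≤ Λ' * (t - s))
    (hτ' : 0 ≤ τ') (hττ : τ' ≤ τ) (hτT : τ ≤ T)
    (hv : ‖v (z τ + (τ - τ'), τ') - v (z τ', τ')‖ ^ 2 ≤ q) :
    ‖u (z τ' - τ' + τ, τ) - u (z τ, τ)‖ ^ 2 ≤
      2 * (L * R + Λ' * R + Λ * (L * R)) ^ 2 * (τ - τ') ^ 2 + 2 * Λ ^ 2 * q := by
  have hL := h.L_nonneg
  have hR := h.R_nonneg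
  obtain ⟨d, rfl⟩ : ∃ d, τ = τ' + d := ⟨τ - τ', by ring⟩
  have hd : 0 ≤ d := by linarith
  simp only [add_sub_cancel_left] at hv ⊢
  rw [show z τ' - τ' + (τ' + d) = z τ' + d by ring]
  have h1 := h.norm_segment_F_le hτ' le_rfl hd hτT
  have h2 := h.norm_segment_G_le (x := z (τ' + d) + d) hτ' hd (by simp) hτT
  rw [add_sub_cancel_right] at h2
  set a := ‖v (z (τ' + d) + d, τ') - v (z τ', τ')‖
  have h3 : ‖u (z τ', τ') - u (z (τ' + d), τ' + d)‖ ≤ Λ' * d * R + Λ * (L * R * d + a) := by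
    rw [h.boundary _ hτ' (by linarith), h.boundary _ (by linarith) hτT, norm_sub_rev]
    -- The path from one boundary point to the other: the increment of `lam`, then `v` along its
    -- characteristic from (z τ, τ) back to time τ', then a horizontal increment of `v` at time τ'.
    have e : lam (τ' + d) * v (z (τ' + d), τ' + d) - lam τ' * v (z τ', τ') =
        (lam (τ' + d) - lam τ') * v (z τ', τ') +
        lam (τ' + d) * ((v (z (τ' + d), τ' + d) - v (z (τ' + d) + d, τ')) +
          (v (z (τ' + d) + d, τ') - v (z τ', τ'))) := by ring
    rw [e]
    refine (norm_add_le _ _).trans ?_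
    rw [norm_mul, norm_mul]
    gcongr
    · simpa using hΛ' τ' ⟨hτ', by linarith⟩ (τ' + d) ⟨by linarith, hτT⟩ (by linarith)
    · exact (le_max_right _ _).trans (h.bound (z τ', τ') ⟨hτ', le_rfl⟩ (by simp only; linarith))
    · exact hΛ _ ⟨by linarith, hτT⟩
    · exact (norm_add_le _ _).trans (by gcongr)
  have h4 : ‖u (z τ' + d, τ' + d) - u (z (τ' + d), τ' + d)‖ ≤
      (L * R + Λ' * R + Λ * (L * R)) * d + Λ * a := by
    have := norm_sub_le_norm_sub_add_norm_sub (u (z τ' + d, τ' + d)) (u (z τ', τ'))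
      (u (z (τ' + d), τ' + d))
    linarith
  set k := L * R + Λ' * R + Λ * (L * R)
  have ha : 0 ≤ a := norm_nonneg _
  calc _ ≤ (k * d + Λ * a) ^ 2 := by gcongr
    _ ≤ 2 * k ^ 2 * d ^ 2 + 2 * Λ ^ 2 * a ^ 2 := by nlinarith [sq_nonneg (k * d - Λ * a)]
    _ ≤ _ := by gcongr

end IsStripSol

theorem primitive_mono {ρ : ℝ → ℝ} (hρ : Integrable ρ) (hρ0 : ∀ x, 0 ≤ ρ x) :
    Monotone fun x => ∫ s in (0:ℝ)..x, ρ s := by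
  intro x y hxy
  have := intervalIntegral.integral_interval_sub_left (a := 0) (b := y) (c := x)
    hρ.intervalIntegrable hρ.intervalIntegrable
  have h0 := intervalIntegral.integral_nonneg (μ := volume) hxy fun s _ => hρ0 s
  simp only
  linarith

/-- Brings the boundary estimate into the form required of a square modulus: the length `η` times
the increment η + Δ of a monotone function. The difference `d` of foot times is comparable to `η`.
-/
theorem boundary_increment_le {k l Cv M c d Δ η : ℝ} (hCv : 0 ≤ Cv) (hM : 0 ≤ M) (hc : 0 ≤ c)
    (hd : 0 ≤ d) (hΔ : 0 ≤ Δ) (hη : 0 ≤ η) (hdη : d ≤ c * η) :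
    2 * k ^ 2 * d ^ 2 + 2 * l ^ 2 * (2 * d * (Cv * (M * (2 * d) + Δ))) ≤
      η * ((2 * k ^ 2 + 8 * l ^ 2 * Cv * M + 4 * l ^ 2 * Cv) * c * (c + 1) * (η + Δ)) := by
  calc _ = d * ((2 * k ^ 2 + 8 * l ^ 2 * Cv * M) * d + 4 * l ^ 2 * Cv * Δ) := by ring
    _ ≤ d * ((2 * k ^ 2 + 8 * l ^ 2 * Cv * M + 4 * l ^ 2 * Cv) * (d + Δ)) := by
        gcongr
        have : 0 ≤ 4 * l ^ 2 * Cv * d := by positivity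
        have : 0 ≤ (2 * k ^ 2 + 8 * l ^ 2 * Cv * M) * Δ := by positivity
        linarith
    _ ≤ (c * η) * ((2 * k ^ 2 + 8 * l ^ 2 * Cv * M + 4 * l ^ 2 * Cv) * (c * η + Δ)) := by
        gcongr
    _ ≤ (c * η) * ((2 * k ^ 2 + 8 * l ^ 2 * Cv * M + 4 * l ^ 2 * Cv) *
          ((c + 1) * (η + Δ))) := by
        gcongr
        have : 0 ≤ c * Δ := by positivity
        linarith
    _ = _ := by ring

namespace IsStripSol

variable {F G : ℂ × ℂ → ℂ} {z : ℝ → ℝ} {lam u₀ v₀ : ℝ → ℂ} {T L R : ℝ} {u v : ℝ × ℝ → ℂ}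
  {A ρ : ℝ → ℝ}

/-- `v` is settled by `sqModulusOn_v`. In the coordinate ξ = x - t, an increment of `u` is
propagated from t = 0 if both ξ's are nonnegative, and from the curve if both are nonpositive; the
two ranges are joined at x = t. The source contributes the time integral `H` of the moduli of `v`.
-/
theorem exists_modulus (h : IsStripSol F G z lam u₀ v₀ (T + 1) L R u v)
    (hA : IsEnvelope z (T + 1) u v A) {M : ℝ} (hAM : ∀ x, A x ≤ M) (hρ : Integrable ρ)
    (hρ0 : ∀ x, 0 ≤ ρ x) (hu₀ : EnergyDensity ρ u₀) (hv₀ : EnergyDensity ρ v₀) (hT : 0 ≤ T)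
    {Λ Λ' c : ℝ} (hΛ0 : 0 ≤ Λ) (hΛ'0 : 0 ≤ Λ') (hΛ : ∀ t ∈ Icc 0 (T + 1), ‖lam t‖ ≤ Λ)
    (hΛ' : ∀ s ∈ Icc 0 (T + 1), ∀ t ∈ Icc 0 (T + 1), s ≤ t → ‖lam t - lam s‖ ≤ Λ' * (t - s))
    (hc : 0 < c) (hzc : ∀ s t, 0 ≤ s → s ≤ t → t ≤ T → c * (t - s) ≤ (t - s) - (z t - z s)) :
    ∃ K, ∀ t ∈ Icc 0 T,
      (∃ E, SqModulusOn (Ici (z t)) (fun x => u (x, t)) E ∧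
        ∀ x ∈ Ici (z t), ∀ y ∈ Ici (z t), E y - E x ≤ K) ∧
      ∃ E, SqModulusOn (Ici (z t)) (fun x => v (x, t)) E ∧
        ∀ x ∈ Ici (z t), ∀ y ∈ Ici (z t), E y - E x ≤ K := by
  have hz := h.timeLike
  have hL := h.L_nonneg
  have hR := h.R_nonneg
  have hM : 0 ≤ M := (hA.nonneg 0).trans (hAM 0)
  set Cv := 3 * Real.exp (L * T) ^ 2 * (2 + 4 * L ^ 2 + L ^ 4 * T ^ 2)
  have hCv : 0 ≤ Cv := by positivity
  set PA : ℝ → ℝ := fun x => ∫ s in (0:ℝ)..x, A s with hPA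
  set PR : ℝ → ℝ := fun x => ∫ s in (0:ℝ)..x, ρ s with hPR
  have modv {t : ℝ} (ht : 0 ≤ t) (htT : t ≤ T) :
      SqModulusOn (Ici (z t)) (fun x => v (x, t)) fun x => Cv * (PA x + PR (x + t)) :=
    h.sqModulusOn_v hA hρ hρ0 hv₀ ht htT
  have hPAc : Continuous PA := hA.integrable.continuous_primitive 0
  have hPRc : Continuous PR := hρ.continuous_primitive 0
  have hPAm : Monotone PA := primitive_mono hA.integrable hA.nonneg
  have hPRm : Monotone PR := primitive_mono hρ hρ0
  have hPAle (x y) : PA y - PA x ≤ ∫ s, A s := primitive_increment_le hA.integrable hA.nonneg x y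
  have hPRle (x y) : PR y - PR x ≤ ∫ s, ρ s := primitive_increment_le hρ hρ0 x y
  have hPAlip {x y : ℝ} (hxy : x ≤ y) : PA y - PA x ≤ M * (y - x) := by
    simp only [hPA]
    rw [intervalIntegral.integral_interval_sub_left hA.integrable.intervalIntegrable
      hA.integrable.intervalIntegrable]
    refine (intervalIntegral.integral_mono hxy hA.integrable.intervalIntegrable
      intervalIntegrable_const hAM).trans_eq ?_
    simp [mul_comm]
  have hPRint (x y : ℝ) : PR y - PR x = ∫ s in x..y, ρ s :=
    intervalIntegral.integral_interval_sub_left hρ.intervalIntegrable hρ.intervalIntegrable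
  clear_value PA PR Cv
  obtain ⟨τ, -, hτ0, hτpos, hτ⟩ := hz.exists_footTime hT
  set H : ℝ → ℝ := fun ξ => ∫ s in (0:ℝ)..T, Cv * (PA (ξ + s) + PR (ξ + s + s)) with hH
  set k := L * R + Λ' * R + Λ * (L * R)
  set C₂ := 2 * k ^ 2 + 8 * Λ ^ 2 * Cv * M + 4 * Λ ^ 2 * Cv with hC₂
  have hC₂0 : 0 ≤ C₂ := by positivity
  set C₃ := C₂ * c⁻¹ * (c⁻¹ + 1) with hC₃
  have hc' : 0 < c⁻¹ := inv_pos.2 hc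
  have hC₃0 : 0 ≤ C₃ := by positivity
  -- Modulus of `u` at the feet. The first term serves the initial data, the bracket the curve; its
  -- second part enters with a minus sign because the foot time decreases in ξ, which makes it
  -- increasing.
  set D : ℝ → ℝ := fun ξ => PR ξ + C₃ * (min ξ 0 - PR (z (τ ξ) + τ ξ)) with hD
  set C₄ := 2 * Real.exp (L * T) ^ 2
  have hC₄ : 0 ≤ C₄ := by positivity
  have prop {ξ ξ' σ t : ℝ} (hξ : ξ ≤ ξ') (hσ : 0 ≤ σ) (hσt : σ ≤ t) (htT : t ≤ T)
      (hzσ : z σ ≤ ξ + σ)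
      (hstart : ‖u (ξ' + σ, σ) - u (ξ + σ, σ)‖ ^ 2 ≤ (ξ' - ξ) * (D ξ' - D ξ)) :
      ‖u (ξ' + t, t) - u (ξ + t, t)‖ ^ 2 ≤ (ξ' - ξ) *
        (C₄ * (D ξ' + L ^ 2 * T * H ξ') - C₄ * (D ξ + L ^ 2 * T * H ξ)) := by
    set e : ℝ → ℝ := fun s => Cv * (PA (ξ' + s) + PR (ξ' + s + s)) -
      Cv * (PA (ξ + s) + PR (ξ + s + s)) with he
    have hec : Continuous e := by fun_prop
    have he0 (s) : 0 ≤ e s := by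
      have h1 := hPAm (show ξ + s ≤ ξ' + s by linarith)
      have h2 := hPRm (show ξ + s + s ≤ ξ' + s + s by linarith)
      exact sub_nonneg.2 (mul_le_mul_of_nonneg_left (add_le_add h1 h2) hCv)
    have hint : ∫ s in (0:ℝ)..T, e s = H ξ' - H ξ :=
      intervalIntegral.integral_sub
        ((by fun_prop : Continuous fun s => Cv * (PA (ξ' + s) + PR (ξ' + s + s))).intervalIntegrable
          _ _)
        ((by fun_prop : Continuous fun s => Cv * (PA (ξ + s) + PR (ξ + s + s))).intervalIntegrable
          _ _)
    have h1 := h.sq_norm_shift_u_le hec he0 hξ hσ hσt htT hzσ fun s hs => ?_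
    · rw [hint] at h1
      refine h1.trans ((mul_le_mul_of_nonneg_left (add_le_add hstart le_rfl) hC₄).trans_eq ?_)
      ring
    · have h2 : z s ≤ ξ + s := by
        have := hz.right_mem hσ hzσ (sub_nonneg.2 hs.1)
        rw [add_sub_cancel] at this
        linarith
      have h3 := modv (hσ.trans hs.1) (hs.2.trans htT) (ξ + s) h2 (ξ' + s)
        (mem_Ici.2 (by linarith)) (by linarith)
      simp only at h3
      rwa [add_sub_add_right_eq_sub] at h3
  have caseA {ξ ξ' : ℝ} (h0 : 0 ≤ ξ) (hξ : ξ ≤ ξ') :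
      ‖u (ξ' + 0, 0) - u (ξ + 0, 0)‖ ^ 2 ≤ (ξ' - ξ) * (D ξ' - D ξ) := by
    have e1 : D ξ' - D ξ = ∫ s in ξ..ξ', ρ s := by
      simp only [hD, hτpos ξ h0, hτpos ξ' (h0.trans hξ), min_eq_right h0,
        min_eq_right (h0.trans hξ), add_sub_add_right_eq_sub, hPRint]
    rw [add_zero, add_zero, (h.initial _ h0).1, (h.initial _ (h0.trans hξ)).1, e1]
    exact hu₀.sq_sub_le _ _ h0 hξ
  have hτanti {ξ ξ' t : ℝ} (ht : 0 ≤ t) (htT : t ≤ T) (hzt : z t - t ≤ ξ) (hξ : ξ ≤ ξ')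
      (h0 : ξ' ≤ 0) : τ ξ' ≤ τ ξ := by
    by_contra! hlt
    have h1 := hτ ξ t ht htT hzt
    have h2 := hτ ξ' t ht htT (hzt.trans hξ)
    have h3 := hzc (τ ξ) (τ ξ') (hτ0 _) hlt.le (h2.1.trans htT)
    have h4 := h1.2 (hξ.trans h0)
    have h5 := h2.2 h0
    nlinarith
  have caseB {ξ ξ' t : ℝ} (ht : 0 ≤ t) (htT : t ≤ T) (hzt : z t - t ≤ ξ) (hξ : ξ ≤ ξ')
      (h0 : ξ' ≤ 0) :
      ‖u (ξ' + τ ξ, τ ξ) - u (ξ + τ ξ, τ ξ)‖ ^ 2 ≤ (ξ' - ξ) * (D ξ' - D ξ) := by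
    have h1 := hτ ξ t ht htT hzt
    have h2 := hτ ξ' t ht htT (hzt.trans hξ)
    have h3 := hτanti ht htT hzt hξ h0
    have h4 := h1.2 (hξ.trans h0)
    have h5 := h2.2 h0
    have hDξ : D ξ' - D ξ = PR ξ' - PR ξ +
        C₃ * (ξ' - ξ + (PR (z (τ ξ) + τ ξ) - PR (z (τ ξ') + τ ξ'))) := by
      simp only [hD, min_eq_left h0, min_eq_left (hξ.trans h0)]; ring
    rw [hDξ]
    have hσ0 := hτ0 ξ
    have hσ0' := hτ0 ξ'
    have hPRξ : 0 ≤ PR ξ' - PR ξ := sub_nonneg.2 (hPRm hξ)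
    generalize τ ξ = σ at *
    generalize τ ξ' = σ' at *
    set d := σ - σ' with hd
    have hd0 : 0 ≤ d := by linarith
    have h6 := abs_le.1 (hz.abs_sub_le hσ0' h3)
    set Δ := PR (z σ + σ) - PR (z σ' + σ') with hΔ
    have hΔ0 : 0 ≤ Δ := sub_nonneg.2 (hPRm (by linarith))
    -- The gap `c` between the speed of the curve and 1 makes the foot time Lipschitz in ξ.
    have hcd : d ≤ c⁻¹ * (ξ' - ξ) := by
      have := hzc σ' σ hσ0' h3 (h1.1.trans htT)
      rw [← div_eq_inv_mul, le_div_iff₀ hc]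
      linarith
    have hq : ‖v (z σ + d, σ') - v (z σ', σ')‖ ^ 2 ≤ 2 * d * (Cv * (M * (2 * d) + Δ)) := by
      refine (modv hσ0' (h2.1.trans htT) (z σ') self_mem_Ici (z σ + d)
        (mem_Ici.2 (by linarith)) (by linarith)).trans ?_
      rw [← mul_sub]
      have h7 : PA (z σ + d) - PA (z σ') ≤ M * (2 * d) :=
        (hPAlip (by linarith)).trans (by gcongr; linarith)
      have h8 : PR (z σ + d + σ') = PR (z σ + σ) := by congr 1; rw [hd]; ring
      have h9 : 0 ≤ PA (z σ + d) - PA (z σ') := sub_nonneg.2 (hPAm (by linarith))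
      rw [h8, add_sub_add_comm]
      gcongr
      · linarith
    have hb := h.sq_norm_sub_boundary_le hΛ0 hΛ'0 hΛ hΛ' hσ0' h3
      (by linarith [h1.1]) hq
    have e1 : ξ' + σ = z σ' - σ' + σ := by rw [h5]
    have e2 : ξ + σ = z σ := by rw [← h4]; ring
    rw [e1, e2]
    have hη : 0 ≤ ξ' - ξ := sub_nonneg.2 hξ
    refine hb.trans ((boundary_increment_le hCv hM hc'.le hd0 hΔ0 hη hcd).trans ?_)
    exact mul_le_mul_of_nonneg_left (le_add_of_nonneg_left hPRξ) hη
  set K := C₄ * ((∫ s, ρ s) + C₃ * (2 * T + ∫ s, ρ s) +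
    L ^ 2 * T * (T * (Cv * ((∫ s, A s) + ∫ s, ρ s)))) with hK
  refine ⟨max K (Cv * ((∫ s, A s) + ∫ s, ρ s)), fun t ⟨ht, htT⟩ => ⟨⟨fun x =>
    C₄ * (D (x - t) + L ^ 2 * T * H (x - t)), ?_, fun x hx y hy => (le_max_left _ _).trans' ?_⟩,
    _, modv ht htT, fun x hx y hy => (le_max_right _ _).trans' ?_⟩⟩
  · have hzt : z t ≤ t := (abs_le.1 (hz.abs_le ht)).2
    have hset : Ici (z t) = Icc (z t) t ∪ Ici t := (Icc_union_Ici_eq_Ici hzt).symm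
    rw [hset]
    refine SqModulusOn.union (a := t) (fun x hx y hy hxy => ?_) (fun x hx y hy hxy => ?_)
      ⟨hzt, le_rfl⟩ self_mem_Ici (fun x hx => hx.2) fun x hx => hx
    · have h1 : x - t ≤ 0 := by linarith [hx.2]
      have h2 := hτ (x - t) t ht htT (by linarith [hx.1])
      have h3 := prop (ξ := x - t) (ξ' := y - t) (by linarith) (hτ0 _) h2.1 htT
        (by linarith [h2.2 h1])
        (caseB ht htT (by linarith [hx.1]) (by linarith) (by linarith [hy.2]))
      simpa using h3
    · have h1 : 0 ≤ x - t := sub_nonneg.2 hx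
      have h3 := prop (ξ := x - t) (ξ' := y - t) (by linarith) le_rfl ht htT
        (by rw [hz.zero]; linarith) (caseA h1 (by linarith))
      simpa using h3
  · have hzt : -t ≤ z t := (abs_le.1 (hz.abs_le ht)).1
    simp only [mem_Ici] at hx hy
    have hHle : H (y - t) - H (x - t) ≤ T * (Cv * ((∫ s, A s) + ∫ s, ρ s)) := by
      have c1 (ξ : ℝ) : IntervalIntegrable (fun s => Cv * (PA (ξ + s) + PR (ξ + s + s))) volume
          0 T := (by fun_prop : Continuous _).intervalIntegrable _ _
      simp only [hH]
      rw [← intervalIntegral.integral_sub (c1 _) (c1 _)]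
      refine (intervalIntegral.integral_mono hT ((c1 _).sub (c1 _)) intervalIntegrable_const
        fun s => ?_).trans_eq
        (show ∫ _ in (0:ℝ)..T, Cv * ((∫ s, A s) + ∫ s, ρ s) = _ by simp; ring)
      rw [← mul_sub, add_sub_add_comm]
      exact mul_le_mul_of_nonneg_left (add_le_add (hPAle _ _) (hPRle _ _)) hCv
    have hmin : min (y - t) 0 - min (x - t) 0 ≤ 2 * T := by
      have h1 : min (y - t) 0 ≤ 0 := min_le_right _ _
      have h2 : -(2 * T) ≤ min (x - t) 0 := le_min (by linarith) (by linarith)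
      linarith
    rw [← mul_sub, hK]
    refine mul_le_mul_of_nonneg_left ?_ hC₄
    have h1 := hPRle (x - t) (y - t)
    have h2 := hPRle (z (τ (y - t)) + τ (y - t)) (z (τ (x - t)) + τ (x - t))
    have h3 : C₃ * ((min (y - t) 0 - min (x - t) 0) +
        (PR (z (τ (x - t)) + τ (x - t)) - PR (z (τ (y - t)) + τ (y - t)))) ≤
        C₃ * (2 * T + ∫ s, ρ s) := by gcongr
    have h4 : L ^ 2 * T * (H (y - t) - H (x - t)) ≤
        L ^ 2 * T * (T * (Cv * ((∫ s, A s) + ∫ s, ρ s))) := by gcongr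
    simp only [hD]
    linarith
  · rw [← mul_sub, add_sub_add_comm]
    exact mul_le_mul_of_nonneg_left (add_le_add (hPAle _ _) (hPRle _ _)) hCv

end IsStripSol

/-! ### Extension to the plane and weak x-derivatives -/

section Slices

/-- Constant continuation to the left of `a` adds no variation. -/
theorem SqModulusOn.comp_max {F : Type*} [NormedAddCommGroup F] {f : ℝ → F} {E : ℝ → ℝ} {a : ℝ}
    (h : SqModulusOn (Ici a) f E) :
    SqModulusOn univ (fun x => f (max x a)) fun x => E (max x a) := by
  intro x _ y _ hxy
  have hle : max x a ≤ max y a := max_le_max_right _ hxy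
  have hm := h.monotoneOn (le_max_right x a) (le_max_right y a) hle
  refine (h _ (le_max_right x a) _ (le_max_right y a) hle).trans
    (mul_le_mul_of_nonneg_right ?_ (sub_nonneg.2 hm))
  rcases le_total y a with hy | hy
  · simp [hy, hxy.trans hy, hxy]
  · rw [max_eq_left hy]; linarith [le_max_left x a]

variable {z : ℝ → ℝ} {f : ℝ × ℝ → ℂ}

/-- The functions whose slices `f(·, t)` on `[z(t), ∞)` have a modulus of total variation locally
bounded in `t`. -/
def HasSliceModulus (z : ℝ → ℝ) (f : ℝ × ℝ → ℂ) : Prop :=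
  ∀ T, 0 ≤ T → ∃ K, ∀ t ∈ Icc 0 T, ∃ E, SqModulusOn (Ici (z t)) (fun x => f (x, t)) E ∧
    ∀ x ∈ Ici (z t), ∀ y ∈ Ici (z t), E y - E x ≤ K

theorem HasSliceModulus.exists_extend (h : HasSliceModulus z f) (hf : ∀ p, f (proj z p) = f p) :
    ∃ E : ℝ → ℝ → ℝ, (∀ t, SqModulusOn univ (fun x => f (x, t)) (E t)) ∧
      ∀ T, ∃ C, ∀ t, |t| ≤ T → ∀ x y, E t y - E t x ≤ C := by
  -- Only integer horizons are used; for |t| ≤ T the relevant one is at most ⌈T⌉, so the finite sum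
  -- of the |K n| is a uniform bound.
  choose K hK using fun n : ℕ => h n n.cast_nonneg
  have hmem (t : ℝ) : max t 0 ∈ Icc (0:ℝ) ⌈|t|⌉₊ :=
    ⟨le_max_right _ _, max_le ((le_abs_self t).trans (Nat.le_ceil _)) (Nat.cast_nonneg _)⟩
  choose E hE hEK using fun t => hK ⌈|t|⌉₊ (max t 0) (hmem t)
  refine ⟨fun t x => E t (max x (z (max t 0))), fun t => ?_, fun T =>
    ⟨∑ n ∈ Finset.range (⌈T⌉₊ + 1), |K n|, fun t ht x y => ?_⟩⟩
  · have h1 : (fun x => f (x, t)) = fun x => f (max x (z (max t 0)), max t 0) :=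
      funext fun x => (hf (x, t)).symm
    rw [h1]
    exact (hE t).comp_max
  · refine (hEK t _ (mem_Ici.2 (le_max_right _ _)) _ (mem_Ici.2 (le_max_right _ _))).trans ((le_abs_self _).trans ?_)
    exact Finset.single_le_sum (f := fun n => |K n|) (fun _ _ => abs_nonneg _)
      (Finset.mem_range.2 (Nat.lt_succ_of_le (Nat.ceil_le_ceil ht)))

/-- A single function, the pointwise slice derivative, serves both as weak derivative in the plane
and as weak derivative of every slice, not just of almost every one. -/
theorem HasSliceModulus.exists_weakDeriv (h : HasSliceModulus z f)
    (hf : ∀ p, f (proj z p) = f p) (hc : Continuous f) :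
    ∃ fx : ℝ × ℝ → ℂ, HasWeakDeriv univ (1, 0) f fx ∧
      (∀ K, IsCompact K → MemLp fx 2 (volume.restrict K)) ∧
      ∀ t, HasWeakDeriv univ (1:ℝ) (fun x => f (x, t)) (fun x => fx (x, t)) ∧
        MemLp (fun x => fx (x, t)) 2 := by
  obtain ⟨E, hE, hC⟩ := h.exists_extend hf
  refine ⟨_, hasWeakDeriv_slice hc hE hC, fun K hK => memLp_deriv_slice hc hE hC hK, fun t => ?_⟩
  obtain ⟨C, hC⟩ := hC |t|
  exact ⟨(hE t).hasWeakDeriv (by fun_prop) (hC t le_rfl), (hE t).memLp_deriv (hC t le_rfl)⟩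

end Slices

/-! ### Differentiability along characteristics -/

section Characteristics

variable {F G : ℂ × ℂ → ℂ} {z : ℝ → ℝ} {lam u₀ v₀ : ℝ → ℂ} {u v : ℝ × ℝ → ℂ}

theorem exists_pos_segment_mem {p w : ℝ × ℝ} {U : Set (ℝ × ℝ)} (hU : IsOpen U) (hp : p ∈ U) :
    ∃ a : ℝ, 0 < a ∧ ∀ r, |r| ≤ a → p + r • w ∈ U := by
  have hc : ContinuousAt (fun r : ℝ => p + r • w) 0 := by fun_prop
  have := hc.preimage_mem_nhds (t := U) (hU.mem_nhds (by simpa using hp))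
  obtain ⟨a, ha, hb⟩ := Metric.mem_nhds_iff.1 this
  refine ⟨a / 2, by positivity, fun r hr => hb ?_⟩
  rw [mem_ball_zero_iff, Real.norm_eq_abs]
  linarith

theorem hasDerivAt_of_eq_primitive {φ g : ℝ → ℂ} (hg : Continuous g) {a : ℝ} {c : ℂ}
    (ha : 0 < a) (h : ∀ r, |r| < a → φ r = c + ∫ s in (0:ℝ)..a + r, g s) :
    HasDerivAt φ (g a) 0 := by
  have hI : HasDerivAt (fun b => ∫ s in (0:ℝ)..b, g s) (g a) (a + 0) := by
    rw [add_zero]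
    exact intervalIntegral.integral_hasDerivAt_right (hg.intervalIntegrable _ _)
      (hg.stronglyMeasurableAtFilter _ _) hg.continuousAt
  refine ((hI.comp_const_add a 0).const_add c).congr_of_eventuallyEq ?_
  filter_upwards [Metric.ball_mem_nhds (0:ℝ) ha] with r hr
  rw [mem_ball_zero_iff, Real.norm_eq_abs] at hr
  exact h r hr

theorem IsCharSol.hasDerivAt_u (hs : ∀ T, IsCharSol F G z lam u₀ v₀ T u v) (hF : Continuous F)
    {p : ℝ × ℝ} (hp : p ∈ interior (Omega z)) :
    HasDerivAt (fun r : ℝ => u (p + r • ((1, 1) : ℝ × ℝ))) (F (u p, v p)) 0 := by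
  -- The integral equations run only forward in time, so the base point is moved back by `a`; this
  -- gives the two-sided derivative at `p`.
  obtain ⟨a, ha, hmem⟩ := exists_pos_segment_mem (w := (1, 1)) isOpen_interior hp
  obtain ⟨x, t⟩ := p
  have hu := (hs 0).continuous_u
  have hv := (hs 0).continuous_v
  have h1 := interior_subset (hmem (-a) (by simp [abs_of_pos ha]))
  simp only [Omega, mem_ofPred_eq, Prod.smul_mk, smul_eq_mul, mul_one, Prod.mk_add_mk,
    ← sub_eq_add_neg] at h1
  have hc : Continuous fun s => F (u (x - a + s, t - a + s), v (x - a + s, t - a + s)) := by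
    fun_prop
  have key := hasDerivAt_of_eq_primitive (c := u (x - a, t - a))
    (φ := fun r : ℝ => u ((x, t) + r • ((1, 1) : ℝ × ℝ))) hc ha fun r hr => ?_
  · simpa using key
  · have hr' := abs_lt.1 hr
    rw [← (hs (t + r)).eq_u _ _ _ h1.1 h1.2 (by linarith) (by linarith)]
    simp only [Prod.smul_mk, smul_eq_mul, mul_one, Prod.mk_add_mk]
    rw [show x - a + (a + r) = x + r by ring, show t - a + (a + r) = t + r by ring]
    ring

theorem IsCharSol.hasDerivAt_v (hs : ∀ T, IsCharSol F G z lam u₀ v₀ T u v) (hG : Continuous G)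
    {p : ℝ × ℝ} (hp : p ∈ interior (Omega z)) :
    HasDerivAt (fun r : ℝ => v (p + r • ((-1, 1) : ℝ × ℝ))) (G (u p, v p)) 0 := by
  obtain ⟨a, ha, hmem⟩ := exists_pos_segment_mem (w := (-1, 1)) isOpen_interior hp
  obtain ⟨x, t⟩ := p
  have hu := (hs 0).continuous_u
  have hv := (hs 0).continuous_v
  have h1 (r : ℝ) (hr : |r| ≤ a) := interior_subset (hmem r hr)
  simp only [Omega, mem_ofPred_eq, Prod.smul_mk, smul_eq_mul, mul_one, mul_neg, Prod.mk_add_mk,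
    ← sub_eq_add_neg] at h1
  have hc : Continuous fun s => G (u (x + a - s, t - a + s), v (x + a - s, t - a + s)) := by
    fun_prop
  have key := hasDerivAt_of_eq_primitive (c := v (x + a, t - a))
    (φ := fun r : ℝ => v ((x, t) + r • ((-1, 1) : ℝ × ℝ))) hc ha fun r hr => ?_
  · simpa using key
  · have hr' := abs_lt.1 hr
    have h2 := (h1 (-a) (by simp [abs_of_pos ha])).1
    have h3 := (h1 r hr.le).2
    have e1 : x + a - (a + r) = x - r := by ring
    have e2 : t - a + (a + r) = t + r := by ring
    rw [← (hs (t + r)).eq_v _ _ _ (by linarith) (by linarith) (by rwa [e1, e2]) (by linarith)]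
    simp only [Prod.smul_mk, smul_eq_mul, mul_one, mul_neg, Prod.mk_add_mk]
    rw [e1, e2, ← sub_eq_add_neg]
    ring

end Characteristics

/-! ### Consequences of the smoothness of `z` and `lam` -/

section Coefficients

variable {z : ℝ → ℝ} {lam : ℝ → ℂ}

theorem hasDerivAt_of_contDiffOn {E : Type*} [NormedAddCommGroup E] [NormedSpace ℝ E] {f : ℝ → E}
    (hf : ContDiffOn ℝ 1 f (Ici 0)) {t : ℝ} (ht : 0 < t) :
    HasDerivAt f (derivWithin f (Ici 0) t) t :=
  ((hf.differentiableOn one_ne_zero t ht.le).hasDerivWithinAt).hasDerivAt (Ici_mem_nhds ht)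

theorem exists_slope {f : ℝ → ℝ} (hf : ContDiffOn ℝ 1 f (Ici 0)) {s t : ℝ} (hs : 0 ≤ s)
    (hst : s < t) : ∃ r ∈ Ioo s t, f t - f s = derivWithin f (Ici 0) r * (t - s) := by
  obtain ⟨r, hr, he⟩ := exists_hasDerivAt_eq_slope f (derivWithin f (Ici 0)) hst
    (hf.continuousOn.mono fun r hr => hs.trans hr.1)
    fun r hr => hasDerivAt_of_contDiffOn hf (hs.trans_lt hr.1)
  refine ⟨r, hr, ?_⟩
  rw [he, div_mul_cancel₀ _ (sub_pos.2 hst).ne']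

theorem timeLike_of_contDiffOn (hz : ContDiffOn ℝ 1 z (Ici 0)) (hz0 : z 0 = 0)
    (H1 : ∀ t : ℝ, 0 ≤ t → -1 < derivWithin z (Ici 0) t ∧ derivWithin z (Ici 0) t < 1) :
    TimeLike z where
  continuousOn := hz.continuousOn
  zero := hz0
  abs_sub_lt s t hs hst := by
    obtain ⟨r, hr, he⟩ := exists_slope hz hs hst
    have := H1 r (hs.trans hr.1.le)
    rw [he, abs_mul, abs_of_pos (sub_pos.2 hst)]
    exact mul_lt_of_lt_one_left (sub_pos.2 hst) (abs_lt.2 this)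

/-- On [0, T] the derivative of `z` attains its maximum, which is less than 1; `c` is the gap. -/
theorem exists_gap_of_contDiffOn (hz : ContDiffOn ℝ 1 z (Ici 0))
    (H1 : ∀ t : ℝ, 0 ≤ t → derivWithin z (Ici 0) t < 1) (T : ℝ) :
    ∃ c : ℝ, 0 < c ∧ ∀ s t, 0 ≤ s → s ≤ t → t ≤ T → c * (t - s) ≤ (t - s) - (z t - z s) := by
  rcases lt_or_ge T 0 with hT | hT
  · exact ⟨1, one_pos, fun s t hs hst htT => by linarith⟩
  have hc : ContinuousOn (derivWithin z (Ici 0)) (Icc 0 T) :=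
    (hz.continuousOn_derivWithin (uniqueDiffOn_Ici 0) le_rfl).mono Icc_subset_Ici_self
  obtain ⟨q, hq, hmax⟩ := isCompact_Icc.exists_isMaxOn ⟨0, le_rfl, hT⟩ hc
  refine ⟨1 - derivWithin z (Ici 0) q, sub_pos.2 (H1 q hq.1), fun s t hs hst htT => ?_⟩
  rcases hst.eq_or_lt with rfl | hlt
  · simp
  obtain ⟨r, hr, he⟩ := exists_slope hz hs hlt
  have : derivWithin z (Ici 0) r ≤ derivWithin z (Ici 0) q :=
    hmax ⟨hs.trans hr.1.le, hr.2.le.trans htT⟩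
  rw [he]
  nlinarith

theorem exists_lipschitz_of_contDiffOn (hlam : ContDiffOn ℝ 1 lam (Ici 0)) (T : ℝ) :
    ∃ C : ℝ, 0 ≤ C ∧ ∀ s ∈ Icc 0 T, ∀ t ∈ Icc 0 T, s ≤ t → ‖lam t - lam s‖ ≤ C * (t - s) := by
  obtain ⟨C, hC⟩ := isCompact_Icc.exists_bound_of_continuousOn
    ((hlam.continuousOn_derivWithin (uniqueDiffOn_Ici 0) le_rfl).mono
      (Icc_subset_Ici_self : Icc 0 T ⊆ Ici 0))
  refine ⟨max C 0, le_max_right _ _, fun s hs t ht hst => ?_⟩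
  have := (convex_Icc (0:ℝ) T).norm_image_sub_le_of_norm_hasDerivWithin_le
    (fun r hr => ((hlam.differentiableOn one_ne_zero r hr.1).hasDerivWithinAt).mono
      Icc_subset_Ici_self) (fun r hr => (hC r hr).trans (le_max_left C 0)) hs ht
  rwa [Real.norm_eq_abs, abs_of_nonneg (sub_nonneg.2 hst)] at this

end Coefficients

/-! ### Assembly of the well-posedness theorem -/

section WellPosed

variable {m α β : ℝ} {z : ℝ → ℝ} {lam u₀ v₀ : ℝ → ℂ} {u v : ℝ × ℝ → ℂ} {ρ : ℝ → ℝ}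

theorem exists_isStripSol (hz : TimeLike z) {T : ℝ}
    (h : IsCharSol (rhsU m α β) (rhsV m α β) z lam u₀ v₀ T u v)
    (hR : ∃ R, ∀ p ∈ Omega z, p.2 ≤ T → ‖u p‖ ≤ R ∧ ‖v p‖ ≤ R) :
    ∃ L R, IsStripSol (rhsU m α β) (rhsV m α β) z lam u₀ v₀ T L R u v := by
  obtain ⟨R, hR⟩ := hR
  obtain ⟨L₁, hL₁, hF⟩ := lipOnBalls_rhsU m α β (max R 0)
  obtain ⟨L₂, hL₂, hG⟩ := lipOnBalls_rhsV m α β (max R 0)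
  exact ⟨max L₁ L₂, max R 0, {
    h with
    timeLike := hz
    continuous_F := (lipOnBalls_rhsU m α β).continuous
    continuous_G := (lipOnBalls_rhsV m α β).continuous
    F_zero := rhsU_zero m α β
    G_zero := rhsV_zero m α β
    L_nonneg := le_max_of_le_left hL₁
    R_nonneg := le_max_right _ _
    bound := fun p hp hpT => (max_le (hR p hp hpT).1 (hR p hp hpT).2).trans (le_max_left R 0)
    lip_F := fun p q hp hq => (hF p q hp hq).trans (by gcongr; exact le_max_left _ _)
    lip_G := fun p q hp hq => (hG p q hp hq).trans (by gcongr; exact le_max_right _ _) }⟩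

theorem hasSliceModulus_of_isStripSol
    (h : ∀ T, ∃ L R, IsStripSol (rhsU m α β) (rhsV m α β) z lam u₀ v₀ T L R u v)
    (hz : ContDiffOn ℝ 1 z (Ici 0)) (hz1 : ∀ t : ℝ, 0 ≤ t → derivWithin z (Ici 0) t < 1)
    (hlam : ContDiffOn ℝ 1 lam (Ici 0)) (hρ : Integrable ρ) (hρ0 : ∀ x, 0 ≤ ρ x)
    (hu₀ : EnergyDensity ρ u₀) (hv₀ : EnergyDensity ρ v₀) :
    HasSliceModulus z u ∧ HasSliceModulus z v := by
  suffices H : ∀ T, 0 ≤ T → ∃ K, ∀ t ∈ Icc 0 T,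
      (∃ E, SqModulusOn (Ici (z t)) (fun x => u (x, t)) E ∧
        ∀ x ∈ Ici (z t), ∀ y ∈ Ici (z t), E y - E x ≤ K) ∧
      ∃ E, SqModulusOn (Ici (z t)) (fun x => v (x, t)) E ∧
        ∀ x ∈ Ici (z t), ∀ y ∈ Ici (z t), E y - E x ≤ K from
    ⟨fun T hT => (H T hT).imp fun K hK t ht => (hK t ht).1,
      fun T hT => (H T hT).imp fun K hK t ht => (hK t ht).2⟩
  intro T hT
  obtain ⟨L, R, hs⟩ := h (T + 1)
  obtain ⟨A, hAi, hA0, ⟨M, hM⟩, hA⟩ := hs.exists_envelope hρ hρ0 hu₀ hv₀ (by linarith)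
  obtain ⟨Λ, hΛ⟩ := isCompact_Icc.exists_bound_of_continuousOn
    (hlam.continuousOn.mono (Icc_subset_Ici_self : Icc 0 (T + 1) ⊆ Ici 0))
  obtain ⟨Λ', hΛ'0, hΛ'⟩ := exists_lipschitz_of_contDiffOn hlam (T + 1)
  obtain ⟨c, hc, hzc⟩ := exists_gap_of_contDiffOn hz hz1 T
  exact hs.exists_modulus ⟨hAi, hA0, hA⟩ hM hρ hρ0 hu₀ hv₀ hT (le_max_right Λ 0) hΛ'0
    (fun t ht => (hΛ t ht).trans (le_max_left _ _)) hΛ' hc hzc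

theorem memLp_slice_of_isStripSol
    (h : ∀ T, ∃ L R, IsStripSol (rhsU m α β) (rhsV m α β) z lam u₀ v₀ T L R u v)
    (hρ : Integrable ρ) (hρ0 : ∀ x, 0 ≤ ρ x)
    (hu₀ : EnergyDensity ρ u₀) (hv₀ : EnergyDensity ρ v₀) {t : ℝ} (ht : 0 ≤ t) :
    MemLp (fun x => u (x, t)) 2 (volume.restrict (Ioi (z t))) ∧
      MemLp (fun x => v (x, t)) 2 (volume.restrict (Ioi (z t))) := by
  obtain ⟨L, R, hs⟩ := h t
  obtain ⟨A, hAi, -, -, hA⟩ := hs.exists_envelope hρ hρ0 hu₀ hv₀ ht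
  have key {f : ℝ → ℂ} (hf : Continuous f) (hle : ∀ x, ‖f x‖ ≤ ‖(u (x, t), v (x, t))‖) :
      MemLp f 2 (volume.restrict (Ioi (z t))) := by
    refine (memLp_two_iff_integrable_sq_norm hf.aestronglyMeasurable).2
      (Integrable.mono' hAi.integrableOn (by fun_prop) ?_)
    refine (ae_restrict_mem measurableSet_Ioi).mono fun x hx => ?_
    rw [Real.norm_of_nonneg (by positivity)]
    calc ‖f x‖ ^ 2 ≤ ‖(u (x, t), v (x, t))‖ ^ 2 := by gcongr; exact hle x
      _ ≤ A x := hA x x t ht le_rfl (mem_Ioi.1 hx).le le_rfl (by linarith)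
  have hu := hs.continuous_u
  have hv := hs.continuous_v
  exact ⟨key (by fun_prop) fun x => le_max_left _ _, key (by fun_prop) fun x => le_max_right _ _⟩

theorem memLp_restrict_of_continuous {f : ℝ × ℝ → ℂ} (hf : Continuous f) {K : Set (ℝ × ℝ)}
    (hK : IsCompact K) : MemLp f 2 (volume.restrict K) := by
  have : IsFiniteMeasure (volume.restrict K) :=
    ⟨by rw [Measure.restrict_apply_univ]; exact hK.measure_lt_top⟩
  obtain ⟨C, hC⟩ := hK.exists_bound_of_continuousOn hf.continuousOn
  refine MemLp.of_bound hf.aestronglyMeasurable C ?_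
  exact (ae_restrict_mem hK.measurableSet).mono hC

theorem I_mul_rhsU (p : ℂ × ℂ) :
    Complex.I * rhsU m α β p = -(m : ℂ) * p.2 + N₁ α β p.1 p.2 := by
  rw [rhsU, ← mul_assoc, mul_neg, Complex.I_mul_I]; ring

theorem I_mul_rhsV (p : ℂ × ℂ) :
    Complex.I * rhsV m α β p = -(m : ℂ) * p.1 + N₂ α β p.1 p.2 := by
  rw [rhsV, ← mul_assoc, mul_neg, Complex.I_mul_I]; ring

/-- The derivatives along (1, 1) and (-1, 1) are continuous and the x-derivatives are known, so u_t
= F - u_x and v_t = G + v_x. All are square integrable on every compact set, also on one that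
touches the boundary. -/
theorem isGlobalSolution_of_isCharSol
    (hs : ∀ T, IsCharSol (rhsU m α β) (rhsV m α β) z lam u₀ v₀ T u v)
    {ux vx : ℝ × ℝ → ℂ} (hux : HasWeakDeriv univ (1, 0) u ux) (hvx : HasWeakDeriv univ (1, 0) v vx)
    (hux2 : ∀ K, IsCompact K → MemLp ux 2 (volume.restrict K))
    (hvx2 : ∀ K, IsCompact K → MemLp vx 2 (volume.restrict K)) :
    IsGlobalSolution m α β z lam u₀ v₀ u v ∧ MemH1Loc (Omega z) u ∧ MemH1Loc (Omega z) v := by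
  have hu := (hs 0).continuous_u
  have hv := (hs 0).continuous_v
  have hFc : Continuous fun p => rhsU m α β (u p, v p) :=
    (contDiff_rhsU m α β).continuous.comp (hu.prodMk hv)
  have hGc : Continuous fun p => rhsV m α β (u p, v p) :=
    (contDiff_rhsV m α β).continuous.comp (hu.prodMk hv)
  set U := interior (Omega z) with hU
  have hUo : IsOpen U := isOpen_interior
  have hux' : HasWeakDeriv U (1, 0) u ux := hux.mono (subset_univ _)
  have hvx' : HasWeakDeriv U (1, 0) v vx := hvx.mono (subset_univ _)
  have hut : HasWeakDeriv U (0, 1) u (fun p => rhsU m α β (u p, v p) - ux p) := by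
    have h1 := hasWeakDeriv_of_hasDerivAt hUo hu hFc fun p hp =>
      IsCharSol.hasDerivAt_u hs (contDiff_rhsU m α β).continuous hp
    have h2 := h1.add_dir hUo.measurableSet hux'.neg_dir
    simpa [sub_eq_add_neg, Pi.add_def] using h2
  have hvt : HasWeakDeriv U (0, 1) v (fun p => rhsV m α β (u p, v p) + vx p) := by
    have h1 := hasWeakDeriv_of_hasDerivAt hUo hv hGc fun p hp =>
      IsCharSol.hasDerivAt_v hs (contDiff_rhsV m α β).continuous hp
    have h2 := h1.add_dir hUo.measurableSet hvx'
    simpa [Pi.add_def] using h2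
  have hut2 (K) (hK : IsCompact K) :
      MemLp (fun p => rhsU m α β (u p, v p) - ux p) 2 (volume.restrict K) :=
    (memLp_restrict_of_continuous hFc hK).sub (hux2 K hK)
  have hvt2 (K) (hK : IsCompact K) :
      MemLp (fun p => rhsV m α β (u p, v p) + vx p) 2 (volume.restrict K) :=
    (memLp_restrict_of_continuous hGc hK).add (hvx2 K hK)
  refine ⟨⟨hu.continuousOn, hv.continuousOn, ?_, ?_, ?_, (hs 0).initial, fun t ht =>
    (hs t).boundary t ht le_rfl⟩, ?_, ?_⟩
  · refine ⟨ux, _, ?_, ?_, fun K hK _ => memLp_restrict_of_continuous hu hK,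
      fun K hK _ => hux2 K hK, fun K hK _ => hut2 K hK⟩ <;> rwa [interior_interior]
  · refine ⟨vx, _, ?_, ?_, fun K hK _ => memLp_restrict_of_continuous hv hK,
      fun K hK _ => hvx2 K hK, fun K hK _ => hvt2 K hK⟩ <;> rwa [interior_interior]
  · refine ⟨ux, _, vx, _, ⟨hux', hut, hvx', hvt⟩, ⟨fun K hK _ => hux2 K hK,
      fun K hK _ => hut2 K hK, fun K hK _ => hvx2 K hK, fun K hK _ => hvt2 K hK⟩,
      .of_forall fun p => ?_, .of_forall fun p => ?_⟩
    · rw [sub_add_cancel, I_mul_rhsU]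
    · rw [add_sub_cancel_right, I_mul_rhsV]
  · exact ⟨ux, _, hux', hut, fun K hK _ => memLp_restrict_of_continuous hu hK,
      fun K hK _ => hux2 K hK, fun K hK _ => hut2 K hK⟩
  · exact ⟨vx, _, hvx', hvt, fun K hK _ => memLp_restrict_of_continuous hv hK,
      fun K hK _ => hvx2 K hK, fun K hK _ => hvt2 K hK⟩

theorem EnergyDensity.norm_le {f : ℝ → ℂ} (h : EnergyDensity ρ f) (hρ : Integrable ρ)
    (hρ0 : ∀ x, 0 ≤ ρ x) {x : ℝ} (hx : 0 ≤ x) : ‖f x‖ ≤ √(2 * ∫ s, ρ s) := by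
  refine Real.le_sqrt_of_sq_le ((h.sq_le x hx).trans ?_)
  gcongr
  exact intervalIntegral_le_integral hρ hρ0 (by linarith)

theorem EnergyDensity.integral_sq_le {f g : ℝ → ℂ} (hf : EnergyDensity ρ f)
    (hg : EnergyDensity ρ g) (hfc : ContinuousOn f (Ici 0)) (hgc : ContinuousOn g (Ici 0))
    (hρ : Integrable ρ) (hρ0 : ∀ x, 0 ≤ ρ x) {c : ℝ} (hc : 0 ≤ c) :
    ∫ y in (0:ℝ)..c, (‖f y‖ ^ 2 + ‖g y‖ ^ 2) ≤ 2 * ∫ s, ρ s := by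
  have hi : IntervalIntegrable (fun y => ‖f y‖ ^ 2 + ‖g y‖ ^ 2) volume 0 c := by
    refine ContinuousOn.intervalIntegrable_of_Icc hc ?_
    exact ((hfc.mono Icc_subset_Ici_self).norm.pow 2).add ((hgc.mono Icc_subset_Ici_self).norm.pow 2)
  have h1 : ∫ y in (0:ℝ)..c, (‖f y‖ ^ 2 + ‖g y‖ ^ 2) ≤ ∫ y in (0:ℝ)..c, 2 * ρ y := by
    refine intervalIntegral.integral_mono_on_of_le_Ioo hc hi
      (hρ.const_mul 2).intervalIntegrable fun y hy => ?_
    have := hf.sq_le_self y hy.1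
    have := hg.sq_le_self y hy.1
    linarith
  rw [intervalIntegral.integral_const_mul] at h1
  exact h1.trans (by gcongr; exact intervalIntegral_le_integral hρ hρ0 hc)

theorem dissipative_of_contDiffOn (hz : ContDiffOn ℝ 1 z (Ici 0))
    (H2 : ∀ t : ℝ, 0 ≤ t →
      ‖lam t‖ ^ 2 * (1 - derivWithin z (Ici 0) t) ≤ 1 + derivWithin z (Ici 0) t) :
    Dissipative z lam :=
  fun t ht => ⟨_, hasDerivAt_of_contDiffOn hz ht, H2 t ht.le⟩

end WellPosed

end Dirac

/-- Global well-posedness for `H¹` data. The solution is `H¹` on compact sets up to the boundary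
of `Ω`; uniqueness holds among all solutions that are continuous on `Ω` and `H¹_loc` in its
interior. The functions `u₀`, `v₀` are the continuous representatives of the `H¹` data. -/
theorem theorem2 (m α β : ℝ) (hm : 0 ≤ m) (z : ℝ → ℝ) (lam : ℝ → ℂ)
    (hz : ContDiffOn ℝ 1 z (Ici 0)) (hlam : ContDiffOn ℝ 1 lam (Ici 0))
    (hz0 : z 0 = 0)
    (H1 : ∀ t : ℝ, 0 ≤ t → -1 < derivWithin z (Ici 0) t ∧ derivWithin z (Ici 0) t < 1)
    (H2 : ∀ t : ℝ, 0 ≤ t →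
      ‖lam t‖ ^ 2 * (1 - derivWithin z (Ici 0) t) ≤ 1 + derivWithin z (Ici 0) t)
    (u₀ v₀ : ℝ → ℂ)
    (hu₀ : Dirac.MemH1HalfLine 0 u₀) (hu₀c : ContinuousOn u₀ (Ici 0))
    (hv₀ : Dirac.MemH1HalfLine 0 v₀) (hv₀c : ContinuousOn v₀ (Ici 0))
    (hcomp : u₀ 0 = lam 0 * v₀ 0) :
    ∃ u v : ℝ × ℝ → ℂ,
      Dirac.IsGlobalSolution m α β z lam u₀ v₀ u v ∧
      Dirac.MemH1Loc (Dirac.Omega z) u ∧ Dirac.MemH1Loc (Dirac.Omega z) v ∧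
      (∀ t : ℝ, 0 ≤ t →
        Dirac.MemH1HalfLine (z t) (fun x => u (x, t)) ∧
        Dirac.MemH1HalfLine (z t) (fun x => v (x, t))) ∧
      (∀ u' v' : ℝ × ℝ → ℂ, Dirac.IsGlobalSolution m α β z lam u₀ v₀ u' v' →
        EqOn u' u (Dirac.Omega z) ∧ EqOn v' v (Dirac.Omega z)) := by
  have hzT : Dirac.TimeLike z := Dirac.timeLike_of_contDiffOn hz hz0 H1
  obtain ⟨ρu, hρu, hρu0, hu⟩ := hu₀.exists_energyDensity hu₀c
  obtain ⟨ρv, hρv, hρv0, hv⟩ := hv₀.exists_energyDensity hv₀c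
  -- One density for both data, as the envelope and the moduli of `u` and `v` are coupled.
  set ρ : ℝ → ℝ := fun x => ρu x + ρv x with hρdef
  have hρ : Integrable ρ := hρu.add hρv
  have hρ0 (x) : 0 ≤ ρ x := add_nonneg (hρu0 x) (hρv0 x)
  have hu : Dirac.EnergyDensity ρ u₀ :=
    hu.mono hρu hρ fun x => le_add_of_nonneg_right (hρv0 x)
  have hv : Dirac.EnergyDensity ρ v₀ :=
    hv.mono hρv hρ fun x => le_add_of_nonneg_left (hρu0 x)
  obtain ⟨u, v, hproj, hs, hR⟩ := Dirac.exists_global_isCharSol (α := α) (β := β) hm hzT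
    (Dirac.dissipative_of_contDiffOn hz H2) hlam.continuousOn hu₀c hv₀c
    (fun x hx => hu.norm_le hρ hρ0 hx) (fun x hx => hv.norm_le hρ hρ0 hx)
    (fun c hc => hu.integral_sq_le hv hu₀c hv₀c hρ hρ0 hc) hcomp
  have hstrip T := Dirac.exists_isStripSol hzT (hs T) (hR T)
  obtain ⟨hmu, hmv⟩ := Dirac.hasSliceModulus_of_isStripSol hstrip hz (fun t ht => (H1 t ht).2)
    hlam hρ hρ0 hu hv
  obtain ⟨ux, hux, hux2, huxs⟩ := hmu.exists_weakDeriv (fun p => (hproj p).1) (hs 0).continuous_u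
  obtain ⟨vx, hvx, hvx2, hvxs⟩ := hmv.exists_weakDeriv (fun p => (hproj p).2) (hs 0).continuous_v
  obtain ⟨h1, h2, h3⟩ := Dirac.isGlobalSolution_of_isCharSol hs hux hvx hux2 hvx2
  refine ⟨u, v, h1, h2, h3, fun t ht => ?_, fun u' v' h' => ?_⟩
  · have h4 := Dirac.memLp_slice_of_isStripSol hstrip hρ hρ0 hu hv ht
    exact ⟨⟨_, (huxs t).1.mono (subset_univ _), h4.1, (huxs t).2.restrict _⟩,
      ⟨_, (hvxs t).1.mono (subset_univ _), h4.2, (hvxs t).2.restrict _⟩⟩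
  -- Any competing solution becomes a characteristic solution after composition with `proj`, which
  -- is the identity on the domain.
  · have key (p) (hp : p ∈ Dirac.Omega z) : u' p = u p ∧ v' p = v p := by
      have := Dirac.IsCharSol.eqOn hzT (Dirac.lipOnBalls_rhsU m α β)
        (Dirac.lipOnBalls_rhsV m α β) hlam.continuousOn (hs p.2)
        (Dirac.isCharSol_of_isGlobalSolution hzT h' p.2) hp le_rfl
      simpa only [Function.comp_apply, Dirac.proj_eq hp] using this
    exact ⟨fun p hp => (key p hp).1, fun p hp => (key p hp).2⟩
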